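/- Notation. For positive integers $n,k$ write $[a,b]=\{a,a+1,\dots,b\}$, $[n]=[1,n]$, and $\binom{S}{k}$ for the set of all $k$-subsets of $S$. For $S\subseteq[n]$ let $[S\rangle_k=\{F\in\binom{[n]}{k}: S\subseteq F\}$. A $t$-cover of a family $\mathcal F\subseteq\binom{[n]}{k}$ is a set $T\subseteq[n]$ with $|T\cap F|\ge t$ for all $F\in\mathcal F$, and $\tau_t(\mathcal F)$ is the minimum size of a $t$-cover of $\mathcal F$. Families $\mathcal F_1\subseteq\binom{[n]}{k_1}$ and $\mathcal F_2\subseteq\binom{[n]}{k_2}$ are cross $t$-intersecting if $|F_1\cap F_2|\ge t$ for all $F_1\in\mathcal F_1$, $F_2\in\mathcal F_2$. Write $(\mathcal F_1,\mathcal F_2)\simeq(\mathcal F_1',\mathcal F_2')$ if there is a permutation $\sigma$ of $[n]$ with $\sigma(\mathcal F_1)=\mathcal F_1'$ and $\sigma(\mathcal F_2)=\mathcal F_2'$. Define $$\mathcal A(k,t)=\Big\{F\in\tbinom{[n]}{k}:|F\cap[t+2]|\ge t+1\Big\},$$ $$\mathcal B(k;(a_1,a_2,a_3,a_4))=[\{a_1,a_2\}\rangle_k\cup[\{a_2,a_3\}\rangle_k\cup[\{a_3,a_4\}\rangle_k,$$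 $$\mathcal C_1(\ell,t)=\big\{[\ell+1]\setminus\{i\}:i\in[t+1]\big\}\cup[[t+1]\rangle_\ell,$$ $$\mathcal C_2(k,t;\ell)=\Big\{F\in\tbinom{[n]}{k}:|F\cap[t+1]|=t,\ |F\cap[t+2,\ell+1]|\ge1\Big\}\cup[[t+1]\rangle_k,$$ $$\mathcal H(k,t;X,Y)=\Big\{F\in\tbinom{[n]}{k}:[t]\subseteq F,\ |F\cap Y|\ge1\Big\}\cup\big\{(X\cup[t])\setminus\{i\}:i\in[t]\big\}.$$ Theorem. Let $n,k_1,k_2,t$ be positive integers with $k_1\ge k_2\ge t+1$ and $$n\ge(t+1)^2(k_1+k_2)^2(k_1-t+1)(k_2-t+1)+k_1+k_2-t.$$ Let $\mathcal F_1\subseteq\binom{[n]}{k_1}$ and $\mathcal F_2\subseteq\binom{[n]}{k_2}$ be cross $t$-intersecting families with $\tau_t(\mathcal F_1)\ge t+1$ and $\tau_t(\mathcal F_2)\ge t+1$, such that $|\mathcal F_1||\mathcal F_2|$ is maximum among all such pairs of families. (i) If $t\ge2$, then $(\mathcal F_1,\mathcal F_2)$ is isomorphic ($\simeq$) to $(\mathcal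 A(k_1,t),\mathcal A(k_2,t))$, or to $(\mathcal C_1(k_1,t),\mathcal C_2(k_2,t;k_1))$, or to $(\mathcal H(k_1,t;X,Y),\mathcal H(k_2,t;Y,X))$ for some $X\in\binom{[t+1,n]}{k_1-t+1}$ and $Y\in\binom{[t+1,n]}{k_2-t+1}$ with $|X\cap Y|\ge2$. (ii) If $t=1$, then $(\mathcal F_1,\mathcal F_2)$ is isomorphic to $(\mathcal A(k_1,1),\mathcal A(k_2,1))$, or to $(\mathcal B(k_1;(1,3,2,4)),\mathcal B(k_2;(1,2,3,4)))$, or to $(\mathcal H(k_1,1;X,Y),\mathcal H(k_2,1;Y,X))$ for some $X\in\binom{[2,n]}{k_1}$ and $Y\in\binom{[2,n]}{k_2}$ with $|X\cap Y|\ge1$. -/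

import Mathlib

namespace CrossInt

/-- The ground set `[n] = {1, …, n}`. -/
abbrev seg (n : ℕ) : Finset ℕ := Finset.Icc 1 n

/-- `binom([n], k)`: all `k`-element subsets of `[n]`. -/
abbrev layer (n k : ℕ) : Finset (Finset ℕ) := (seg n).powersetCard k

/-- `[S⟩_k`: all `k`-element subsets of `[n]` that contain `S`. -/
def star (n k : ℕ) (S : Finset ℕ) : Finset (Finset ℕ) :=
  (layer n k).filter fun F => S ⊆ F

/-- `T` is a `t`-cover of the family `𝓕`. -/
def IsTCover (t : ℕ) (𝓕 : Finset (Finset ℕ)) (T : Finset ℕ) : Prop :=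
  ∀ F ∈ 𝓕, t ≤ (T ∩ F).card

/-- The `t`-covering number `τ_t(𝓕)`: the minimum size of a `t`-cover `T ⊆ [n]` of `𝓕`.
(For a family of `k`-subsets of `[n]` with `t ≤ k`, the set `[n]` itself is a `t`-cover,
so the infimum is a minimum; for the empty family the value is `0`.) -/
noncomputable def tau (n t : ℕ) (𝓕 : Finset (Finset ℕ)) : ℕ :=
  sInf {m : ℕ | ∃ T : Finset ℕ, T ⊆ seg n ∧ IsTCover t 𝓕 T ∧ T.card = m}

/-- `𝓕` and `𝓖` are cross `t`-intersecting. -/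
def CrossTIntersecting (t : ℕ) (𝓕 𝓖 : Finset (Finset ℕ)) : Prop :=
  ∀ F ∈ 𝓕, ∀ G ∈ 𝓖, t ≤ (F ∩ G).card

/-- The competing pairs: cross `t`-intersecting families of `k₁`-subsets and of `k₂`-subsets
of `[n]`, both with `t`-covering number at least `t + 1`. -/
structure Admissible (n k₁ k₂ t : ℕ) (𝓕₁ 𝓕₂ : Finset (Finset ℕ)) : Prop where
  subset₁ : 𝓕₁ ⊆ layer n k₁
  subset₂ : 𝓕₂ ⊆ layer n k₂
  cross : CrossTIntersecting t 𝓕₁ 𝓕₂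
  tau₁ : t + 1 ≤ tau n t 𝓕₁
  tau₂ : t + 1 ≤ tau n t 𝓕₂

/-- `(𝓕₁, 𝓕₂)` is a competing pair with maximum product of sizes. -/
def IsExtremal (n k₁ k₂ t : ℕ) (𝓕₁ 𝓕₂ : Finset (Finset ℕ)) : Prop :=
  Admissible n k₁ k₂ t 𝓕₁ 𝓕₂ ∧
    ∀ 𝓖₁ 𝓖₂ : Finset (Finset ℕ), Admissible n k₁ k₂ t 𝓖₁ 𝓖₂ →
      𝓖₁.card * 𝓖₂.card ≤ 𝓕₁.card * 𝓕₂.card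

/-- `σ(𝓕) = {σ(F) : F ∈ 𝓕}`. -/
def permFamily (σ : Equiv.Perm ℕ) (𝓕 : Finset (Finset ℕ)) : Finset (Finset ℕ) :=
  𝓕.image fun F => F.image σ

/-- `(𝓕₁, 𝓕₂) ≃ (𝓖₁, 𝓖₂)`: one permutation of `[n]` (given as a permutation of `ℕ` that maps
`[n]` onto itself) carries `𝓕₁` to `𝓖₁` and `𝓕₂` to `𝓖₂`. -/
def PairIso (n : ℕ) (𝓕₁ 𝓕₂ 𝓖₁ 𝓖₂ : Finset (Finset ℕ)) : Prop :=
  ∃ σ : Equiv.Perm ℕ, (seg n).image σ = seg n ∧ permFamily σ 𝓕₁ = 𝓖₁ ∧ permFamily σ 𝓕₂ = 𝓖₂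

/-- `𝓐(k, t)`. -/
def famA (n k t : ℕ) : Finset (Finset ℕ) :=
  (layer n k).filter fun F => t + 1 ≤ (F ∩ seg (t + 2)).card

/-- `𝓑(k; (a₁, a₂, a₃, a₄))`. -/
def famB (n k a₁ a₂ a₃ a₄ : ℕ) : Finset (Finset ℕ) :=
  star n k {a₁, a₂} ∪ star n k {a₂, a₃} ∪ star n k {a₃, a₄}

/-- `𝓒₁(l, t)`. -/
def famC₁ (n l t : ℕ) : Finset (Finset ℕ) :=
  ((seg (t + 1)).image fun i => seg (l + 1) \ {i}) ∪ star n l (seg (t + 1))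

/-- `𝓒₂(k, t; l)`. -/
def famC₂ (n k t l : ℕ) : Finset (Finset ℕ) :=
  ((layer n k).filter fun F =>
      (F ∩ seg (t + 1)).card = t ∧ 1 ≤ (F ∩ Finset.Icc (t + 2) (l + 1)).card) ∪
    star n k (seg (t + 1))

/-- `𝓗(k, t; X, Y)`. -/
def famH (n k t : ℕ) (X Y : Finset ℕ) : Finset (Finset ℕ) :=
  ((layer n k).filter fun F => seg t ⊆ F ∧ 1 ≤ (F ∩ Y).card) ∪
    (seg t).image fun i => (X ∪ seg t) \ {i}

end CrossInt

open CrossInt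

/-! ### Star sizes, degrees and branching. -/

namespace CrossInt

open Finset

/-! For large `n` a family is governed by the `(t+1)`-sets whose stars it contains, because
prescribing one more element shrinks a star by a factor of order `n / k`. Write `k₁ = t + α + 1`,
`k₂ = t + β + 1`, let `Nᵢ` be the size of the star of a `(t+1)`-set among `kᵢ`-sets, and let `c₁`,
`c₂` count the `t`-covers of size `t + 1` of `𝓕`, `𝓖`. In an extremal pair the star of each such
cover of `𝓖` lies in `𝓕`, and conversely, so `|𝓕||𝓖|` is `c₁c₂N₁N₂` up to lower order.

This is made quantitative from both sides. Branching (`exists_deg_le_mul_deg_insert`) shows that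
both covering numbers equal `t + 1` (`IsExtremal.tau_eq`) and that `|𝓕||𝓖| ≤ (c₁c₂ + 51/100)N₁N₂`
(`IsExtremal.upper`). Bonferroni's inequality, applied to an admissible pair containing `m₁` and
`m₂` stars, gives `|𝓕||𝓖| ≥ (m₁m₂ - 9/20)N₁N₂` (`IsExtremal.starCount_mul_le`). The two errors sum
to less than 1, so integrality yields `c₁c₂ ≥ m₁m₂`. The models supply `m₁m₂ = (t+2)²`,
`(α+2)(β+2)`, `(t+1)(α+1)+1`, and also `2(α+2+t)` when `β = 0`.

The minimal covers of `𝓕` and of `𝓖` are themselves cross `t`-intersecting families of `(t+1)`-sets.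
Under these lower bounds only four configurations survive (`IsExtremal.minCovers_classification`):
all `(t+1)`-subsets of a `(t+2)`-set; two paths on four points (`t = 1`); two sunflowers of maximum
size over a common `t`-set; or a common cover `T` all of whose `t`-subsets have the maximum number
of extensions on the `𝓕` side (`t ≥ 2`). For three of them the covers confine `𝓕` and `𝓖` to a model
pair, and maximality turns inclusion into equality (`IsExtremal.eq_of_subset`); for the sunflowers
an exchange argument is also needed to see that the model is admissible. In the path case both
families are read off directly. -/

/-- The number of `k`-subsets of `[n]` containing a given `m`-subset of `[n]`. -/
def starCount (n k m : ℕ) : ℕ := if m ≤ k then (n - m).choose (k - m) else 0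

/-- The number of members of `𝓕` containing `S`. -/
def deg (𝓕 : Finset (Finset ℕ)) (S : Finset ℕ) : ℕ := (𝓕.filter fun F => S ⊆ F).card

lemma mem_layer {n k : ℕ} {F : Finset ℕ} : F ∈ layer n k ↔ F ⊆ seg n ∧ F.card = k := by
  simp [layer, mem_powersetCard]

lemma mem_star {n k : ℕ} {S F : Finset ℕ} :
    F ∈ star n k S ↔ (F ⊆ seg n ∧ F.card = k) ∧ S ⊆ F := by
  simp [star, mem_powersetCard]

lemma card_seg (n : ℕ) : (seg n).card = n := by simp [seg]

lemma card_star {n k : ℕ} {S : Finset ℕ} (hS : S ⊆ seg n) :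
    (star n k S).card = starCount n k S.card := by
  unfold starCount
  split_ifs with h
  · have hc : (seg n \ S).card = n - S.card := by
      rw [card_sdiff_of_subset hS, card_seg]
    rw [← hc, ← card_powersetCard]
    refine card_bij' (fun F _ => F \ S) (fun R _ => R ∪ S) ?_ ?_ ?_ ?_
    · intro F hF
      rw [mem_star] at hF
      rw [mem_powersetCard, card_sdiff_of_subset hF.2, hF.1.2]
      exact ⟨sdiff_subset_sdiff hF.1.1 le_rfl, rfl⟩
    · intro R hR
      rw [mem_powersetCard] at hR
      have hd : Disjoint R S := disjoint_of_subset_left hR.1 sdiff_disjoint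
      rw [mem_star, card_union_of_disjoint hd, hR.2]
      exact ⟨⟨union_subset (hR.1.trans sdiff_subset) hS, by omega⟩, subset_union_right⟩
    · intro F hF
      rw [mem_star] at hF
      exact sdiff_union_of_subset hF.2
    · intro R hR
      rw [mem_powersetCard] at hR
      exact union_sdiff_cancel_right (disjoint_of_subset_left hR.1 sdiff_disjoint)
  -- The value 0 for `m > k` is essential: truncated subtraction would make the binomial coefficient
  -- 1.
  · rw [card_eq_zero, eq_empty_iff_forall_notMem]
    intro F hF
    rw [mem_star] at hF
    have := card_le_card hF.2
    omega

lemma deg_le_starCount {n k : ℕ} {𝓕 : Finset (Finset ℕ)} (h𝓕 : 𝓕 ⊆ layer n k)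
    {S : Finset ℕ} (hS : S ⊆ seg n) : deg 𝓕 S ≤ starCount n k S.card := by
  rw [← card_star hS]
  refine card_le_card fun F hF => ?_
  rw [mem_filter] at hF
  exact mem_star.2 ⟨mem_layer.1 (h𝓕 hF.1), hF.2⟩

/-- Averaging over `G \ S`. With `u + 1 = t - |S ∩ G|`, every member of `𝓕` containing `S` has at
least `u + 1` elements in `G \ S`, while `|G \ S| = b + u + 1 ≤ (b + 1)(u + 1)`. Hence some `x`
retains a fraction `1 / (b + 1)` of the degree. -/
lemma exists_deg_le_mul_deg_insert {k t b : ℕ} {𝓕 𝓖 : Finset (Finset ℕ)}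
    (hk : k = t + b) (hc : CrossTIntersecting t 𝓕 𝓖) {S G : Finset ℕ} (hG : G ∈ 𝓖)
    (hGk : G.card = k) (hS : (S ∩ G).card < t) :
    ∃ x ∈ G \ S, deg 𝓕 S ≤ (b + 1) * deg 𝓕 (insert x S) := by
  by_contra! hcon
  have hGS : (G \ S).card + (S ∩ G).card = t + b := by
    rw [inter_comm, card_sdiff_add_card_inter, hGk, hk]
  obtain ⟨u, hu⟩ : ∃ u, t = (S ∩ G).card + (u + 1) := ⟨t - (S ∩ G).card - 1, by omega⟩
  have hne : (G \ S).Nonempty := by rw [← card_pos]; omega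
  have hdc : ∑ F ∈ 𝓕 with S ⊆ F, (F ∩ (G \ S)).card = ∑ x ∈ G \ S, deg 𝓕 (insert x S) := by
    have := sum_card_bipartiteAbove_eq_sum_card_bipartiteBelow
      (s := 𝓕.filter fun F => S ⊆ F) (t := G \ S) (fun F x => x ∈ F)
    convert this using 2 with F hF x hx
    · congr 1; ext y; simp [bipartiteAbove, and_comm]
    · unfold deg bipartiteBelow
      rw [filter_filter]
      congr 1; ext y; simp [insert_subset_iff, and_comm]
  have hlow : (u + 1) * deg 𝓕 S ≤ ∑ F ∈ 𝓕 with S ⊆ F, (F ∩ (G \ S)).card := by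
    rw [mul_comm]
    refine card_nsmul_le_sum (𝓕.filter fun F => S ⊆ F) (fun F => (F ∩ (G \ S)).card) (u + 1)
      fun F hF => ?_
    rw [mem_filter] at hF
    have h1 := hc F hF.1 G hG
    have h2 : F ∩ G ⊆ (F ∩ (G \ S)) ∪ (S ∩ G) := by
      intro y hy; simp only [mem_inter, mem_union, mem_sdiff] at hy ⊢; tauto
    have h3 := (card_le_card h2).trans (card_union_le _ _)
    omega
  have hup : (b + 1) * ∑ x ∈ G \ S, deg 𝓕 (insert x S) < (G \ S).card * deg 𝓕 S := by
    rw [mul_sum, ← smul_eq_mul (G \ S).card, ← sum_const]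
    exact sum_lt_sum_of_nonempty hne hcon
  have h5 : (G \ S).card ≤ (b + 1) * (u + 1) := by
    have : (G \ S).card = b + (u + 1) := by omega
    rw [this]; nlinarith [Nat.zero_le (b * u)]
  rw [← hdc] at hup
  have h6 := Nat.mul_le_mul_left (b + 1) hlow
  have h7 := Nat.mul_le_mul_right (deg 𝓕 S) h5
  rw [← mul_assoc] at h6
  omega

/-- A set with fewer than `m` elements is not a `t`-cover of `𝓖`, so it can be enlarged at a cost of
`b + 1` per element until it has `m` elements, where the star bound applies. -/
lemma deg_le_pow_mul_starCount {n k l t b m : ℕ} {𝓕 𝓖 : Finset (Finset ℕ)}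
    (h𝓕 : 𝓕 ⊆ layer n k) (h𝓖 : 𝓖 ⊆ layer n l) (hl : l = t + b)
    (hc : CrossTIntersecting t 𝓕 𝓖)
    (hm : ∀ T ⊆ seg n, IsTCover t 𝓖 T → m ≤ T.card) (d : ℕ) :
    ∀ S ⊆ seg n, S.card + d = m → deg 𝓕 S ≤ (b + 1) ^ d * starCount n k m := by
  induction d with
  | zero =>
    intro S hS hd
    rw [pow_zero, one_mul, ← hd]
    exact deg_le_starCount h𝓕 hS
  | succ d ih =>
    intro S hS hd
    have hnc : ¬ IsTCover t 𝓖 S := fun h => by have := hm S hS h; omega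
    unfold IsTCover at hnc
    push Not at hnc
    obtain ⟨G, hG, hGS⟩ := hnc
    obtain ⟨x, hx, hle⟩ := exists_deg_le_mul_deg_insert hl hc hG (mem_layer.1 (h𝓖 hG)).2 hGS
    rw [mem_sdiff] at hx
    have hxS : insert x S ⊆ seg n :=
      insert_subset ((mem_layer.1 (h𝓖 hG)).1 hx.1) hS
    have := ih _ hxS (by rw [card_insert_of_notMem hx.2]; omega)
    calc deg 𝓕 S ≤ (b + 1) * deg 𝓕 (insert x S) := hle
      _ ≤ (b + 1) * ((b + 1) ^ d * starCount n k m) := Nat.mul_le_mul_left _ this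
      _ = _ := by ring

/-- Each member of `𝓕` contains one of the `t`-subsets of the cover `T`. -/
lemma card_le_choose_mul {t B : ℕ} {𝓕 : Finset (Finset ℕ)} {T : Finset ℕ}
    (hT : IsTCover t 𝓕 T) (hB : ∀ S ⊆ T, S.card = t → deg 𝓕 S ≤ B) :
    𝓕.card ≤ T.card.choose t * B := by
  have hsub : 𝓕 ⊆ (T.powersetCard t).biUnion fun S => 𝓕.filter fun F => S ⊆ F := by
    intro F hF
    obtain ⟨S, hS, hSc⟩ := exists_subset_card_eq (hT F hF)
    rw [mem_biUnion]
    exact ⟨S, mem_powersetCard.2 ⟨hS.trans inter_subset_left, hSc⟩,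
      mem_filter.2 ⟨hF, hS.trans inter_subset_right⟩⟩
  calc 𝓕.card ≤ _ := card_le_card hsub
    _ ≤ ∑ S ∈ T.powersetCard t, deg 𝓕 S := card_biUnion_le
    _ ≤ ∑ _S ∈ T.powersetCard t, B := sum_le_sum fun S hS => by
        rw [mem_powersetCard] at hS; exact hB S hS.1 hS.2
    _ = _ := by rw [sum_const, card_powersetCard, smul_eq_mul]

lemma starCount_succ_mul_le {n k m Q : ℕ} (h : m ≤ k → (k - m) * Q ≤ n - m) :
    Q * starCount n k (m + 1) ≤ starCount n k m := by
  unfold starCount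
  split_ifs with h1 h2
  · obtain ⟨c, hc⟩ : ∃ c, k - m = c + 1 := ⟨k - m - 1, by omega⟩
    have hQ := h h2
    rw [hc] at hQ
    rcases Nat.eq_zero_or_pos Q with rfl | hpos
    · simp
    obtain ⟨d, hd⟩ : ∃ d, n - m = d + 1 := ⟨n - m - 1, by
      have : 0 < (c + 1) * Q := by positivity
      omega⟩
    rw [hd] at hQ
    rw [hc, hd, show k - (m + 1) = c by omega, show n - (m + 1) = d by omega]
    have key := Nat.add_one_mul_choose_eq d c
    refine Nat.le_of_mul_le_mul_right ?_ (Nat.succ_pos c)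
    rw [Nat.succ_eq_add_one, ← key]
    calc Q * d.choose c * (c + 1) = ((c + 1) * Q) * d.choose c := by ring
      _ ≤ (d + 1) * d.choose c := Nat.mul_le_mul_right _ hQ
  · omega
  · simp
  · simp

lemma starCount_succ_mul_eq {n t a : ℕ} (hn : t + a + 2 ≤ n) :
    (n - t - 1) * starCount n (t + (a + 1)) (t + 2) = a * starCount n (t + (a + 1)) (t + 1) := by
  unfold starCount
  rw [if_pos (show t + 1 ≤ t + (a + 1) by omega)]
  split_ifs with h
  · obtain ⟨c, rfl⟩ : ∃ c, a = c + 1 := ⟨a - 1, by omega⟩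
    obtain ⟨d, hd⟩ : ∃ d, n - t - 1 = d + 1 := ⟨n - t - 2, by omega⟩
    rw [hd, show n - (t + 2) = d by omega, show n - (t + 1) = d + 1 by omega,
      show t + (c + 1 + 1) - (t + 2) = c by omega,
      show t + (c + 1 + 1) - (t + 1) = c + 1 by omega, Nat.add_one_mul_choose_eq]
    ring
  · have : a = 0 := by omega
    subst this; simp

lemma starCount_pos {n k m : ℕ} (hm : m ≤ k) (hk : k ≤ n) : 0 < starCount n k m := by
  unfold starCount
  rw [if_pos hm]
  exact Nat.choose_pos (by omega)

/-- Bonferroni's inequality for a union of stars of `(t+1)`-sets. -/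
lemma two_mul_card_mul_starCount_le {n k t : ℕ} {𝓤 : Finset (Finset ℕ)}
    (h𝓤 : 𝓤 ⊆ layer n (t + 1)) :
    2 * (𝓤.card * starCount n k (t + 1)) ≤
      2 * (𝓤.biUnion (star n k)).card + 𝓤.card ^ 2 * starCount n k (t + 2) := by
  induction 𝓤 using Finset.induction_on with
  | empty => simp
  | insert W 𝓤 hW ih =>
    have hW' := mem_layer.1 (h𝓤 (mem_insert_self _ _))
    have ih := ih ((subset_insert _ _).trans h𝓤)
    rw [biUnion_insert, card_insert_of_notMem hW]
    have hu := card_union_add_card_inter (star n k W) (𝓤.biUnion (star n k))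
    rw [card_star hW'.1, hW'.2] at hu
    -- Distinct `(t+1)`-sets have a union of at least `t + 2` elements, so two of the stars overlap
    -- inside the star of a `(t+2)`-set. The quadratic error closes the induction by `m² + 2m ≤ (m +
    -- 1)²`.
    have hi : (star n k W ∩ 𝓤.biUnion (star n k)).card ≤ 𝓤.card * starCount n k (t + 2) := by
      rw [inter_biUnion]
      refine card_biUnion_le_card_mul _ _ _ fun V hV => ?_
      have hV' := mem_layer.1 (h𝓤 (mem_insert_of_mem hV))
      have hlt : W.card < (W ∪ V).card := by
        refine card_lt_card (ssubset_of_subset_of_ne subset_union_left fun h => hW ?_)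
        have : V ⊆ W := by rw [h]; exact subset_union_right
        rwa [← eq_of_subset_of_card_le this (by omega)]
      obtain ⟨Z, hZ, hZc⟩ := exists_subset_card_eq (show t + 2 ≤ (W ∪ V).card by omega)
      rw [← hZc, ← card_star (hZ.trans (union_subset hW'.1 hV'.1))]
      refine card_le_card fun F hF => ?_
      rw [mem_inter, mem_star, mem_star] at hF
      exact mem_star.2 ⟨hF.1.1, hZ.trans (union_subset hF.1.2 hF.2.2)⟩
    nlinarith [Nat.zero_le (starCount n k (t + 2))]

end CrossInt

/-! ### Covering numbers, minimal covers and extensions of a `t`-set. -/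

namespace CrossInt

open Finset

section Tau

variable {n k t : ℕ} {𝓕 𝓖 : Finset (Finset ℕ)}

lemma tau_le_card {T : Finset ℕ} (hT : T ⊆ seg n) (hc : IsTCover t 𝓕 T) : tau n t 𝓕 ≤ T.card :=
  Nat.sInf_le ⟨T, hT, hc, rfl⟩

lemma isTCover_seg (h𝓕 : 𝓕 ⊆ layer n k) (hk : t ≤ k) : IsTCover t 𝓕 (seg n) := by
  intro F hF
  have := mem_layer.1 (h𝓕 hF)
  rw [inter_eq_right.2 this.1, this.2]
  exact hk

lemma exists_isTCover_card_eq_tau (h𝓕 : 𝓕 ⊆ layer n k) (hk : t ≤ k) :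
    ∃ T ⊆ seg n, IsTCover t 𝓕 T ∧ T.card = tau n t 𝓕 :=
  Nat.sInf_mem (s := {m : ℕ | ∃ T : Finset ℕ, T ⊆ seg n ∧ IsTCover t 𝓕 T ∧ T.card = m})
    ⟨_, seg n, Subset.rfl, isTCover_seg h𝓕 hk, rfl⟩

lemma tau_mono (h : 𝓕 ⊆ 𝓖) (h𝓖 : 𝓖 ⊆ layer n k) (hk : t ≤ k) : tau n t 𝓕 ≤ tau n t 𝓖 := by
  obtain ⟨T, hT, hc, hcard⟩ := exists_isTCover_card_eq_tau h𝓖 hk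
  rw [← hcard]
  exact tau_le_card hT fun F hF => hc F (h hF)

lemma nonempty_of_tau_pos (h : 0 < tau n t 𝓕) : 𝓕.Nonempty := by
  by_contra hne
  rw [not_nonempty_iff_eq_empty] at hne
  have := tau_le_card (n := n) (t := t) (𝓕 := 𝓕) (T := ∅) (by simp) (by simp [hne, IsTCover])
  simp at this
  omega

/-- A `t`-cover with at most `t` elements of a nonempty family has exactly `t` elements and lies in
every member. Nonemptiness matters because the empty family has covering number 0. -/
lemma succ_le_tau (h𝓕 : 𝓕 ⊆ layer n k) (hk : t ≤ k) (hne : 𝓕.Nonempty)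
    (h : ∀ T : Finset ℕ, T.card = t → ∃ F ∈ 𝓕, ¬ T ⊆ F) : t + 1 ≤ tau n t 𝓕 := by
  obtain ⟨T, -, hc, hcard⟩ := exists_isTCover_card_eq_tau h𝓕 hk
  rw [← hcard]
  by_contra! hlt
  obtain ⟨F₀, hF₀⟩ := hne
  have h0 := (hc F₀ hF₀).trans (card_le_card inter_subset_left)
  obtain ⟨F, hF, hTF⟩ := h T (by omega)
  have h1 := hc F hF
  refine hTF ?_
  rw [← inter_eq_left]
  exact eq_of_subset_of_card_le inter_subset_left (by omega)

end Tau

lemma CrossTIntersecting.symm {t : ℕ} {𝓕 𝓖 : Finset (Finset ℕ)} (h : CrossTIntersecting t 𝓕 𝓖) :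
    CrossTIntersecting t 𝓖 𝓕 := fun F hF G hG => by rw [inter_comm]; exact h G hG F hF

lemma Admissible.symm {n k l t : ℕ} {𝓕 𝓖 : Finset (Finset ℕ)} (h : Admissible n k l t 𝓕 𝓖) :
    Admissible n l k t 𝓖 𝓕 := ⟨h.subset₂, h.subset₁, h.cross.symm, h.tau₂, h.tau₁⟩

lemma IsExtremal.symm {n k l t : ℕ} {𝓕 𝓖 : Finset (Finset ℕ)} (h : IsExtremal n k l t 𝓕 𝓖) :
    IsExtremal n l k t 𝓖 𝓕 :=
  ⟨h.1.symm, fun 𝓖₁ 𝓖₂ hG => by rw [mul_comm, mul_comm 𝓖.card]; exact h.2 _ _ hG.symm⟩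

lemma Admissible.nonempty_left {n k l t : ℕ} {𝓕 𝓖 : Finset (Finset ℕ)}
    (h : Admissible n k l t 𝓕 𝓖) : 𝓕.Nonempty :=
  nonempty_of_tau_pos (lt_of_lt_of_le (Nat.succ_pos t) h.tau₁)

lemma Admissible.nonempty_right {n k l t : ℕ} {𝓕 𝓖 : Finset (Finset ℕ)}
    (h : Admissible n k l t 𝓕 𝓖) : 𝓖.Nonempty := h.symm.nonempty_left

/-- In an extremal pair, the first family contains every set that `t`-intersects all members of
the second one. -/
lemma IsExtremal.mem_left {n k l t : ℕ} {𝓕 𝓖 : Finset (Finset ℕ)} (h : IsExtremal n k l t 𝓕 𝓖)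
    (hk : t ≤ k) {F : Finset ℕ} (hF : F ∈ layer n k) (hc : ∀ G ∈ 𝓖, t ≤ (F ∩ G).card) :
    F ∈ 𝓕 := by
  by_contra hnot
  have hsub : insert F 𝓕 ⊆ layer n k := insert_subset hF h.1.subset₁
  have hadm : Admissible n k l t (insert F 𝓕) 𝓖 :=
    ⟨hsub, h.1.subset₂, fun A hA B hB => by
      rcases mem_insert.1 hA with rfl | hA
      · exact hc B hB
      · exact h.1.cross A hA B hB,
      h.1.tau₁.trans (tau_mono (subset_insert _ _) hsub hk), h.1.tau₂⟩
  have h1 := h.2 _ _ hadm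
  rw [card_insert_of_notMem hnot] at h1
  have := h.1.nonempty_right.card_pos
  nlinarith

/-- The `t`-covers of size `t + 1` of a family. -/
noncomputable def minCovers (n t : ℕ) (𝓕 : Finset (Finset ℕ)) : Finset (Finset ℕ) :=
  open Classical in (layer n (t + 1)).filter fun T => IsTCover t 𝓕 T

lemma mem_minCovers {n t : ℕ} {𝓕 : Finset (Finset ℕ)} {T : Finset ℕ} :
    T ∈ minCovers n t 𝓕 ↔ (T ⊆ seg n ∧ T.card = t + 1) ∧ IsTCover t 𝓕 T := by
  classical
  simp [minCovers, mem_powersetCard]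

section Extremal

variable {n k l t : ℕ} {𝓕 𝓖 : Finset (Finset ℕ)}

/-- A superset of a `t`-cover of `𝓖` meets every member of `𝓖` in `t` elements, so maximality
already placed it in `𝓕`. -/
lemma IsExtremal.star_subset_left (h : IsExtremal n k l t 𝓕 𝓖) (hk : t ≤ k) {T : Finset ℕ}
    (hT : T ∈ minCovers n t 𝓖) : star n k T ⊆ 𝓕 := by
  intro F hF
  rw [mem_star] at hF
  refine h.mem_left hk (mem_layer.2 hF.1) fun G hG => ?_
  exact ((mem_minCovers.1 hT).2 G hG).trans (card_le_card (inter_subset_inter_right hF.2))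

lemma exists_mem_layer_superset {Z W : Finset ℕ} (hW : W ⊆ seg n) (hWk : W.card ≤ k)
    (hd : Disjoint W Z) (hn : k + Z.card ≤ n) :
    ∃ F ∈ layer n k, W ⊆ F ∧ Disjoint F Z := by
  have h1 : W ⊆ seg n \ Z := subset_sdiff.2 ⟨hW, hd⟩
  have h2 : k ≤ (seg n \ Z).card := by
    have := le_card_sdiff Z (seg n)
    rw [card_seg] at this
    omega
  obtain ⟨F, hWF, hF, hFk⟩ := exists_subsuperset_card_eq h1 hWk h2
  rw [subset_sdiff] at hF
  exact ⟨F, mem_layer.2 ⟨hF.1, hFk⟩, hWF, hF.2⟩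

/-- The whole star of `V` lies in `𝓕`; since `n` is large, it has a member avoiding `T \ V`. As `T`
covers that member, its `t` common elements lie in `V`. -/
lemma IsExtremal.le_card_inter_minCovers (h : IsExtremal n k l t 𝓕 𝓖) (hk : t + 1 ≤ k)
    (hl : t + 1 ≤ l) (hn : k + l ≤ n) {T V : Finset ℕ} (hT : T ∈ minCovers n t 𝓕)
    (hV : V ∈ minCovers n t 𝓖) : t ≤ (T ∩ V).card := by
  have hT' := mem_minCovers.1 hT
  have hV' := mem_minCovers.1 hV
  obtain ⟨F, hF, hVF, hFT⟩ := exists_mem_layer_superset (k := k) (W := V) (Z := T \ V) hV'.1.1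
    (by omega) disjoint_sdiff (by
      have := card_le_card (sdiff_subset (s := T) (t := V)); omega)
  have hF𝓕 : F ∈ 𝓕 := h.star_subset_left (by omega) hV (mem_star.2 ⟨mem_layer.1 hF, hVF⟩)
  refine (hT'.2 F hF𝓕).trans (card_le_card fun x hx => ?_)
  rw [mem_inter] at hx ⊢
  refine ⟨hx.1, ?_⟩
  by_contra hxV
  exact disjoint_left.1 hFT hx.2 (mem_sdiff.2 ⟨hx.1, hxV⟩)

lemma Admissible.card_cover_ge (h : Admissible n k l t 𝓕 𝓖) {T : Finset ℕ} (hT : T ⊆ seg n)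
    (hc : IsTCover t 𝓕 T) : t + 1 ≤ T.card := h.tau₁.trans (tau_le_card hT hc)

lemma Admissible.exists_not_subset (h : Admissible n k l t 𝓕 𝓖) {S : Finset ℕ} (hS : S ⊆ seg n)
    (hSc : S.card = t) : ∃ F ∈ 𝓕, ¬ S ⊆ F := by
  by_contra! hcon
  have := h.card_cover_ge hS fun F hF => by rw [inter_eq_left.2 (hcon F hF), hSc]
  omega

/-- The elements that extend `S` to a minimal `t`-cover of `𝓕`. -/
noncomputable def extensions (n t : ℕ) (𝓕 : Finset (Finset ℕ)) (S : Finset ℕ) : Finset ℕ :=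
  (seg n).filter fun x => x ∉ S ∧ insert x S ∈ minCovers n t 𝓕

lemma mem_extensions {S : Finset ℕ} {x : ℕ} :
    x ∈ extensions n t 𝓕 S ↔ x ∉ S ∧ insert x S ∈ minCovers n t 𝓕 := by
  simp only [extensions, mem_filter, and_iff_right_iff_imp]
  rintro ⟨-, h⟩
  exact (mem_minCovers.1 h).1.1 (mem_insert_self _ _)

lemma card_extensions {S : Finset ℕ} (hS : S.card = t) :
    (extensions n t 𝓕 S).card = ((minCovers n t 𝓕).filter fun T => S ⊆ T).card := by
  refine card_bij (fun x _ => insert x S) ?_ ?_ ?_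
  · intro x hx
    exact mem_filter.2 ⟨(mem_extensions.1 hx).2, subset_insert _ _⟩
  · intro x hx y hy hxy
    rw [mem_extensions] at hx hy
    have : x ∈ insert y S := hxy ▸ mem_insert_self x S
    exact (mem_insert.1 this).resolve_right hx.1
  · intro T hT
    rw [mem_filter] at hT
    have hTc := (mem_minCovers.1 hT.1).1.2
    have h1 : (T \ S).card = 1 := by rw [card_sdiff_of_subset hT.2]; omega
    obtain ⟨x, hx⟩ := card_eq_one.1 h1
    have hxm : x ∈ T \ S := by rw [hx]; exact mem_singleton_self _
    have hins : insert x S = T := by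
      rw [insert_eq, ← hx, sdiff_union_of_subset hT.2]
    exact ⟨x, mem_extensions.2 ⟨(mem_sdiff.1 hxm).2, hins ▸ hT.1⟩, hins⟩

/-- A member of `𝓕` not containing `S` contains all extensions of `S`
and all but one elements of `S`. -/
lemma extensions_subset_of_not_subset {S F : Finset ℕ} (hS : S.card = t) (hF : F ∈ 𝓕)
    (hSF : ¬ S ⊆ F) : extensions n t 𝓕 S ⊆ F \ S := by
  intro x hx
  rw [mem_extensions] at hx
  refine mem_sdiff.2 ⟨?_, hx.1⟩
  by_contra hxF
  have h1 := (mem_minCovers.1 hx.2).2 F hF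
  rw [insert_inter_of_notMem hxF] at h1
  refine hSF ?_
  rw [← inter_eq_left]
  exact eq_of_subset_of_card_le inter_subset_left (by omega)

/-- One extension `x` contributes at most one element to `F`, so covering by `insert x S` lets `F`
miss only one element of `S`. -/
lemma card_inter_of_not_subset {S F : Finset ℕ} (hS : S.card = t) (hF : F ∈ 𝓕)
    (hSF : ¬ S ⊆ F) (hne : (extensions n t 𝓕 S).Nonempty) : (S ∩ F).card + 1 = t := by
  obtain ⟨x, hx⟩ := hne
  rw [mem_extensions] at hx
  have h1 := (mem_minCovers.1 hx.2).2 F hF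
  have h2 : (insert x S ∩ F).card ≤ (S ∩ F).card + 1 := by
    refine (card_le_card (t := insert x (S ∩ F)) fun y hy => ?_).trans (card_insert_le _ _)
    simp only [mem_inter, mem_insert] at hy ⊢
    tauto
  have h3 : (S ∩ F).card < S.card :=
    card_lt_card (ssubset_of_subset_of_ne inter_subset_left fun h => hSF (inter_eq_left.1 h))
  omega

/-- Some `F ∈ 𝓕` does not contain `S`. If there is any extension, `F` spends exactly `t - 1`
elements on `S`, and its other `a + 1` elements must include all extensions. -/
lemma Admissible.card_extensions_le {a : ℕ} (h : Admissible n (t + a) l t 𝓕 𝓖) {S : Finset ℕ}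
    (hSs : S ⊆ seg n) (hS : S.card = t) : (extensions n t 𝓕 S).card ≤ a + 1 := by
  rcases (extensions n t 𝓕 S).eq_empty_or_nonempty with he | hne
  · simp [he]
  obtain ⟨F, hF, hSF⟩ := h.exists_not_subset hSs hS
  have h1 := card_le_card (extensions_subset_of_not_subset (n := n) hS hF hSF)
  have h2 := card_inter_of_not_subset hS hF hSF hne
  have h3 := card_sdiff_add_card_inter F S
  rw [inter_comm, (mem_layer.1 (h.subset₁ hF)).2] at h3
  omega

/-- If `S` has the maximum number of extensions, the members of `𝓕` that do not contain `S` are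
determined up to the missing element of `S`. -/
lemma eq_of_card_extensions_eq {a : ℕ} (h𝓕 : 𝓕 ⊆ layer n (t + a)) {S F : Finset ℕ}
    (hS : S.card = t) (hF : F ∈ 𝓕) (hSF : ¬ S ⊆ F)
    (hX : (extensions n t 𝓕 S).card = a + 1) :
    ∃ s ∈ S, F = (extensions n t 𝓕 S ∪ S) \ {s} := by
  have hne : (extensions n t 𝓕 S).Nonempty := by rw [← card_pos]; omega
  have h1 := extensions_subset_of_not_subset (n := n) hS hF hSF
  have h2 := card_inter_of_not_subset hS hF hSF hne
  have h3 := card_sdiff_add_card_inter F S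
  rw [inter_comm, (mem_layer.1 (h𝓕 hF)).2] at h3
  have h4 := eq_of_subset_of_card_le h1 (by omega)
  have h5 : (S \ F).card = 1 := by
    have := card_sdiff_add_card_inter S F; omega
  obtain ⟨s, hs⟩ := card_eq_one.1 h5
  have hsm : ∀ y, y ∈ S ∧ y ∉ F ↔ y = s := fun y => by
    rw [← mem_sdiff, hs, mem_singleton]
  refine ⟨s, ((hsm s).2 rfl).1, ?_⟩
  rw [h4]
  ext y
  simp only [mem_sdiff, mem_union, mem_singleton, ← hsm]
  tauto

/-- Fix a minimal cover of `𝓕`: every minimal cover of `𝓖` contains one of its `t + 1` subsets of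
size `t`, each having at most `b + 1` extensions. -/
lemma Admissible.card_minCovers_le {b : ℕ} (h : Admissible n k (t + b) t 𝓕 𝓖)
    (hcr : ∀ T ∈ minCovers n t 𝓕, ∀ V ∈ minCovers n t 𝓖, t ≤ (T ∩ V).card)
    (hne : (minCovers n t 𝓕).Nonempty) :
    (minCovers n t 𝓖).card ≤ (t + 1) * (b + 1) := by
  obtain ⟨T, hT⟩ := hne
  have hT' := mem_minCovers.1 hT
  have := card_le_choose_mul (t := t) (B := b + 1) (𝓕 := minCovers n t 𝓖) (T := T)
    (fun V hV => hcr T hT V hV) (fun S hS hSc => by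
      have := h.symm.card_extensions_le (hS.trans hT'.1.1) hSc
      rwa [card_extensions hSc] at this)
  rwa [hT'.1.2, Nat.choose_succ_self_right] at this

/-- The main upper bound for one family of an admissible pair. -/
lemma Admissible.card_le_of_minCovers {b : ℕ} (h : Admissible n k (t + b) t 𝓕 𝓖)
    (hne : (minCovers n t 𝓕).Nonempty) :
    𝓕.card ≤ (minCovers n t 𝓖).card * starCount n k (t + 1) +
      (t + 1) * (b + 1) ^ 2 * starCount n k (t + 2) := by
  classical
  obtain ⟨T, hT⟩ := hne
  have hT' := mem_minCovers.1 hT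
  -- The members of `𝓕` outside the main term; they are to be bounded by stars of `(t+2)`-sets.
  set 𝓗 := 𝓕.filter fun F => ¬ ∃ V ∈ minCovers n t 𝓖, V ⊆ F with h𝓗
  have h𝓗s : 𝓗 ⊆ layer n k := (filter_subset _ _).trans h.subset₁
  have hsplit : 𝓕.card ≤ ((minCovers n t 𝓖).biUnion (star n k)).card + 𝓗.card := by
    refine (card_le_card fun F hF => ?_).trans (card_union_le _ _)
    rw [mem_union]
    by_cases hV : ∃ V ∈ minCovers n t 𝓖, V ⊆ F
    · obtain ⟨V, hV, hVF⟩ := hV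
      exact Or.inl (mem_biUnion.2 ⟨V, hV, mem_star.2 ⟨mem_layer.1 (h.subset₁ hF), hVF⟩⟩)
    · exact Or.inr (mem_filter.2 ⟨hF, hV⟩)
  have h1 : ((minCovers n t 𝓖).biUnion (star n k)).card ≤
      (minCovers n t 𝓖).card * starCount n k (t + 1) := by
    refine card_biUnion_le_card_mul _ _ _ fun V hV => ?_
    have hV' := mem_minCovers.1 hV
    rw [card_star hV'.1.1, hV'.1.2]
  have hc𝓗 : CrossTIntersecting t 𝓗 𝓖 := fun F hF G hG => h.cross F (mem_filter.1 hF).1 G hG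
  have hstep : ∀ S ⊆ seg n, ¬ IsTCover t 𝓖 S →
      ∃ x ∈ seg n, x ∉ S ∧ deg 𝓗 S ≤ (b + 1) * deg 𝓗 (insert x S) := by
    intro S hS hnc
    unfold IsTCover at hnc
    push Not at hnc
    obtain ⟨G, hG, hGS⟩ := hnc
    have hG' := mem_layer.1 (h.subset₂ hG)
    obtain ⟨x, hx, hle⟩ := exists_deg_le_mul_deg_insert rfl hc𝓗 hG hG'.2 hGS
    rw [mem_sdiff] at hx
    exact ⟨x, hG'.1 hx.1, hx.2, hle⟩
  -- Branch twice from a `t`-subset `S` of `T`. After the first step `insert x S` is either a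
  -- minimal cover of `𝓖`, contained in no member of `𝓗`, or not a cover, so that a second step is
  -- available.
  have h2 : 𝓗.card ≤ T.card.choose t * ((b + 1) ^ 2 * starCount n k (t + 2)) := by
    refine card_le_choose_mul (fun F hF => hT'.2 F (mem_filter.1 hF).1) fun S hST hSc => ?_
    have hS := hST.trans hT'.1.1
    obtain ⟨x, hx, hxS, hle⟩ := hstep S hS fun hc => by
      have := h.symm.card_cover_ge hS hc; omega
    have hxS' : insert x S ⊆ seg n := insert_subset hx hS
    have hxc : (insert x S).card = t + 1 := by rw [card_insert_of_notMem hxS, hSc]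
    by_cases hcov : IsTCover t 𝓖 (insert x S)
    · have : deg 𝓗 (insert x S) = 0 := by
        unfold deg
        rw [card_eq_zero, filter_eq_empty_iff]
        intro F hF hsub
        exact (mem_filter.1 hF).2 ⟨_, mem_minCovers.2 ⟨⟨hxS', hxc⟩, hcov⟩, hsub⟩
      rw [this] at hle
      omega
    · obtain ⟨y, hy, hyS, hle'⟩ := hstep _ hxS' hcov
      have h3 := deg_le_starCount h𝓗s (insert_subset hy hxS')
      rw [card_insert_of_notMem hyS, hxc] at h3
      calc deg 𝓗 S ≤ (b + 1) * deg 𝓗 (insert x S) := hle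
        _ ≤ (b + 1) * ((b + 1) * starCount n k (t + 2)) :=
          Nat.mul_le_mul_left _ (hle'.trans (Nat.mul_le_mul_left _ h3))
        _ = _ := by ring
  rw [hT'.1.2, Nat.choose_succ_self_right, ← mul_assoc] at h2
  omega

end Extremal

end CrossInt

/-! ### Model pairs on arbitrary base sets and their admissibility. -/

namespace CrossInt

open Finset

/-- The `k`-sets meeting `U` in at least `t + 1` elements. -/
def genA (n k t : ℕ) (U : Finset ℕ) : Finset (Finset ℕ) :=
  (layer n k).filter fun F => t + 1 ≤ (F ∩ U).card

/-- The family `𝓗` with `[t]` replaced by an arbitrary set `S`. -/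
def genH (n k : ℕ) (S X Y : Finset ℕ) : Finset (Finset ℕ) :=
  ((layer n k).filter fun F => S ⊆ F ∧ 1 ≤ (F ∩ Y).card) ∪ S.image fun i => (X ∪ S) \ {i}

/-- The family `𝓒₁` with `[t+1]` and `[t+2, l+1]` replaced by arbitrary sets. -/
def genC₁ (n k : ℕ) (T X : Finset ℕ) : Finset (Finset ℕ) :=
  (T.image fun i => (X ∪ T) \ {i}) ∪ star n k T

/-- The family `𝓒₂` with `[t+1]` and `[t+2, l+1]` replaced by arbitrary sets. -/
def genC₂ (n k t : ℕ) (T X : Finset ℕ) : Finset (Finset ℕ) :=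
  ((layer n k).filter fun F => (F ∩ T).card = t ∧ 1 ≤ (F ∩ X).card) ∪ star n k T

variable {n k l t : ℕ}

lemma exists_not_subset_of_star {𝓖 : Finset (Finset ℕ)} {W T : Finset ℕ} {x : ℕ}
    (hW : W ⊆ seg n) (hWk : W.card ≤ k) (hn : k + 1 ≤ n) (h : star n k W ⊆ 𝓖)
    (hxT : x ∈ T) (hxW : x ∉ W) : ∃ F ∈ 𝓖, ¬ T ⊆ F := by
  obtain ⟨F, hF, hWF, hd⟩ := exists_mem_layer_superset (Z := {x}) hW hWk
    (disjoint_singleton_right.2 hxW) (by simpa using hn)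
  exact ⟨F, h (mem_star.2 ⟨mem_layer.1 hF, hWF⟩),
    fun hT => disjoint_singleton_right.1 hd (hT hxT)⟩

lemma star_nonempty {W : Finset ℕ} (hW : W ⊆ seg n) (hWk : W.card ≤ k) (hn : k ≤ n) :
    (star n k W).Nonempty := by
  rw [← card_pos, card_star hW]
  exact starCount_pos hWk hn

section A

variable {U : Finset ℕ}

lemma genA_subset : genA n k t U ⊆ layer n k := filter_subset _ _

lemma star_subset_genA {W : Finset ℕ} (hW : W ∈ U.powersetCard (t + 1)) :
    star n k W ⊆ genA n k t U := by
  intro F hF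
  rw [mem_star] at hF
  rw [mem_powersetCard] at hW
  exact mem_filter.2 ⟨mem_layer.2 hF.1, hW.2 ▸ card_le_card (subset_inter hF.2 hW.1)⟩

lemma succ_le_tau_genA (hU : U ⊆ seg n) (hUc : U.card = t + 2) (ht : 1 ≤ t) (hk : t + 1 ≤ k)
    (hn : k + 1 ≤ n) : t + 1 ≤ tau n t (genA n k t U) := by
  have key : ∀ x, ∃ W ∈ U.powersetCard (t + 1), x ∉ W := by
    intro x
    obtain ⟨W, hW, hWc⟩ := exists_subset_card_eq (show t + 1 ≤ (U \ {x}).card by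
      have := le_card_sdiff {x} U; rw [card_singleton] at this; omega)
    rw [subset_sdiff, disjoint_singleton_right] at hW
    exact ⟨W, mem_powersetCard.2 ⟨hW.1, hWc⟩, hW.2⟩
  refine succ_le_tau genA_subset (by omega) ?_ fun T hT => ?_
  · obtain ⟨W, hW, -⟩ := key 0
    have hW' := mem_powersetCard.1 hW
    exact (star_nonempty (hW'.1.trans hU) (by omega) (by omega)).mono (star_subset_genA hW)
  · obtain ⟨x, hx⟩ : T.Nonempty := by rw [← card_pos]; omega
    obtain ⟨W, hW, hxW⟩ := key x
    have hW' := mem_powersetCard.1 hW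
    exact exists_not_subset_of_star (hW'.1.trans hU) (by omega) hn (star_subset_genA hW) hx hxW

lemma admissible_genA (hU : U ⊆ seg n) (hUc : U.card = t + 2) (ht : 1 ≤ t) (hk : t + 1 ≤ k)
    (hl : t + 1 ≤ l) (hkn : k + 1 ≤ n) (hln : l + 1 ≤ n) :
    Admissible n k l t (genA n k t U) (genA n l t U) := by
  refine ⟨genA_subset, genA_subset, fun F hF G hG => ?_, succ_le_tau_genA hU hUc ht hk hkn,
    succ_le_tau_genA hU hUc ht hl hln⟩
  have hF := (mem_filter.1 hF).2
  have hG := (mem_filter.1 hG).2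
  have h1 := card_union_add_card_inter (F ∩ U) (G ∩ U)
  have h2 := card_le_card (union_subset (inter_subset_right (s₁ := F) (s₂ := U))
    (inter_subset_right (s₁ := G) (s₂ := U)))
  have h3 : (F ∩ U) ∩ (G ∩ U) ⊆ F ∩ G := inter_subset_inter inter_subset_left inter_subset_left
  have h4 := card_le_card h3
  omega

end A

section H

variable {S X Y : Finset ℕ}

lemma mem_genH {F : Finset ℕ} : F ∈ genH n k S X Y ↔
    (F ∈ layer n k ∧ S ⊆ F ∧ 1 ≤ (F ∩ Y).card) ∨ ∃ i ∈ S, (X ∪ S) \ {i} = F := by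
  simp [genH]

lemma card_union_sdiff_singleton {i : ℕ} (hd : Disjoint X S) (hi : i ∈ S) :
    ((X ∪ S) \ {i}).card + 1 = X.card + S.card := by
  rw [card_sdiff_of_subset (singleton_subset_iff.2 (mem_union_right _ hi)),
    card_union_of_disjoint hd, card_singleton]
  have : 0 < S.card := card_pos.2 ⟨i, hi⟩
  omega

lemma genH_subset (hS : S ⊆ seg n) (hX : X ⊆ seg n) (hd : Disjoint X S)
    (hc : X.card + S.card = k + 1) : genH n k S X Y ⊆ layer n k := by
  intro F hF
  rcases mem_genH.1 hF with h | ⟨i, hi, rfl⟩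
  · exact h.1
  · have := card_union_sdiff_singleton hd hi
    exact mem_layer.2 ⟨sdiff_subset.trans (union_subset hX hS), by omega⟩

lemma star_subset_genH {y : ℕ} (hy : y ∈ Y) : star n k (insert y S) ⊆ genH n k S X Y := by
  intro F hF
  rw [mem_star, insert_subset_iff] at hF
  exact mem_genH.2 (Or.inl ⟨mem_layer.2 hF.1, hF.2.2,
    card_pos.2 ⟨y, mem_inter.2 ⟨hF.2.1, hy⟩⟩⟩)

lemma succ_le_tau_genH (hS : S ⊆ seg n) (hX : X ⊆ seg n) (hY : Y ⊆ seg n) (hd : Disjoint X S)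
    (hSc : S.card = t) (ht : 1 ≤ t) (hc : X.card + t = k + 1) (hk : t + 1 ≤ k)
    (hY2 : 2 ≤ Y.card) (hn : k + 1 ≤ n) : t + 1 ≤ tau n t (genH n k S X Y) := by
  have hle : ∀ y, (insert y S).card ≤ k := fun y => (card_insert_le _ _).trans (by omega)
  refine succ_le_tau (genH_subset hS hX hd (hSc ▸ hc)) (by omega) ?_ fun T hT => ?_
  · obtain ⟨y, hy⟩ : Y.Nonempty := by rw [← card_pos]; omega
    exact (star_nonempty (insert_subset (hY hy) hS) (hle y) (by omega)).mono (star_subset_genH hy)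
  · by_cases hTS : T ⊆ S
    · have hTS' : T = S := eq_of_subset_of_card_le hTS (by omega)
      obtain ⟨s, hs⟩ : S.Nonempty := by rw [← card_pos]; omega
      refine ⟨_, mem_genH.2 (Or.inr ⟨s, hs, rfl⟩), fun h => ?_⟩
      have := h (hTS' ▸ hs)
      simp at this
    · obtain ⟨x, hxT, hxS⟩ := not_subset.1 hTS
      obtain ⟨y, hy, hyx⟩ := exists_mem_ne (show 1 < Y.card by omega) x
      refine exists_not_subset_of_star (insert_subset (hY hy) hS) (hle y) hn
        (star_subset_genH hy) hxT ?_
      rw [mem_insert, not_or]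
      exact ⟨hyx.symm, hxS⟩

/-- The element `i` missing from `G` is compensated by an element of `F ∩ X`, which lies outside
`S`. -/
lemma le_card_inter_of_superset {F G : Finset ℕ} {i : ℕ} (hd : Disjoint X S)
    (hSF : S ⊆ F) (hFX : 1 ≤ (F ∩ X).card) (hG : G = (X ∪ S) \ {i}) (hi : i ∈ S) :
    S.card ≤ (F ∩ G).card := by
  obtain ⟨x, hx⟩ := card_pos.1 hFX
  rw [mem_inter] at hx
  have hxS : x ∉ S := disjoint_left.1 hd hx.2
  have hsub : insert x (S \ {i}) ⊆ F ∩ G := by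
    intro y hy
    rw [mem_insert, mem_sdiff, mem_singleton] at hy
    rw [hG, mem_inter, mem_sdiff, mem_union, mem_singleton]
    rcases hy with rfl | hy
    · exact ⟨hx.1, Or.inl hx.2, fun h => hxS (h ▸ hi)⟩
    · exact ⟨hSF hy.1, Or.inr hy.1, hy.2⟩
  have h1 := card_le_card hsub
  rw [card_insert_of_notMem (fun h => hxS (mem_sdiff.1 h).1),
    card_sdiff_of_subset (singleton_subset_iff.2 hi), card_singleton] at h1
  omega

/-- The critical pairs are `(X ∪ S) \ {i}` and `(Y ∪ S) \ {j}`. They share `X ∩ Y` and all of `S`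
except at most two elements, so two common elements of `X` and `Y` suffice. For `t = 1` only one
element of `S` can be lost, and one suffices. -/
lemma crossTIntersecting_genH (hdX : Disjoint X S) (hdY : Disjoint Y S) (hSc : S.card = t)
    (hXY : 2 ≤ (X ∩ Y).card ∨ t = 1 ∧ 1 ≤ (X ∩ Y).card) :
    CrossTIntersecting t (genH n k S X Y) (genH n l S Y X) := by
  intro F hF G hG
  rw [mem_genH] at hF hG
  rcases hF with hF | ⟨i, hi, rfl⟩ <;> rcases hG with hG | ⟨j, hj, rfl⟩
  · rw [← hSc]
    exact card_le_card (subset_inter hF.2.1 hG.2.1)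
  · rw [← hSc]
    exact le_card_inter_of_superset hdY hF.2.1 hF.2.2 rfl hj
  · rw [← hSc, inter_comm]
    exact le_card_inter_of_superset hdX hG.2.1 hG.2.2 rfl hi
  · have hsub : (X ∩ Y) ∪ (S \ {i, j}) ⊆ ((X ∪ S) \ {i}) ∩ ((Y ∪ S) \ {j}) := by
      intro y hy
      have h1 : y ∈ X → y ∉ S := fun h => disjoint_left.1 hdX h
      simp only [mem_union, mem_inter, mem_sdiff, mem_insert, mem_singleton, not_or] at hy ⊢
      rcases hy with hy | hy
      · exact ⟨⟨Or.inl hy.1, fun h => h1 hy.1 (h ▸ hi)⟩, Or.inl hy.2, fun h => h1 hy.1 (h ▸ hj)⟩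
      · tauto
    have h1 := card_le_card hsub
    rw [card_union_of_disjoint (disjoint_of_subset_left inter_subset_left
      (disjoint_of_subset_right sdiff_subset hdX))] at h1
    have h2 := le_card_sdiff {i, j} S
    have h3 := card_le_two (a := i) (b := j)
    rcases hXY with h | ⟨h, h'⟩ <;> omega

lemma admissible_genH (hS : S ⊆ seg n) (hX : X ⊆ seg n) (hY : Y ⊆ seg n) (hdX : Disjoint X S)
    (hdY : Disjoint Y S) (hSc : S.card = t) (ht : 1 ≤ t) (hXc : X.card + t = k + 1)
    (hYc : Y.card + t = l + 1) (hk : t + 1 ≤ k) (hl : t + 1 ≤ l) (hkn : k + 1 ≤ n)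
    (hln : l + 1 ≤ n) (hXY : 2 ≤ (X ∩ Y).card ∨ t = 1 ∧ 1 ≤ (X ∩ Y).card) :
    Admissible n k l t (genH n k S X Y) (genH n l S Y X) :=
  ⟨genH_subset hS hX hdX (hSc ▸ hXc), genH_subset hS hY hdY (hSc ▸ hYc),
    crossTIntersecting_genH hdX hdY hSc hXY,
    succ_le_tau_genH hS hX hY hdX hSc ht hXc hk (by omega) hkn,
    succ_le_tau_genH hS hY hX hdY hSc ht hYc hl (by omega) hln⟩

end H

section C

variable {T X : Finset ℕ}

lemma mem_genC₁ {F : Finset ℕ} : F ∈ genC₁ n k T X ↔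
    (∃ i ∈ T, (X ∪ T) \ {i} = F) ∨ F ∈ star n k T := by
  simp [genC₁]

lemma mem_genC₂ {F : Finset ℕ} : F ∈ genC₂ n k t T X ↔
    (F ∈ layer n k ∧ (F ∩ T).card = t ∧ 1 ≤ (F ∩ X).card) ∨ F ∈ star n k T := by
  simp [genC₂]

lemma genC₁_subset (hT : T ⊆ seg n) (hX : X ⊆ seg n) (hd : Disjoint X T)
    (hc : X.card + T.card = k + 1) : genC₁ n k T X ⊆ layer n k := by
  intro F hF
  rcases mem_genC₁.1 hF with ⟨i, hi, rfl⟩ | h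
  · have := card_union_sdiff_singleton hd hi
    exact mem_layer.2 ⟨sdiff_subset.trans (union_subset hX hT), by omega⟩
  · exact mem_layer.2 (mem_star.1 h).1

lemma genC₂_subset : genC₂ n k t T X ⊆ layer n k :=
  union_subset (filter_subset _ _) (filter_subset _ _)

lemma star_subset_genC₂ (hTc : T.card = t + 1) {i x : ℕ} (hx : x ∈ X) :
    star n k (insert x (T \ {i})) ⊆ genC₂ n k t T X := by
  intro F hF
  rw [mem_star, insert_subset_iff] at hF
  rw [mem_genC₂]
  by_cases hTF : T ⊆ F
  · exact Or.inr (mem_star.2 ⟨hF.1, hTF⟩)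
  · refine Or.inl ⟨mem_layer.2 hF.1, ?_, card_pos.2 ⟨x, mem_inter.2 ⟨hF.2.1, hx⟩⟩⟩
    have h1 := card_le_card (subset_inter hF.2.2 (sdiff_subset (s := T) (t := {i})))
    have h2 := le_card_sdiff {i} T
    rw [card_singleton] at h2
    have h3 : (F ∩ T).card < T.card :=
      card_lt_card (ssubset_of_subset_of_ne inter_subset_right fun h => hTF (inter_eq_right.1 h))
    omega

lemma succ_le_tau_genC₁ (hT : T ⊆ seg n) (hX : X ⊆ seg n) (hd : Disjoint X T)
    (hTc : T.card = t + 1) (ht : 1 ≤ t) (hc : X.card + t = k) (hX1 : 1 ≤ X.card)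
    (hn : k + 1 ≤ n) : t + 1 ≤ tau n t (genC₁ n k T X) := by
  have hst : star n k T ⊆ genC₁ n k T X := subset_union_right
  refine succ_le_tau (genC₁_subset hT hX hd (by omega)) (by omega)
    ((star_nonempty hT (by omega) (by omega)).mono hst) fun V hV => ?_
  obtain ⟨x, hx⟩ : V.Nonempty := by rw [← card_pos]; omega
  by_cases hxT : x ∈ T
  · refine ⟨_, mem_genC₁.2 (Or.inl ⟨x, hxT, rfl⟩), fun h => ?_⟩
    have := h hx
    simp at this
  · exact exists_not_subset_of_star hT (by omega) hn hst hx hxT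

lemma succ_le_tau_genC₂ (hT : T ⊆ seg n) (hX : X ⊆ seg n) (hd : Disjoint X T)
    (hTc : T.card = t + 1) (ht : 1 ≤ t) (hk : t + 1 ≤ k) (hX1 : 1 ≤ X.card)
    (hn : k + 1 ≤ n) : t + 1 ≤ tau n t (genC₂ n k t T X) := by
  have hst : star n k T ⊆ genC₂ n k t T X := subset_union_right
  refine succ_le_tau genC₂_subset (by omega)
    ((star_nonempty hT (by omega) (by omega)).mono hst) fun V hV => ?_
  obtain ⟨x, hx⟩ : V.Nonempty := by rw [← card_pos]; omega
  by_cases hxT : x ∈ T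
  · obtain ⟨y, hy⟩ := card_pos.1 hX1
    refine exists_not_subset_of_star (insert_subset (hX hy) (sdiff_subset.trans hT)) ?_ hn
      (star_subset_genC₂ hTc (i := x) hy) hx ?_
    · refine (card_insert_le _ _).trans ?_
      rw [card_sdiff_of_subset (singleton_subset_iff.2 hxT), card_singleton]
      omega
    · rw [mem_insert, not_or]
      exact ⟨fun h => disjoint_left.1 hd hy (h ▸ hxT), by simp⟩
  · exact exists_not_subset_of_star hT (by omega) hn hst hx hxT

lemma crossTIntersecting_genC (hd : Disjoint X T) (hTc : T.card = t + 1) :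
    CrossTIntersecting t (genC₁ n k T X) (genC₂ n l t T X) := by
  intro F hF G hG
  rw [mem_genC₁] at hF
  rw [mem_genC₂] at hG
  have hGT : t ≤ (G ∩ T).card := by
    rcases hG with hG | hG
    · omega
    · rw [inter_eq_right.2 (mem_star.1 hG).2]; omega
  rcases hF with ⟨i, hi, rfl⟩ | hF
  · rcases hG with hG | hG
    · obtain ⟨x, hx⟩ := card_pos.1 hG.2.2
      rw [mem_inter] at hx
      have hxT : x ∉ T := disjoint_left.1 hd hx.2
      have hsub : insert x ((G ∩ T) \ {i}) ⊆ ((X ∪ T) \ {i}) ∩ G := by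
        intro y hy
        simp only [mem_insert, mem_sdiff, mem_inter, mem_union, mem_singleton] at hy ⊢
        rcases hy with rfl | hy
        · exact ⟨⟨Or.inl hx.2, fun h => hxT (h ▸ hi)⟩, hx.1⟩
        · tauto
      have h1 := card_le_card hsub
      rw [card_insert_of_notMem (fun h => hxT (mem_inter.1 (mem_sdiff.1 h).1).2)] at h1
      have h2 := le_card_sdiff {i} (G ∩ T)
      rw [card_singleton] at h2
      omega
    · have hsub : T \ {i} ⊆ ((X ∪ T) \ {i}) ∩ G :=
        subset_inter (sdiff_subset_sdiff subset_union_right le_rfl)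
          (sdiff_subset.trans (mem_star.1 hG).2)
      have h1 := card_le_card hsub
      have h2 := le_card_sdiff {i} T
      rw [card_singleton] at h2
      omega
  · rw [inter_comm F]
    exact hGT.trans (card_le_card (inter_subset_inter_left (mem_star.1 hF).2))

lemma admissible_genC (hT : T ⊆ seg n) (hX : X ⊆ seg n) (hd : Disjoint X T)
    (hTc : T.card = t + 1) (ht : 1 ≤ t) (hc : X.card + t = k) (hX1 : 1 ≤ X.card)
    (hl : t + 1 ≤ l) (hkn : k + 1 ≤ n) (hln : l + 1 ≤ n) :
    Admissible n k l t (genC₁ n k T X) (genC₂ n l t T X) :=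
  ⟨genC₁_subset hT hX hd (by omega), genC₂_subset, crossTIntersecting_genC hd hTc,
    succ_le_tau_genC₁ hT hX hd hTc ht hc hX1 hkn,
    succ_le_tau_genC₂ hT hX hd hTc ht hl hX1 hln⟩

end C

end CrossInt

/-! ### Numerical bounds for the product of sizes. -/

namespace CrossInt

open Finset

section Numeric

/-- Here `G₁ ≥ m₁N₁(1 - m₁x/2)`, and similarly for `G₂`. Relative to `N₁N₂` the product loses at
most `(m₁²m₂x + m₁m₂²y)/2`, which `he` caps at `9/20`. -/
lemma le_mul_of_bonferroni {G₁ G₂ N₁ N₂ P₁ P₂ m₁ m₂ x y : ℝ} (hN₁ : 0 ≤ N₁) (hN₂ : 0 ≤ N₂)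
    (hx : 0 ≤ x) (hy : 0 ≤ y) (hP₁ : P₁ = x * N₁) (hP₂ : P₂ = y * N₂) (hm₁ : 1 ≤ m₁)
    (hm₂ : 1 ≤ m₂) (h₁ : 2 * (m₁ * N₁) ≤ 2 * G₁ + m₁ ^ 2 * P₁)
    (h₂ : 2 * (m₂ * N₂) ≤ 2 * G₂ + m₂ ^ 2 * P₂)
    (he : 10 * (m₁ ^ 2 * m₂ * x + m₁ * m₂ ^ 2 * y) ≤ 9) :
    (20 * (m₁ * m₂) - 9) * (N₁ * N₂) ≤ 20 * (G₁ * G₂) := by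
  have hA : 0 ≤ m₁ ^ 2 * m₂ * x := by positivity
  have hB : 0 ≤ m₁ * m₂ ^ 2 * y := by positivity
  have h1x : m₁ * x ≤ m₁ ^ 2 * m₂ * x := by
    have h12 : 1 ≤ m₁ * m₂ := by nlinarith
    calc m₁ * x = 1 * (m₁ * x) := by ring
      _ ≤ (m₁ * m₂) * (m₁ * x) := mul_le_mul_of_nonneg_right h12 (by positivity)
      _ = _ := by ring
  have h2y : m₂ * y ≤ m₁ * m₂ ^ 2 * y := by
    have h12 : 1 ≤ m₁ * m₂ := by nlinarith
    calc m₂ * y = 1 * (m₂ * y) := by ring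
      _ ≤ (m₁ * m₂) * (m₂ * y) := mul_le_mul_of_nonneg_right h12 (by positivity)
      _ = _ := by ring
  have g1 : N₁ * (m₁ * (1 - m₁ * x / 2)) ≤ G₁ := by rw [hP₁] at h₁; linarith
  have g2 : N₂ * (m₂ * (1 - m₂ * y / 2)) ≤ G₂ := by rw [hP₂] at h₂; linarith
  have p1 : 0 ≤ 1 - m₁ * x / 2 := by linarith
  have p2 : 0 ≤ 1 - m₂ * y / 2 := by linarith
  have q1 : 0 ≤ N₁ * (m₁ * (1 - m₁ * x / 2)) := by positivity
  have q2 : 0 ≤ N₂ * (m₂ * (1 - m₂ * y / 2)) := by positivity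
  have hprod := mul_le_mul g1 g2 q2 (q1.trans g1)
  have hNN : 0 ≤ N₁ * N₂ := by positivity
  have hxy : 0 ≤ m₁ * m₂ * (m₁ * x) * (m₂ * y) := by positivity
  have hfin : 20 * (m₁ * m₂) - 9 ≤ 20 * ((m₁ * (1 - m₁ * x / 2)) * (m₂ * (1 - m₂ * y / 2))) := by
    linarith
  calc (20 * (m₁ * m₂) - 9) * (N₁ * N₂)
      ≤ 20 * ((m₁ * (1 - m₁ * x / 2)) * (m₂ * (1 - m₂ * y / 2))) * (N₁ * N₂) :=
        mul_le_mul_of_nonneg_right hfin hNN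
    _ = 20 * (N₁ * (m₁ * (1 - m₁ * x / 2)) * (N₂ * (m₂ * (1 - m₂ * y / 2)))) := by ring
    _ ≤ _ := by linarith

/-- The relative errors are `e₁ = B/(tK²)` and `e₂ = A/(tK²)`. In `(c₂ + e₁)(c₁ + e₂)` each mixed
term is at most `AB/K² ≤ 1/4` and `e₁e₂ ≤ 1/100`, whence `51/100`. The variable `t` will be
instantiated with `t + 1`. -/
lemma mul_le_of_minCovers {F₁ F₂ N₁ N₂ E₁ E₂ c₁ c₂ A B K t : ℝ} (hN₁ : 0 ≤ N₁) (hN₂ : 0 ≤ N₂)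
    (ht : 2 ≤ t) (hK : 4 ≤ K) (hA : 0 ≤ A) (hB : 0 ≤ B) (hAB : 4 * (A * B) ≤ K ^ 2)
    (hF₁0 : 0 ≤ F₁) (hF₂0 : 0 ≤ F₂)
    (hF₁ : F₁ ≤ c₂ * N₁ + E₁) (hF₂ : F₂ ≤ c₁ * N₂ + E₂)
    (hE₁ : t * K ^ 2 * E₁ ≤ B * N₁) (hE₂ : t * K ^ 2 * E₂ ≤ A * N₂)
    (hc₁ : c₁ ≤ t * A) (hc₂ : c₂ ≤ t * B) :
    100 * (F₁ * F₂) ≤ (100 * (c₁ * c₂) + 51) * (N₁ * N₂) := by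
  have hQ : 0 < t * K ^ 2 := by positivity
  set e₁ := B / (t * K ^ 2) with he₁
  set e₂ := A / (t * K ^ 2) with he₂
  have he₁0 : 0 ≤ e₁ := by positivity
  have he₂0 : 0 ≤ e₂ := by positivity
  have g1 : F₁ ≤ (c₂ + e₁) * N₁ := by
    have : E₁ ≤ e₁ * N₁ := by
      rw [he₁, div_mul_eq_mul_div, le_div_iff₀ hQ]; linarith
    linarith
  have g2 : F₂ ≤ (c₁ + e₂) * N₂ := by
    have : E₂ ≤ e₂ * N₂ := by
      rw [he₂, div_mul_eq_mul_div, le_div_iff₀ hQ]; linarith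
    linarith
  have hprod := mul_le_mul g1 g2 hF₂0 (hF₁0.trans g1)
  have k1 : c₂ * e₂ ≤ 1 / 4 := by
    calc c₂ * e₂ ≤ (t * B) * e₂ := mul_le_mul_of_nonneg_right hc₂ he₂0
      _ = A * B / K ^ 2 := by rw [he₂]; field_simp
      _ ≤ 1 / 4 := by rw [div_le_div_iff₀ (by positivity) (by norm_num)]; linarith
  have k2 : c₁ * e₁ ≤ 1 / 4 := by
    calc c₁ * e₁ ≤ (t * A) * e₁ := mul_le_mul_of_nonneg_right hc₁ he₁0
      _ = A * B / K ^ 2 := by rw [he₁]; field_simp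
      _ ≤ 1 / 4 := by rw [div_le_div_iff₀ (by positivity) (by norm_num)]; linarith
  have k3 : e₁ * e₂ ≤ 1 / 100 := by
    have : e₁ * e₂ = (A * B) / (t * K ^ 2) ^ 2 := by rw [he₁, he₂]; field_simp
    rw [this, div_le_div_iff₀ (by positivity) (by norm_num)]
    have h1 : 16 ≤ K ^ 2 := by nlinarith
    have h2 : 4 ≤ t ^ 2 := by nlinarith
    have h3 : 64 ≤ t ^ 2 * K ^ 2 := by nlinarith
    have h4 : 64 * K ^ 2 ≤ t ^ 2 * K ^ 2 * K ^ 2 := mul_le_mul_of_nonneg_right h3 (by positivity)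
    nlinarith
  have hNN : 0 ≤ N₁ * N₂ := by positivity
  have hfin : 100 * ((c₂ + e₁) * (c₁ + e₂)) ≤ 100 * (c₁ * c₂) + 51 := by nlinarith
  calc 100 * (F₁ * F₂) ≤ 100 * ((c₂ + e₁) * N₁ * ((c₁ + e₂) * N₂)) := by linarith
    _ = 100 * ((c₂ + e₁) * (c₁ + e₂)) * (N₁ * N₂) := by ring
    _ ≤ _ := mul_le_mul_of_nonneg_right hfin hNN

end Numeric

variable {n t α β : ℕ}

/-- The lower bound on `n` in the theorem, for `k₁ = t + α + 1` and `k₂ = t + β + 1`. -/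
def LargeGround (n t α β : ℕ) : Prop :=
  (t + 1) ^ 2 * (2 * t + α + β + 2) ^ 2 * (α + 2) * (β + 2) + (t + α + β + 2) ≤ n

lemma LargeGround.symm (h : LargeGround n t α β) : LargeGround n t β α := by
  unfold LargeGround at *
  calc _ = (t + 1) ^ 2 * (2 * t + α + β + 2) ^ 2 * (α + 2) * (β + 2) + (t + α + β + 2) := by ring
    _ ≤ n := h

lemma LargeGround.le_sub (h : LargeGround n t α β) :
    (t + 1) ^ 2 * (2 * t + α + β + 2) ^ 2 * (α + 2) * (β + 2) ≤ n - t - 1 := by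
  unfold LargeGround at h
  omega

lemma LargeGround.add_le (h : LargeGround n t α β) :
    (t + (α + 1)) + (t + (β + 1)) + 1 ≤ n := by
  have h1 : 1 * (2 * t + α + β + 2) * 1 * 1 ≤
      (t + 1) ^ 2 * (2 * t + α + β + 2) ^ 2 * (α + 2) * (β + 2) :=
    Nat.mul_le_mul (Nat.mul_le_mul (Nat.mul_le_mul (Nat.one_le_pow _ _ (by omega))
      (Nat.le_self_pow two_ne_zero _)) (by omega)) (by omega)
  unfold LargeGround at h
  omega

/-- Star sizes drop by the ratio `(n - m)/(k₁ - m)`. The factor `α + 2` in the bound on `n` absorbs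
`k₁ - m`, and its additive term absorbs the subtracted `m`. -/
lemma LargeGround.mul_starCount_succ_le (h : LargeGround n t α β) {m : ℕ} (hm : t + 1 ≤ m) :
    ((t + 1) ^ 2 * (2 * t + α + β + 2) ^ 2 * (β + 2)) * starCount n (t + (α + 1)) (m + 1) ≤
      starCount n (t + (α + 1)) m := by
  refine starCount_succ_mul_le fun hmk => ?_
  have h1 : (t + (α + 1) - m) * ((t + 1) ^ 2 * (2 * t + α + β + 2) ^ 2 * (β + 2)) ≤
      (α + 2) * ((t + 1) ^ 2 * (2 * t + α + β + 2) ^ 2 * (β + 2)) :=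
    Nat.mul_le_mul_right _ (by omega)
  have h2 : (α + 2) * ((t + 1) ^ 2 * (2 * t + α + β + 2) ^ 2 * (β + 2)) =
      (t + 1) ^ 2 * (2 * t + α + β + 2) ^ 2 * (α + 2) * (β + 2) := by ring
  unfold LargeGround at h
  omega

lemma LargeGround.pow_mul_starCount_le (h : LargeGround n t α β) (d : ℕ) :
    ((t + 1) ^ 2 * (2 * t + α + β + 2) ^ 2 * (β + 2)) ^ d *
      starCount n (t + (α + 1)) (t + 1 + d) ≤ starCount n (t + (α + 1)) (t + 1) := by
  induction d with
  | zero => simp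
  | succ d ih =>
    refine le_trans ?_ ih
    rw [pow_succ, mul_assoc]
    exact Nat.mul_le_mul_left _ (h.mul_starCount_succ_le (Nat.le_add_right _ _))

lemma choose_add_le_pow (t i : ℕ) : (t + i).choose t ≤ (t + 1) ^ i := by
  induction i with
  | zero => simp
  | succ i ih =>
    have h1 := Nat.add_one_mul_choose_eq (t + i) i
    rw [Nat.choose_symm_add] at ih
    rw [Nat.choose_symm_add, ← add_assoc]
    refine Nat.le_of_mul_le_mul_right ?_ (Nat.succ_pos i)
    rw [Nat.succ_eq_add_one, ← h1, pow_succ]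
    calc (t + i + 1) * (t + i).choose i ≤ ((t + 1) * (i + 1)) * (t + 1) ^ i :=
          Nat.mul_le_mul (by nlinarith [Nat.zero_le (t * i)]) ih
      _ = _ := by ring

/-- Upper bound for one family of an admissible pair in terms of the covering numbers. -/
lemma Admissible.card_mul_pow_le {𝓕 𝓖 : Finset (Finset ℕ)}
    (h : Admissible n (t + (α + 1)) (t + (β + 1)) t 𝓕 𝓖) (hn : LargeGround n t α β) {i j : ℕ}
    (hi : tau n t 𝓕 = t + (i + 1)) (hj : tau n t 𝓖 = t + (j + 1)) :
    𝓕.card * ((t + 1) ^ 2 * (2 * t + α + β + 2) ^ 2) ^ j ≤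
      (t + 1) ^ (i + 1) * (β + 2) * starCount n (t + (α + 1)) (t + 1) := by
  obtain ⟨T, hT, hTc, hTcard⟩ := exists_isTCover_card_eq_tau h.subset₁ (Nat.le_add_right _ _)
  -- Pass from a minimum cover of `𝓕` to a `t`-subset of it, then branch `j + 1` times against `𝓖`.
  -- Of the resulting factors `β + 2`, all but one are cancelled by the decay of star sizes from `t
  -- + 1` to `t + 1 + j`.
  have h1 : 𝓕.card ≤ T.card.choose t *
      ((β + 1 + 1) ^ (j + 1) * starCount n (t + (α + 1)) (t + (j + 1))) :=
    card_le_choose_mul hTc fun S hST hSc =>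
      deg_le_pow_mul_starCount h.subset₁ h.subset₂ rfl h.cross
        (fun V hV hVc => hj ▸ tau_le_card hV hVc) (j + 1) S (hST.trans hT) (by omega)
  rw [hTcard, hi] at h1
  have h2 := choose_add_le_pow t (i + 1)
  have h3 := hn.pow_mul_starCount_le j
  rw [show t + 1 + j = t + (j + 1) by ring] at h3
  set R := (t + 1) ^ 2 * (2 * t + α + β + 2) ^ 2
  set s := starCount n (t + (α + 1)) (t + (j + 1))
  calc 𝓕.card * R ^ j
      ≤ ((t + (i + 1)).choose t * ((β + 1 + 1) ^ (j + 1) * s)) * R ^ j := Nat.mul_le_mul_right _ h1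
    _ ≤ ((t + 1) ^ (i + 1) * ((β + 1 + 1) ^ (j + 1) * s)) * R ^ j := by gcongr
    _ = (t + 1) ^ (i + 1) * (β + 2) * ((R * (β + 2)) ^ j * s) := by rw [mul_pow R]; ring
    _ ≤ _ := Nat.mul_le_mul_left _ h3

section Extremal

variable {𝓕 𝓖 : Finset (Finset ℕ)}

lemma cast_starCount_eq (hn : LargeGround n t α β) :
    (starCount n (t + (α + 1)) (t + 2) : ℝ) =
      α / (n - t - 1 : ℕ) * starCount n (t + (α + 1)) (t + 1) := by
  have h1 := starCount_succ_mul_eq (n := n) (t := t) (a := α) (by have := hn.add_le; omega)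
  have h2 : (0 : ℝ) < (n - t - 1 : ℕ) := by
    have := hn.add_le
    exact_mod_cast (show 0 < n - t - 1 by omega)
  rw [div_mul_eq_mul_div, eq_div_iff h2.ne', mul_comm]
  exact_mod_cast h1

/-- An extremal pair has at least the size forced by the stars in any admissible pair. -/
lemma IsExtremal.starCount_mul_le (h : IsExtremal n (t + (α + 1)) (t + (β + 1)) t 𝓕 𝓖)
    (hn : LargeGround n t α β) {𝓖₁ 𝓖₂ 𝓤₁ 𝓤₂ : Finset (Finset ℕ)}
    (hadm : Admissible n (t + (α + 1)) (t + (β + 1)) t 𝓖₁ 𝓖₂)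
    (hu₁ : 𝓤₁ ⊆ layer n (t + 1)) (hu₂ : 𝓤₂ ⊆ layer n (t + 1))
    (hs₁ : ∀ W ∈ 𝓤₁, star n (t + (α + 1)) W ⊆ 𝓖₁) (hs₂ : ∀ W ∈ 𝓤₂, star n (t + (β + 1)) W ⊆ 𝓖₂)
    (hne₁ : 1 ≤ 𝓤₁.card) (hne₂ : 1 ≤ 𝓤₂.card)
    (he : 10 * (𝓤₁.card ^ 2 * 𝓤₂.card * α + 𝓤₁.card * 𝓤₂.card ^ 2 * β) ≤ 9 * (n - t - 1)) :
    (20 * (𝓤₁.card * 𝓤₂.card : ℝ) - 9) *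
      (starCount n (t + (α + 1)) (t + 1) * starCount n (t + (β + 1)) (t + 1)) ≤
      20 * (𝓕.card * 𝓖.card) := by
  have hD : (0 : ℝ) < (n - t - 1 : ℕ) := by
    have := hn.add_le
    exact_mod_cast (show 0 < n - t - 1 by omega)
  have b1 := two_mul_card_mul_starCount_le (k := t + (α + 1)) hu₁
  have b2 := two_mul_card_mul_starCount_le (k := t + (β + 1)) hu₂
  have c1 := card_le_card (biUnion_subset.2 hs₁)
  have c2 := card_le_card (biUnion_subset.2 hs₂)
  have d1 : 2 * (𝓤₁.card * starCount n (t + (α + 1)) (t + 1)) ≤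
    2 * 𝓖₁.card + 𝓤₁.card ^ 2 * starCount n (t + (α + 1)) (t + 2) := by omega
  have d2 : 2 * (𝓤₂.card * starCount n (t + (β + 1)) (t + 1)) ≤
    2 * 𝓖₂.card + 𝓤₂.card ^ 2 * starCount n (t + (β + 1)) (t + 2) := by omega
  have hmax : (𝓖₁.card * 𝓖₂.card : ℝ) ≤ 𝓕.card * 𝓖.card := by exact_mod_cast h.2 _ _ hadm
  have he' : (10 * (𝓤₁.card ^ 2 * 𝓤₂.card * α + 𝓤₁.card * 𝓤₂.card ^ 2 * β) : ℝ) ≤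
    9 * (n - t - 1 : ℕ) := by exact_mod_cast he
  have key := le_mul_of_bonferroni (G₁ := 𝓖₁.card) (G₂ := 𝓖₂.card)
    (N₁ := starCount n (t + (α + 1)) (t + 1)) (N₂ := starCount n (t + (β + 1)) (t + 1))
    (m₁ := 𝓤₁.card) (m₂ := 𝓤₂.card) (x := α / (n - t - 1 : ℕ)) (y := β / (n - t - 1 : ℕ))
    (by positivity) (by positivity) (by positivity) (by positivity)
    (cast_starCount_eq hn) (cast_starCount_eq hn.symm) (by exact_mod_cast hne₁)
    (by exact_mod_cast hne₂) (by exact_mod_cast d1) (by exact_mod_cast d2) (by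
      rw [mul_div_assoc', mul_div_assoc', ← add_div, mul_div_assoc', div_le_iff₀ hD]
      exact he')
  linarith

lemma pos_starCount_mul (hn : LargeGround n t α β) :
    (0 : ℝ) < starCount n (t + (α + 1)) (t + 1) * starCount n (t + (β + 1)) (t + 1) := by
  have h0 := hn.add_le
  have h1 := starCount_pos (n := n) (k := t + (α + 1)) (m := t + 1) (by omega) (by omega)
  have h2 := starCount_pos (n := n) (k := t + (β + 1)) (m := t + 1) (by omega) (by omega)
  exact_mod_cast Nat.mul_pos h1 h2

lemma exists_subset_seg_card {m : ℕ} (hm : m ≤ n) : ∃ U ⊆ seg n, U.card = m :=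
  exists_subset_card_eq (by rwa [card_seg])

lemma four_mul_le_sq (t α β : ℕ) : 4 * ((α + 2) * (β + 2)) ≤ (2 * (t + 1) + α + β + 2) ^ 2 := by
  zify
  nlinarith [sq_nonneg ((α : ℤ) - β), mul_nonneg (Int.natCast_nonneg t) (Int.natCast_nonneg α),
    mul_nonneg (Int.natCast_nonneg t) (Int.natCast_nonneg β), sq_nonneg (t : ℤ)]

/-- The error condition of `IsExtremal.starCount_mul_le` for `t + 2` stars on each side. -/
lemma genA_error_le (hn : LargeGround n t α β) (ht : 1 ≤ t) :
    10 * ((t + 2) ^ 2 * (t + 2) * α + (t + 2) * (t + 2) ^ 2 * β) ≤ 9 * (n - t - 1) := by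
  refine le_trans ?_ (Nat.mul_le_mul_left 9 hn.le_sub)
  obtain ⟨s, rfl⟩ : ∃ s, t = s + 1 := ⟨t - 1, by omega⟩
  have h1 : 4 * (s + 1 + 2) ^ 2 ≤ 9 * (s + 1 + 1) ^ 2 := by nlinarith
  have h2 : (s + 1 + 2) * (α + β) ≤ (2 * (s + 1) + α + β + 2) ^ 2 := by nlinarith
  have h3 : 4 ≤ (α + 2) * (β + 2) := by nlinarith [Nat.zero_le (α * β)]
  calc 10 * ((s + 1 + 2) ^ 2 * (s + 1 + 2) * α + (s + 1 + 2) * (s + 1 + 2) ^ 2 * β)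
      = 10 * ((s + 1 + 2) ^ 2 * ((s + 1 + 2) * (α + β))) := by ring
    _ ≤ (9 * (s + 1 + 1) ^ 2) * ((2 * (s + 1) + α + β + 2) ^ 2) * 4 := by
        have := Nat.mul_le_mul h1 h2
        nlinarith
    _ ≤ (9 * (s + 1 + 1) ^ 2) * ((2 * (s + 1) + α + β + 2) ^ 2) * ((α + 2) * (β + 2)) :=
        Nat.mul_le_mul_left _ h3
    _ = _ := by ring

/-- The lower bound on the product coming from the pair `(𝓐(k₁, t), 𝓐(k₂, t))`. -/
lemma IsExtremal.lower_genA (h : IsExtremal n (t + (α + 1)) (t + (β + 1)) t 𝓕 𝓖)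
    (hn : LargeGround n t α β) (ht : 1 ≤ t) :
    (20 * ((t + 2) * (t + 2) : ℝ) - 9) *
      (starCount n (t + (α + 1)) (t + 1) * starCount n (t + (β + 1)) (t + 1)) ≤
      20 * (𝓕.card * 𝓖.card) := by
  have h0 := hn.add_le
  obtain ⟨U, hU, hUc⟩ := exists_subset_seg_card (n := n) (m := t + 2) (by omega)
  have hcard : (U.powersetCard (t + 1)).card = t + 2 := by
    rw [card_powersetCard, hUc, Nat.choose_succ_self_right]
  have hsub : U.powersetCard (t + 1) ⊆ layer n (t + 1) := powersetCard_mono hU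
  have := h.starCount_mul_le hn (admissible_genA hU hUc ht (by omega) (by omega) (by omega)
    (by omega)) hsub hsub (fun W hW => star_subset_genA hW) (fun W hW => star_subset_genA hW)
    (by omega) (by omega) (by rw [hcard]; exact genA_error_le hn ht)
  rw [hcard] at this
  push_cast at this
  exact this

/-- If a covering number exceeds `t + 1`, multiplying the two branching bounds gains at least one
factor of order `K²`, with `K = k₁ + k₂`. This beats `4(α + 2)(β + 2)` and leaves `4|𝓕||𝓖| ≤ (t +
1)N₁N₂`, below what the `genA` pair already achieves. -/
lemma IsExtremal.tau_eq (h : IsExtremal n (t + (α + 1)) (t + (β + 1)) t 𝓕 𝓖)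
    (hn : LargeGround n t α β) (ht : 1 ≤ t) : tau n t 𝓕 = t + 1 ∧ tau n t 𝓖 = t + 1 := by
  obtain ⟨i, hi⟩ : ∃ i, tau n t 𝓕 = t + (i + 1) :=
    ⟨tau n t 𝓕 - t - 1, by have := h.1.tau₁; omega⟩
  obtain ⟨j, hj⟩ : ∃ j, tau n t 𝓖 = t + (j + 1) :=
    ⟨tau n t 𝓖 - t - 1, by have := h.1.tau₂; omega⟩
  by_contra hcon
  have hij : 1 ≤ i + j := by
    by_contra h0
    exact hcon ⟨by rw [hi]; omega, by rw [hj]; omega⟩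
  obtain ⟨s, hs⟩ : ∃ s, i + j = s + 1 := ⟨i + j - 1, by omega⟩
  have u1 := h.1.card_mul_pow_le hn hi hj
  have u2 := h.1.symm.card_mul_pow_le hn.symm hj hi
  rw [show 2 * t + β + α + 2 = 2 * t + α + β + 2 by ring] at u2
  have hpos := pos_starCount_mul hn
  have hlow := h.lower_genA hn ht
  set N₁ := starCount n (t + (α + 1)) (t + 1)
  set N₂ := starCount n (t + (β + 1)) (t + 1)
  set K := 2 * t + α + β + 2 with hK
  have hprod := Nat.mul_le_mul u1 u2
  -- One factor `t + 1` is split off from each `(t + 1)²K²`, so that `(t + 1) ^ (s + 1)` cancels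
  -- against the binomial losses in `e2`.
  have e1 : 𝓕.card * ((t + 1) ^ 2 * K ^ 2) ^ j * (𝓖.card * ((t + 1) ^ 2 * K ^ 2) ^ i) =
      (t + 1) ^ (s + 1) * (𝓕.card * 𝓖.card * ((t + 1) * K ^ 2) ^ (s + 1)) := by
    have hR : ∀ m, ((t + 1) ^ 2 * K ^ 2) ^ m = (t + 1) ^ m * ((t + 1) * K ^ 2) ^ m := by
      intro m
      rw [← mul_pow _ _ m]
      congr 1
      ring
    rw [← hs, hR, hR]
    generalize (t + 1) * K ^ 2 = Q
    ring
  have e2 : (t + 1) ^ (i + 1) * (β + 2) * N₁ * ((t + 1) ^ (j + 1) * (α + 2) * N₂) =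
      (t + 1) ^ (s + 1) * ((t + 1) ^ 2 * ((α + 2) * (β + 2)) * (N₁ * N₂)) := by
    rw [← hs]; ring
  rw [e1, e2] at hprod
  have hprod := Nat.le_of_mul_le_mul_left hprod (by positivity)
  have hQ : (t + 1) * K ^ 2 ≤ ((t + 1) * K ^ 2) ^ (s + 1) := Nat.le_self_pow (by omega) _
  have hprod2 := (Nat.mul_le_mul_left (𝓕.card * 𝓖.card) hQ).trans hprod
  have hAB : 4 * ((α + 2) * (β + 2)) ≤ K ^ 2 := by
    obtain ⟨r, rfl⟩ : ∃ r, t = r + 1 := ⟨t - 1, by omega⟩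
    exact four_mul_le_sq r α β
  have hfin : 4 * (𝓕.card * 𝓖.card) * ((t + 1) * K ^ 2) ≤
      ((t + 1) * (N₁ * N₂)) * ((t + 1) * K ^ 2) := by
    calc 4 * (𝓕.card * 𝓖.card) * ((t + 1) * K ^ 2)
        = 4 * (𝓕.card * 𝓖.card * ((t + 1) * K ^ 2)) := by ring
      _ ≤ 4 * ((t + 1) ^ 2 * ((α + 2) * (β + 2)) * (N₁ * N₂)) := Nat.mul_le_mul_left _ hprod2
      _ = (4 * ((α + 2) * (β + 2))) * ((t + 1) ^ 2 * (N₁ * N₂)) := by ring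
      _ ≤ K ^ 2 * ((t + 1) ^ 2 * (N₁ * N₂)) := Nat.mul_le_mul_right _ hAB
      _ = _ := by ring
  have hfin := Nat.le_of_mul_le_mul_right hfin (by positivity)
  have hfin' : (4 * (𝓕.card * 𝓖.card) : ℝ) ≤ (t + 1) * (N₁ * N₂) := by exact_mod_cast hfin
  have ht' : (1 : ℝ) ≤ t := by exact_mod_cast ht
  have hc : (0 : ℝ) < 20 * ((t + 2) * (t + 2)) - 9 - 5 * (t + 1) := by nlinarith
  have := mul_pos hc hpos
  linarith

lemma IsExtremal.minCovers_nonempty (h : IsExtremal n (t + (α + 1)) (t + (β + 1)) t 𝓕 𝓖)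
    (hn : LargeGround n t α β) (ht : 1 ≤ t) : (minCovers n t 𝓕).Nonempty := by
  obtain ⟨T, hT, hc, hcard⟩ := exists_isTCover_card_eq_tau h.1.subset₁ (Nat.le_add_right _ _)
  exact ⟨T, mem_minCovers.2 ⟨⟨hT, hcard.trans (h.tau_eq hn ht).1⟩, hc⟩⟩

lemma IsExtremal.inter_minCovers (h : IsExtremal n (t + (α + 1)) (t + (β + 1)) t 𝓕 𝓖)
    (hn : LargeGround n t α β) :
    ∀ T ∈ minCovers n t 𝓕, ∀ V ∈ minCovers n t 𝓖, t ≤ (T ∩ V).card := by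
  have := hn.add_le
  exact fun T hT V hV => h.le_card_inter_minCovers (by omega) (by omega) (by omega) hT hV

lemma error_mul_le (hn : LargeGround n t α β) :
    (t + 1) * (2 * t + α + β + 2) ^ 2 *
      ((t + 1) * (β + 2) ^ 2 * starCount n (t + (α + 1)) (t + 2)) ≤
      (β + 2) * starCount n (t + (α + 1)) (t + 1) := by
  have h1 := hn.mul_starCount_succ_le (m := t + 1) le_rfl
  calc _ = (β + 2) * ((t + 1) ^ 2 * (2 * t + α + β + 2) ^ 2 * (β + 2) *
      starCount n (t + (α + 1)) (t + 1 + 1)) := by ring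
    _ ≤ _ := Nat.mul_le_mul_left _ h1

lemma IsExtremal.upper (h : IsExtremal n (t + (α + 1)) (t + (β + 1)) t 𝓕 𝓖)
    (hn : LargeGround n t α β) (ht : 1 ≤ t) :
    100 * (𝓕.card * 𝓖.card : ℝ) ≤ (100 * ((minCovers n t 𝓕).card * (minCovers n t 𝓖).card) + 51) *
      (starCount n (t + (α + 1)) (t + 1) * starCount n (t + (β + 1)) (t + 1)) := by
  have hne₁ := h.minCovers_nonempty hn ht
  have hne₂ := h.symm.minCovers_nonempty hn.symm ht
  have hcr := h.inter_minCovers hn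
  have u1 := h.1.card_le_of_minCovers hne₁
  have u2 := h.1.symm.card_le_of_minCovers hne₂
  have v1 := h.1.card_minCovers_le hcr hne₁
  have v2 := h.1.symm.card_minCovers_le (h.symm.inter_minCovers hn.symm) hne₂
  have e1 := error_mul_le hn
  have e2 := error_mul_le hn.symm
  rw [show 2 * t + β + α + 2 = 2 * t + α + β + 2 by ring] at e2
  refine mul_le_of_minCovers
    (E₁ := ((t + 1) * (β + 2) ^ 2 * starCount n (t + (α + 1)) (t + 2) : ℕ))
    (E₂ := ((t + 1) * (α + 2) ^ 2 * starCount n (t + (β + 1)) (t + 2) : ℕ))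
    (A := (α + 2 : ℕ)) (B := (β + 2 : ℕ))
    (K := (2 * t + α + β + 2 : ℕ)) (t := (t + 1 : ℕ)) (by positivity) (by positivity)
    (by exact_mod_cast (by omega)) (by exact_mod_cast (by omega)) (by positivity) (by positivity)
    ?_ (by positivity) (by positivity) (by exact_mod_cast u1)
    (by exact_mod_cast u2) (by exact_mod_cast e1) (by exact_mod_cast e2)
    (by exact_mod_cast v2) (by exact_mod_cast v1)
  obtain ⟨r, rfl⟩ : ∃ r, t = r + 1 := ⟨t - 1, by omega⟩
  exact_mod_cast four_mul_le_sq r α β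

/-- The number of pairs of minimal covers of an extremal pair is at least what the stars in any
admissible pair provide. -/
lemma IsExtremal.mul_le_card_minCovers (h : IsExtremal n (t + (α + 1)) (t + (β + 1)) t 𝓕 𝓖)
    (hn : LargeGround n t α β) (ht : 1 ≤ t) {m : ℕ}
    (hlow : (20 * (m : ℝ) - 9) *
      (starCount n (t + (α + 1)) (t + 1) * starCount n (t + (β + 1)) (t + 1)) ≤
      20 * (𝓕.card * 𝓖.card)) :
    m ≤ (minCovers n t 𝓕).card * (minCovers n t 𝓖).card := by
  have hup := h.upper hn ht
  have hpos := pos_starCount_mul hn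
  set N : ℝ := starCount n (t + (α + 1)) (t + 1) * starCount n (t + (β + 1)) (t + 1)
  -- With `c = c₁c₂`, the bounds give `m - 9/20 ≤ c + 51/100`, which is incompatible with `m ≥ c +
  -- 1`.
  by_contra! hlt
  have : ((minCovers n t 𝓕).card * (minCovers n t 𝓖).card + 1 : ℝ) ≤ m := by exact_mod_cast hlt
  nlinarith

end Extremal

end CrossInt

/-! ### Lower bounds for the number of pairs of minimal covers. -/

namespace CrossInt

open Finset

variable {n t α β : ℕ}

lemma card_image_insert {S X : Finset ℕ} (hd : Disjoint X S) :
    (X.image fun x => insert x S).card = X.card := by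
  refine card_image_of_injOn fun x hx y hy hxy => ?_
  have hx' : x ∉ S := disjoint_left.1 hd hx
  have : x ∈ insert y S := hxy ▸ mem_insert_self x S
  exact (mem_insert.1 this).resolve_right hx'

lemma injOn_sdiff_singleton {S Y : Finset ℕ} :
    Set.InjOn (fun i => (Y ∪ S) \ {i}) (S : Set ℕ) := by
  intro i hi j hj hij
  simp only at hij
  by_contra hne
  have : i ∈ (Y ∪ S) \ {j} := by
    rw [mem_sdiff, mem_singleton]
    exact ⟨mem_union_right _ hi, hne⟩
  rw [← hij] at this
  simp at this

lemma image_insert_subset_layer {S X : Finset ℕ} (hS : S ⊆ seg n) (hX : X ⊆ seg n)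
    (hd : Disjoint X S) (hSc : S.card = t) :
    (X.image fun x => insert x S) ⊆ layer n (t + 1) := by
  intro W hW
  obtain ⟨x, hx, rfl⟩ := mem_image.1 hW
  rw [mem_layer, card_insert_of_notMem (disjoint_left.1 hd hx), hSc]
  exact ⟨insert_subset (hX hx) hS, rfl⟩

/-- The families `T` and `(T \ {i}) ∪ {x}`. -/
def swaps (T X : Finset ℕ) : Finset (Finset ℕ) :=
  insert T ((T ×ˢ X).image fun p => insert p.2 (T \ {p.1}))

lemma card_swaps {T X : Finset ℕ} (hd : Disjoint X T) :
    (swaps T X).card = T.card * X.card + 1 := by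
  unfold swaps
  have hmem : ∀ x ∈ X, x ∉ T := fun x hx => disjoint_left.1 hd hx
  rw [card_insert_of_notMem, card_image_of_injOn, card_product]
  · rintro ⟨i, x⟩ hp ⟨j, y⟩ hq h
    simp only [mem_coe, mem_product] at hp hq h
    have hx : x ∈ insert y (T \ {j}) := by rw [← h]; exact mem_insert_self _ _
    have hxy : x = y := by
      rcases mem_insert.1 hx with h1 | h1
      · exact h1
      · exact absurd (mem_sdiff.1 h1).1 (hmem x hp.2)
    have hij : i = j := by
      by_contra hne
      have hi : i ∈ insert y (T \ {j}) :=
        mem_insert_of_mem (mem_sdiff.2 ⟨hp.1, by rwa [mem_singleton]⟩)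
      rw [← h, mem_insert, mem_sdiff] at hi
      rcases hi with h1 | h1
      · exact hmem x hp.2 (h1 ▸ hp.1)
      · simp at h1
    rw [hxy, hij]
  · intro h
    obtain ⟨⟨i, x⟩, hp, h⟩ := mem_image.1 h
    rw [mem_product] at hp
    exact hmem x hp.2 (h ▸ mem_insert_self x _)

lemma swaps_subset_layer {T X : Finset ℕ} (hT : T ⊆ seg n) (hX : X ⊆ seg n)
    (hd : Disjoint X T) (hTc : T.card = t + 1) : swaps T X ⊆ layer n (t + 1) := by
  intro W hW
  rw [swaps, mem_insert, mem_image] at hW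
  rcases hW with rfl | ⟨⟨i, x⟩, hp, rfl⟩
  · exact mem_layer.2 ⟨hT, hTc⟩
  · rw [mem_product] at hp
    have hx : x ∉ T \ {i} := fun h => disjoint_left.1 hd hp.2 (mem_sdiff.1 h).1
    rw [mem_layer, card_insert_of_notMem hx,
      card_sdiff_of_subset (singleton_subset_iff.2 hp.1), card_singleton, hTc]
    exact ⟨insert_subset (hX hp.2) (sdiff_subset.trans hT), rfl⟩

lemma exists_disjoint_subset_seg {S : Finset ℕ} {m : ℕ} (hm : m + S.card ≤ n) :
    ∃ X ⊆ seg n, Disjoint X S ∧ X.card = m := by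
  obtain ⟨X, hX, hXc⟩ := exists_subset_card_eq (show m ≤ (seg n \ S).card by
    have := le_card_sdiff S (seg n)
    rw [card_seg] at this
    omega)
  rw [subset_sdiff] at hX
  exact ⟨X, hX.1, hX.2, hXc⟩

/-- This and the next two estimates verify the Bonferroni error condition for the star counts `(β+2,
α+2)`, `(1, (t+1)(α+1)+1)` and, when `β = 0`, `(2, α+2+t)`. -/
lemma genH_error_le (hn : LargeGround n t α β) (ht : 1 ≤ t) :
    10 * ((β + 2) ^ 2 * (α + 2) * α + (β + 2) * (α + 2) ^ 2 * β) ≤ 9 * (n - t - 1) := by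
  refine le_trans ?_ (Nat.mul_le_mul_left 9 hn.le_sub)
  obtain ⟨s, rfl⟩ : ∃ s, t = s + 1 := ⟨t - 1, by omega⟩
  have h1 := four_mul_le_sq s α β
  have h2 : (β + 2) * α + (α + 2) * β ≤ 2 * ((α + 2) * (β + 2)) := by nlinarith
  have h3 : 4 ≤ (s + 1 + 1) ^ 2 := by nlinarith
  calc 10 * ((β + 2) ^ 2 * (α + 2) * α + (β + 2) * (α + 2) ^ 2 * β)
      = 10 * (((α + 2) * (β + 2)) * ((β + 2) * α + (α + 2) * β)) := by ring
    _ ≤ 10 * (((α + 2) * (β + 2)) * (2 * ((α + 2) * (β + 2)))) := by gcongr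
    _ = 5 * (((α + 2) * (β + 2)) * (4 * ((α + 2) * (β + 2)))) := by ring
    _ ≤ 5 * (((α + 2) * (β + 2)) * (2 * (s + 1) + α + β + 2) ^ 2) := by gcongr
    _ ≤ (9 * 4) * (((α + 2) * (β + 2)) * (2 * (s + 1) + α + β + 2) ^ 2) :=
        Nat.mul_le_mul_right _ (by norm_num)
    _ ≤ (9 * (s + 1 + 1) ^ 2) * (((α + 2) * (β + 2)) * (2 * (s + 1) + α + β + 2) ^ 2) := by gcongr
    _ = _ := by ring

lemma genC_error_le (hn : LargeGround n t α β) (ht : 1 ≤ t) :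
    10 * (1 ^ 2 * ((t + 1) * (α + 1) + 1) * α + 1 * ((t + 1) * (α + 1) + 1) ^ 2 * β) ≤
      9 * (n - t - 1) := by
  refine le_trans ?_ (Nat.mul_le_mul_left 9 hn.le_sub)
  set m := (t + 1) * (α + 1) + 1 with hm
  have h1 : m ≤ (t + 1) * (α + 2) := by rw [hm]; nlinarith
  have h2 : 10 * (α + 2) ≤ 9 * (2 * t + α + β + 2) ^ 2 := by
    have h4 : α + 4 ≤ 2 * t + α + β + 2 := by omega
    nlinarith [Nat.pow_le_pow_left h4 2]
  have h3 : m ≤ (t + 1) ^ 2 * (α + 2) := h1.trans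
    (Nat.mul_le_mul_right _ (Nat.le_self_pow two_ne_zero _))
  calc 10 * (1 ^ 2 * m * α + 1 * m ^ 2 * β) = 10 * (m * α + m ^ 2 * β) := by ring
    _ ≤ 10 * ((t + 1) ^ 2 * (α + 2) * (α + 2) + ((t + 1) * (α + 2)) ^ 2 * β) := by
        gcongr; omega
    _ = (10 * (α + 2)) * ((t + 1) ^ 2 * (α + 2) * (β + 1)) := by ring
    _ ≤ (9 * (2 * t + α + β + 2) ^ 2) * ((t + 1) ^ 2 * (α + 2) * (β + 2)) :=
        Nat.mul_le_mul h2 (Nat.mul_le_mul_left _ (by omega))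
    _ = _ := by ring

lemma genH_error_le_of_eq_succ (hn : LargeGround n t α 0) (ht : 1 ≤ t) :
    10 * (2 ^ 2 * (α + 2 + t) * α + 2 * (α + 2 + t) ^ 2 * 0) ≤ 9 * (n - t - 1) := by
  refine le_trans ?_ (Nat.mul_le_mul_left 9 hn.le_sub)
  have h3 : 4 ≤ (t + 1) ^ 2 := by nlinarith
  have h1 : α + 2 + t ≤ 2 * t + α + 0 + 2 := by omega
  calc 10 * (2 ^ 2 * (α + 2 + t) * α + 2 * (α + 2 + t) ^ 2 * 0)
      = 40 * ((α + 2 + t) * α) := by ring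
    _ ≤ 72 * ((2 * t + α + 0 + 2) ^ 2 * (α + 2)) := by
        refine Nat.mul_le_mul (by norm_num) (Nat.mul_le_mul ?_ (by omega))
        exact h1.trans (Nat.le_self_pow two_ne_zero _)
    _ = 18 * (4 * ((2 * t + α + 0 + 2) ^ 2 * (α + 2))) := by ring
    _ ≤ 18 * ((t + 1) ^ 2 * ((2 * t + α + 0 + 2) ^ 2 * (α + 2))) := by gcongr
    _ = _ := by ring

section Extremal

variable {𝓕 𝓖 : Finset (Finset ℕ)}

lemma IsExtremal.genA_le (h : IsExtremal n (t + (α + 1)) (t + (β + 1)) t 𝓕 𝓖)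
    (hn : LargeGround n t α β) (ht : 1 ≤ t) :
    (t + 2) * (t + 2) ≤ (minCovers n t 𝓕).card * (minCovers n t 𝓖).card :=
  h.mul_le_card_minCovers hn ht (by push_cast; exact h.lower_genA hn ht)

lemma IsExtremal.genH_le (h : IsExtremal n (t + (α + 1)) (t + (β + 1)) t 𝓕 𝓖)
    (hn : LargeGround n t α β) (ht : 1 ≤ t) (hαβ : β ≤ α) :
    (β + 2) * (α + 2) ≤ (minCovers n t 𝓕).card * (minCovers n t 𝓖).card := by
  have h0 := hn.add_le
  obtain ⟨S, hS, hSc⟩ := exists_subset_seg_card (n := n) (m := t) (by omega)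
  obtain ⟨X, hX, hdX, hXc⟩ := exists_disjoint_subset_seg (n := n) (S := S) (m := α + 2) (by omega)
  -- Nesting `Y` in `X`, possible because `β ≤ α`, secures two common elements.
  obtain ⟨Y, hYX, hYc⟩ := exists_subset_card_eq (show β + 2 ≤ X.card by omega)
  have hY := hYX.trans hX
  have hdY := disjoint_of_subset_left hYX hdX
  have := h.starCount_mul_le hn
    (admissible_genH hS hX hY hdX hdY hSc ht (by omega) (by omega) (by omega) (by omega)
      (by omega) (by omega) (Or.inl (by rw [inter_eq_right.2 hYX]; omega)))
    (image_insert_subset_layer hS hY hdY hSc) (image_insert_subset_layer hS hX hdX hSc)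
    (fun W hW => by
      obtain ⟨y, hy, rfl⟩ := mem_image.1 hW
      exact star_subset_genH hy)
    (fun W hW => by
      obtain ⟨y, hy, rfl⟩ := mem_image.1 hW
      exact star_subset_genH hy)
    (by rw [card_image_insert hdY]; omega) (by rw [card_image_insert hdX]; omega)
    (by rw [card_image_insert hdX, card_image_insert hdY, hXc, hYc]; exact genH_error_le hn ht)
  rw [card_image_insert hdX, card_image_insert hdY, hXc, hYc] at this
  exact h.mul_le_card_minCovers hn ht (by push_cast at this ⊢; exact this)

/-- The first family contributes only the star of `T`, the second the stars of `T` and of its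
`(t+1)(α+1)` one-element exchanges with `X`. -/
lemma IsExtremal.genC_le (h : IsExtremal n (t + (α + 1)) (t + (β + 1)) t 𝓕 𝓖)
    (hn : LargeGround n t α β) (ht : 1 ≤ t) :
    (t + 1) * (α + 1) + 1 ≤ (minCovers n t 𝓕).card * (minCovers n t 𝓖).card := by
  have h0 := hn.add_le
  obtain ⟨T, hT, hTc⟩ := exists_subset_seg_card (n := n) (m := t + 1) (by omega)
  obtain ⟨X, hX, hd, hXc⟩ := exists_disjoint_subset_seg (n := n) (S := T) (m := α + 1) (by omega)
  have hcard : (swaps T X).card = (t + 1) * (α + 1) + 1 := by rw [card_swaps hd, hTc, hXc]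
  have := h.starCount_mul_le hn (𝓤₁ := {T}) (𝓤₂ := swaps T X)
    (admissible_genC hT hX hd hTc ht (by omega) (by omega) (by omega) (by omega) (by omega))
    (singleton_subset_iff.2 (mem_layer.2 ⟨hT, hTc⟩)) (swaps_subset_layer hT hX hd hTc)
    (fun W hW => by
      rw [mem_singleton.1 hW]
      exact subset_union_right)
    (fun W hW => by
      rw [swaps, mem_insert, mem_image] at hW
      rcases hW with rfl | ⟨⟨i, x⟩, hp, rfl⟩
      · exact subset_union_right
      · exact star_subset_genC₂ hTc (mem_product.1 hp).2)
    (by simp) (by rw [hcard]; omega) (by rw [hcard, card_singleton]; exact genC_error_le hn ht)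
  rw [hcard, card_singleton] at this
  refine h.mul_le_card_minCovers hn ht ?_
  push_cast at this ⊢
  rwa [one_mul] at this

/-- For `k₂ = t + 1` the star of a `(t+1)`-set is that set alone, so the `t` exceptional members `(Y
∪ S) \ {i}` count as additional full stars. -/
lemma IsExtremal.genH_le_of_eq_succ (h : IsExtremal n (t + (α + 1)) (t + (0 + 1)) t 𝓕 𝓖)
    (hn : LargeGround n t α 0) (ht : 1 ≤ t) :
    2 * (α + 2 + t) ≤ (minCovers n t 𝓕).card * (minCovers n t 𝓖).card := by
  have h0 := hn.add_le
  obtain ⟨S, hS, hSc⟩ := exists_subset_seg_card (n := n) (m := t) (by omega)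
  obtain ⟨X, hX, hdX, hXc⟩ := exists_disjoint_subset_seg (n := n) (S := S) (m := α + 2) (by omega)
  obtain ⟨Y, hYX, hYc⟩ := exists_subset_card_eq (show 2 ≤ X.card by omega)
  have hY := hYX.trans hX
  have hdY := disjoint_of_subset_left hYX hdX
  have hcard : ((X.image fun x => insert x S) ∪ S.image fun i => (Y ∪ S) \ {i}).card =
      α + 2 + t := by
    rw [card_union_of_disjoint, card_image_insert hdX, card_image_of_injOn injOn_sdiff_singleton,
      hXc, hSc]
    rw [disjoint_left]
    intro W hW hW'
    obtain ⟨x, hx, rfl⟩ := mem_image.1 hW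
    obtain ⟨i, hi, hWi⟩ := mem_image.1 hW'
    have : i ∈ (Y ∪ S) \ {i} := by
      rw [hWi]
      exact mem_insert_of_mem hi
    simp at this
  have hadm : Admissible n (t + (α + 1)) (t + (0 + 1)) t _ _ :=
    admissible_genH hS hX hY hdX hdY hSc ht (by omega) (by omega) (by omega) (by omega)
      (by omega) (by omega) (Or.inl (by rw [inter_eq_right.2 hYX]; omega))
  have hsub : (S.image fun i => (Y ∪ S) \ {i}) ⊆ layer n (t + 1) := by
    intro W hW
    exact hadm.subset₂ (mem_union_right _ hW)
  have := h.starCount_mul_le hn hadm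
    (image_insert_subset_layer hS hY hdY hSc)
    (union_subset (image_insert_subset_layer hS hX hdX hSc) hsub)
    (fun W hW => by
      obtain ⟨y, hy, rfl⟩ := mem_image.1 hW
      exact star_subset_genH hy)
    (fun W hW => by
      rcases mem_union.1 hW with hW | hW
      · obtain ⟨y, hy, rfl⟩ := mem_image.1 hW
        exact star_subset_genH hy
      · intro F hF
        rw [mem_star] at hF
        have := eq_of_subset_of_card_le hF.2 (by rw [hF.1.2, (mem_layer.1 (hsub hW)).2])
        rw [← this]
        exact mem_union_right _ hW)
    (by rw [card_image_insert hdY]; omega) (by rw [hcard]; omega)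
    (by rw [hcard, card_image_insert hdY, hYc]; exact genH_error_le_of_eq_succ hn ht)
  rw [hcard, card_image_insert hdY, hYc] at this
  exact h.mul_le_card_minCovers hn ht (by push_cast at this ⊢; exact this)

end Extremal

end CrossInt

/-! ### Recovering the families from their minimal covers. -/

namespace CrossInt

open Finset

variable {n k l t α β : ℕ} {𝓕 𝓖 : Finset (Finset ℕ)}

lemma IsExtremal.eq_of_subset (h : IsExtremal n k l t 𝓕 𝓖) {𝓖₁ 𝓖₂ : Finset (Finset ℕ)}
    (hadm : Admissible n k l t 𝓖₁ 𝓖₂) (h₁ : 𝓕 ⊆ 𝓖₁) (h₂ : 𝓖 ⊆ 𝓖₂) : 𝓕 = 𝓖₁ ∧ 𝓖 = 𝓖₂ := by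
  have hm := h.2 _ _ hadm
  have c1 := card_le_card h₁
  have c2 := card_le_card h₂
  have p1 := h.1.nonempty_left.card_pos
  have p2 := h.1.nonempty_right.card_pos
  constructor
  · refine eq_of_subset_of_card_le h₁ ?_
    by_contra! hlt
    nlinarith
  · refine eq_of_subset_of_card_le h₂ ?_
    by_contra! hlt
    nlinarith

/-- Every `U \ {x}` is a cover; taking `x` in `F ∩ U` leaves `t` further elements of `F ∩ U`. -/
lemma subset_genA {U : Finset ℕ} (h𝓕 : 𝓕 ⊆ layer n k) (ht : 1 ≤ t) (hUc : U.card = t + 2)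
    (hU : U.powersetCard (t + 1) ⊆ minCovers n t 𝓕) : 𝓕 ⊆ genA n k t U := by
  intro F hF
  refine mem_filter.2 ⟨h𝓕 hF, ?_⟩
  have key : ∀ x ∈ U, t ≤ ((F ∩ U) \ {x}).card := by
    intro x hx
    have hW : U \ {x} ∈ U.powersetCard (t + 1) := by
      rw [mem_powersetCard, card_sdiff_of_subset (singleton_subset_iff.2 hx), card_singleton]
      exact ⟨sdiff_subset, by omega⟩
    refine ((mem_minCovers.1 (hU hW)).2 F hF).trans (card_le_card fun y hy => ?_)
    simp only [mem_inter, mem_sdiff, mem_singleton] at hy ⊢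
    tauto
  obtain ⟨x, hx⟩ : U.Nonempty := by rw [← card_pos]; omega
  obtain ⟨y, hy⟩ : (F ∩ U).Nonempty := by
    rw [← card_pos]
    exact lt_of_lt_of_le ht ((key x hx).trans (card_le_card sdiff_subset))
  have h1 := key y (mem_inter.1 hy).2
  rw [card_sdiff_of_subset (singleton_subset_iff.2 hy), card_singleton] at h1
  have := card_pos.2 ⟨y, hy⟩
  omega

lemma IsExtremal.eq_genA (h : IsExtremal n (t + (α + 1)) (t + (β + 1)) t 𝓕 𝓖)
    (hn : LargeGround n t α β) (ht : 1 ≤ t) {U : Finset ℕ} (hUs : U ⊆ seg n)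
    (hUc : U.card = t + 2) (hU₁ : U.powersetCard (t + 1) ⊆ minCovers n t 𝓕)
    (hU₂ : U.powersetCard (t + 1) ⊆ minCovers n t 𝓖) :
    𝓕 = genA n (t + (α + 1)) t U ∧ 𝓖 = genA n (t + (β + 1)) t U := by
  have := hn.add_le
  exact h.eq_of_subset (admissible_genA hUs hUc ht (by omega) (by omega) (by omega) (by omega))
    (subset_genA h.1.subset₁ ht hUc hU₁) (subset_genA h.1.subset₂ ht hUc hU₂)

/-- The given covers of `𝓕` are the edges of the path `q–p–s–r`. A set meeting all three edges
contains `{p, r}`, `{p, s}` or `{q, s}`; these cover `𝓖`, so their stars lie in `𝓕`. -/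
lemma IsExtremal.eq_star_union (h : IsExtremal n k l 1 𝓕 𝓖) (hk : 1 ≤ k) {p q r s : ℕ}
    (h₁ : {p, q} ∈ minCovers n 1 𝓕) (h₂ : {p, s} ∈ minCovers n 1 𝓕)
    (h₃ : {r, s} ∈ minCovers n 1 𝓕) (h₄ : {p, r} ∈ minCovers n 1 𝓖)
    (h₅ : {p, s} ∈ minCovers n 1 𝓖) (h₆ : {q, s} ∈ minCovers n 1 𝓖) :
    𝓕 = star n k {p, r} ∪ star n k {p, s} ∪ star n k {q, s} := by
  refine Subset.antisymm (fun F hF => ?_) (union_subset (union_subset ?_ ?_) ?_)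
  · have hit : ∀ x y : ℕ, {x, y} ∈ minCovers n 1 𝓕 → x ∈ F ∨ y ∈ F := by
      intro x y hxy
      obtain ⟨z, hz⟩ := card_pos.1 ((mem_minCovers.1 hxy).2 F hF)
      simp only [mem_inter, mem_insert, mem_singleton] at hz
      rcases hz with ⟨rfl | rfl, hz⟩
      · exact Or.inl hz
      · exact Or.inr hz
    have hF' := mem_layer.1 (h.1.subset₁ hF)
    simp only [mem_union, mem_star, insert_subset_iff, singleton_subset_iff]
    have := hit _ _ h₁
    have := hit _ _ h₂
    have := hit _ _ h₃
    tauto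
  · exact h.star_subset_left hk h₄
  · exact h.star_subset_left hk h₅
  · exact h.star_subset_left hk h₆

section H

variable {S : Finset ℕ}

lemma disjoint_extensions : Disjoint (extensions n t 𝓕 S) S :=
  disjoint_left.2 fun _ hx => (mem_extensions.1 hx).1

lemma extensions_subset_seg : extensions n t 𝓕 S ⊆ seg n := filter_subset _ _

lemma card_inter_missing {X Y : Finset ℕ} {i j : ℕ} :
    (((X ∪ S) \ {i}) ∩ ((Y ∪ S) \ {j})).card ≤ (X ∩ Y).card + (S \ {i, j}).card +
      (X ∩ S).card + (Y ∩ S).card := by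
  have hsub : ((X ∪ S) \ {i}) ∩ ((Y ∪ S) \ {j}) ⊆
      (((X ∩ Y) ∪ (S \ {i, j})) ∪ (X ∩ S)) ∪ (Y ∩ S) := by
    intro y hy
    simp only [mem_union, mem_inter, mem_sdiff, mem_insert, mem_singleton, not_or] at hy ⊢
    tauto
  refine (card_le_card hsub).trans ?_
  have h1 := card_union_le (((X ∩ Y) ∪ (S \ {i, j})) ∪ (X ∩ S)) (Y ∩ S)
  have h2 := card_union_le ((X ∩ Y) ∪ (S \ {i, j})) (X ∩ S)
  have h3 := card_union_le (X ∩ Y) (S \ {i, j})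
  omega

/-- A maximum number of extensions determines each member not containing `S`. A member `F ⊇ S` of
`𝓕` must meet some `G = (Y ∪ S) \ {j}` of `𝓖` in `t` elements, only `t - 1` of which can come from
`S`. -/
lemma Admissible.mem_genH (h : Admissible n (t + α) (t + β) t 𝓕 𝓖) (hS : S ⊆ seg n)
    (hSc : S.card = t) (hX : (extensions n t 𝓕 S).card = α + 1)
    (hY : (extensions n t 𝓖 S).card = β + 1) {F : Finset ℕ} (hF : F ∈ 𝓕) :
    (F ∈ layer n (t + α) ∧ S ⊆ F ∧ 1 ≤ (F ∩ extensions n t 𝓖 S).card) ∨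
      ∃ i ∈ S, (extensions n t 𝓕 S ∪ S) \ {i} = F := by
  by_cases hSF : S ⊆ F
  · refine Or.inl ⟨h.subset₁ hF, hSF, ?_⟩
    obtain ⟨G, hG, hSG⟩ := h.symm.exists_not_subset hS hSc
    obtain ⟨j, hj, rfl⟩ := eq_of_card_extensions_eq h.subset₂ hSc hG hSG hY
    have h1 := h.cross F hF _ hG
    have hsub : F ∩ ((extensions n t 𝓖 S ∪ S) \ {j}) ⊆ (F ∩ extensions n t 𝓖 S) ∪ (S \ {j}) := by
      intro y hy
      simp only [mem_union, mem_inter, mem_sdiff, mem_singleton] at hy ⊢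
      tauto
    have h2 := (card_le_card hsub).trans (card_union_le _ _)
    rw [card_sdiff_of_subset (singleton_subset_iff.2 hj), card_singleton] at h2
    have := card_pos.2 ⟨j, hj⟩
    omega
  · obtain ⟨i, hi, rfl⟩ := eq_of_card_extensions_eq h.subset₁ hSc hF hSF hX
    exact Or.inr ⟨i, hi, rfl⟩

/-- The transposition of `x` and `y` injects one family into the other. This feeds the exchange
argument in `IsExtremal.eq_genH`. -/
lemma card_filter_hit_le_of_swap {X : Finset ℕ} {x y : ℕ} (hxS : x ∉ S)
    (hyS : y ∉ S) (hyX : y ∉ X) (hxn : x ∈ seg n) (hyn : y ∈ seg n) :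
    ((layer n k).filter fun F => S ⊆ F ∧ 1 ≤ (F ∩ X).card).card ≤
      ((layer n k).filter fun F => S ⊆ F ∧ 1 ≤ (F ∩ insert y (X \ {x})).card).card := by
  have hinj := (Equiv.swap x y).injective
  have hfix : ∀ z, z ≠ x → z ≠ y → Equiv.swap x y z = z :=
    fun z h1 h2 => Equiv.swap_apply_of_ne_of_ne h1 h2
  refine card_le_card_of_injOn (fun F => F.image (Equiv.swap x y)) (fun F hF => ?_)
    ((image_injective hinj).injOn)
  simp only [coe_filter, Set.mem_ofPred_eq, mem_layer] at hF ⊢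
  obtain ⟨⟨hFs, hFc⟩, hSF, hFX⟩ := hF
  refine ⟨⟨?_, by rw [card_image_of_injective _ hinj, hFc]⟩, ?_, ?_⟩
  · intro z hz
    obtain ⟨w, hw, rfl⟩ := mem_image.1 hz
    by_cases h1 : w = x
    · rw [h1, Equiv.swap_apply_left]; exact hyn
    by_cases h2 : w = y
    · rw [h2, Equiv.swap_apply_right]; exact hxn
    rw [hfix w h1 h2]
    exact hFs hw
  · intro z hz
    exact mem_image.2 ⟨z, hSF hz, hfix z (fun h => hxS (h ▸ hz)) fun h => hyS (h ▸ hz)⟩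
  · obtain ⟨w, hw⟩ := card_pos.1 hFX
    rw [mem_inter] at hw
    refine card_pos.2 ⟨Equiv.swap x y w, mem_inter.2 ⟨mem_image_of_mem _ hw.1, ?_⟩⟩
    by_cases h1 : w = x
    · rw [h1, Equiv.swap_apply_left]
      exact mem_insert_self _ _
    · rw [hfix w h1 fun h => hyX (h ▸ hw.2)]
      exact mem_insert_of_mem (mem_sdiff.2 ⟨hw.2, by rwa [mem_singleton]⟩)

lemma card_genH {X Y : Finset ℕ} :
    (genH n k S X Y).card =
      ((layer n k).filter fun F => S ⊆ F ∧ 1 ≤ (F ∩ Y).card).card + S.card := by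
  rw [genH, card_union_of_disjoint, card_image_of_injOn injOn_sdiff_singleton]
  rw [disjoint_left]
  intro F hF hF'
  obtain ⟨i, hi, rfl⟩ := mem_image.1 hF'
  have := (mem_filter.1 hF).2.1 hi
  simp at this

lemma IsExtremal.eq_genH (h : IsExtremal n (t + (α + 1)) (t + (β + 1)) t 𝓕 𝓖)
    (hn : LargeGround n t α β) (ht : 1 ≤ t) (hS : S ⊆ seg n)
    (hSc : S.card = t) (hX : (extensions n t 𝓕 S).card = α + 2)
    (hY : (extensions n t 𝓖 S).card = β + 2) :
    ∃ X Y : Finset ℕ, X ⊆ seg n ∧ Y ⊆ seg n ∧ Disjoint X S ∧ Disjoint Y S ∧ X.card = α + 2 ∧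
      Y.card = β + 2 ∧ (2 ≤ (X ∩ Y).card ∨ t = 1 ∧ 1 ≤ (X ∩ Y).card) ∧
      𝓕 = genH n (t + (α + 1)) S X Y ∧ 𝓖 = genH n (t + (β + 1)) S Y X := by
  have h0 := hn.add_le
  have m1 := fun F (hF : F ∈ 𝓕) => h.1.mem_genH hS hSc hX hY hF
  have m2 := fun G (hG : G ∈ 𝓖) => h.1.symm.mem_genH hS hSc hY hX hG
  obtain ⟨F₀, hF₀, hSF₀⟩ := h.1.exists_not_subset hS hSc
  obtain ⟨G₀, hG₀, hSG₀⟩ := h.1.symm.exists_not_subset hS hSc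
  have hXs := extensions_subset_seg (n := n) (t := t) (𝓕 := 𝓕) (S := S)
  have hYs := extensions_subset_seg (n := n) (t := t) (𝓕 := 𝓖) (S := S)
  have hdX := disjoint_extensions (n := n) (t := t) (𝓕 := 𝓕) (S := S)
  have hdY := disjoint_extensions (n := n) (t := t) (𝓕 := 𝓖) (S := S)
  obtain ⟨i₀, hi₀, rfl⟩ := eq_of_card_extensions_eq h.1.subset₁ hSc hF₀ hSF₀ hX
  obtain ⟨j₀, hj₀, rfl⟩ := eq_of_card_extensions_eq h.1.subset₂ hSc hG₀ hSG₀ hY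
  set X := extensions n t 𝓕 S
  set Y := extensions n t 𝓖 S
  have hcap : ∀ i j, (X ∪ S) \ {i} ∈ 𝓕 → (Y ∪ S) \ {j} ∈ 𝓖 →
      t ≤ (X ∩ Y).card + (S \ {i, j}).card := by
    intro i j hi hj
    have h1 := (h.1.cross _ hi _ hj).trans card_inter_missing
    rw [disjoint_iff_inter_eq_empty.1 hdX, disjoint_iff_inter_eq_empty.1 hdY] at h1
    simpa using h1
  have hsd : ∀ i ∈ S, ∀ j, (S \ {i, j}).card + 1 ≤ t ∧
      (j ∈ S → i ≠ j → (S \ {i, j}).card + 2 ≤ t) := by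
    intro i hi j
    have hpos := card_pos.2 ⟨i, hi⟩
    constructor
    · have h1 : S \ {i, j} ⊆ S \ {i} := sdiff_subset_sdiff le_rfl (by simp)
      have h2 := card_le_card h1
      rw [card_sdiff_of_subset (singleton_subset_iff.2 hi), card_singleton] at h2
      omega
    · intro hj hij
      have h3 : ({i, j} : Finset ℕ) ⊆ S := insert_subset hi (singleton_subset_iff.2 hj)
      have h4 := card_le_card h3
      rw [card_pair hij] at h4
      rw [card_sdiff_of_subset h3, card_pair hij]
      omega
  have hone : 1 ≤ (X ∩ Y).card := by
    have := hcap _ _ hF₀ hG₀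
    have := (hsd i₀ hi₀ j₀).1
    omega
  have hXY : 2 ≤ (X ∩ Y).card ∨ t = 1 ∧ 1 ≤ (X ∩ Y).card := by
    -- Suppose `|X ∩ Y| = 1` and `t ≥ 2`. Then exceptional members of `𝓕` and `𝓖` must miss the same
    -- element of `S`, so each family has only one. Replacing some `x ∈ X \ Y` by some `y ∈ Y \ X`
    -- gives an admissible pair with `t` exceptional members on each side and no fewer ordinary
    -- ones, a larger product.
    by_contra hcon
    have hXY1 : (X ∩ Y).card = 1 := by omega
    have ht2 : 2 ≤ t := by omega
    have heq : ∀ i ∈ S, ∀ j ∈ S, (X ∪ S) \ {i} ∈ 𝓕 → (Y ∪ S) \ {j} ∈ 𝓖 → i = j := by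
      intro i hi j hj hiF hjG
      by_contra hne
      have := hcap _ _ hiF hjG
      have := (hsd i hi j).2 hj hne
      omega
    set A := (layer n (t + (α + 1))).filter fun F => S ⊆ F ∧ 1 ≤ (F ∩ Y).card with hA
    set B := (layer n (t + (β + 1))).filter fun F => S ⊆ F ∧ 1 ≤ (F ∩ X).card with hB
    have c1 : 𝓕.card ≤ A.card + 1 := by
      rw [← card_singleton ((X ∪ S) \ {j₀})]
      refine (card_le_card fun F hF => ?_).trans (card_union_le _ _)
      rcases m1 F hF with hF' | ⟨i, hi, rfl⟩
      · exact mem_union_left _ (mem_filter.2 hF')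
      · rw [heq i hi j₀ hj₀ hF hG₀]
        exact mem_union_right _ (mem_singleton_self _)
    have c2 : 𝓖.card ≤ B.card + 1 := by
      rw [← card_singleton ((Y ∪ S) \ {i₀})]
      refine (card_le_card fun F hF => ?_).trans (card_union_le _ _)
      rcases m2 F hF with hF' | ⟨j, hj, rfl⟩
      · exact mem_union_left _ (mem_filter.2 hF')
      · rw [heq i₀ hi₀ j hj hF₀ hF]
        exact mem_union_right _ (mem_singleton_self _)
    obtain ⟨x, hxX, hxY⟩ : ∃ x ∈ X, x ∉ Y := by
      by_contra! hc
      rw [inter_eq_left.2 hc] at hXY1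
      omega
    obtain ⟨y, hyY, hyX⟩ : ∃ y ∈ Y, y ∉ X := by
      by_contra! hc
      rw [inter_eq_right.2 hc] at hXY1
      omega
    have hxS : x ∉ S := disjoint_left.1 hdX hxX
    have hyS : y ∉ S := disjoint_left.1 hdY hyY
    set X' := insert y (X \ {x}) with hX'
    have hX's : X' ⊆ seg n := insert_subset (hYs hyY) (sdiff_subset.trans hXs)
    have hdX' : Disjoint X' S :=
      disjoint_insert_left.2 ⟨hyS, disjoint_of_subset_left sdiff_subset hdX⟩
    have hX'c : X'.card = α + 2 := by
      rw [hX', card_insert_of_notMem (fun h => hyX (mem_sdiff.1 h).1),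
        card_sdiff_of_subset (singleton_subset_iff.2 hxX), card_singleton]
      omega
    have hX'Y : 2 ≤ (X' ∩ Y).card := by
      have hsub : insert y (X ∩ Y) ⊆ X' ∩ Y := by
        intro z hz
        rw [mem_insert, mem_inter] at hz
        rw [mem_inter, hX', mem_insert, mem_sdiff, mem_singleton]
        rcases hz with rfl | hz
        · exact ⟨Or.inl rfl, hyY⟩
        · exact ⟨Or.inr ⟨hz.1, fun h => hxY (h ▸ hz.2)⟩, hz.2⟩
      have := card_le_card hsub
      rw [card_insert_of_notMem fun h => hyX (mem_inter.1 h).1] at this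
      omega
    have hle := h.2 _ _ (admissible_genH hS hX's hYs hdX' hdY hSc ht (by omega) (by omega)
      (by omega) (by omega) (by omega) (by omega) (Or.inl hX'Y))
    rw [card_genH, card_genH, hSc, ← hA] at hle
    have hBle : B.card ≤ ((layer n (t + (β + 1))).filter
        fun F => S ⊆ F ∧ 1 ≤ (F ∩ X').card).card :=
      card_filter_hit_le_of_swap hxS hyS hyX (hXs hxX) (hYs hyY)
    have hlt : (A.card + 1) * (B.card + 1) < (A.card + t) * (B.card + t) :=
      Nat.mul_lt_mul_of_lt_of_le (by omega) (by omega) (by omega)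
    have h1 := Nat.mul_le_mul c1 c2
    have h2 := Nat.mul_le_mul_left (A.card + t) (Nat.add_le_add_right hBle t)
    omega
  refine ⟨X, Y, hXs, hYs, hdX, hdY, hX, hY, hXY, ?_⟩
  exact h.eq_of_subset (admissible_genH hS hXs hYs hdX hdY hSc ht (by omega) (by omega)
    (by omega) (by omega) (by omega) (by omega) hXY)
    (fun F hF => CrossInt.mem_genH.2 (m1 F hF)) (fun G hG => CrossInt.mem_genH.2 (m2 G hG))

end H

/-- Members of either family miss at most one element of `T`. One `A₀ ∈ 𝓕` missing `s₀` fixes `X =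
A₀ \ T`: for `j ≠ s₀` the `α + 2` extensions of `T \ {j}` must fit into `insert j X`, hence fill it.
This then forces `X` into every member of `𝓕` not containing `T`. -/
lemma IsExtremal.eq_genC (h : IsExtremal n (t + (α + 1)) (t + (β + 1)) t 𝓕 𝓖)
    (hn : LargeGround n t α β) (ht : 2 ≤ t) {T : Finset ℕ} (hT₁ : T ∈ minCovers n t 𝓕)
    (hT₂ : T ∈ minCovers n t 𝓖) (hE : ∀ i ∈ T, (extensions n t 𝓕 (T \ {i})).card = α + 2) :
    ∃ X ⊆ seg n, Disjoint X T ∧ X.card = α + 1 ∧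
      𝓕 = genC₁ n (t + (α + 1)) T X ∧ 𝓖 = genC₂ n (t + (β + 1)) t T X := by
  have h0 := hn.add_le
  obtain ⟨⟨hT, hTc⟩, hcov₁⟩ := mem_minCovers.1 hT₁
  have hcov₂ := (mem_minCovers.1 hT₂).2
  have hTi : ∀ i ∈ T, (T \ {i}).card = t := by
    intro i hi
    rw [card_sdiff_of_subset (singleton_subset_iff.2 hi), card_singleton]
    omega
  have hmiss : ∀ A : Finset ℕ, t ≤ (T ∩ A).card → ¬ T ⊆ A →
      ∃ s ∈ T, s ∉ A ∧ T ∩ A = T \ {s} := by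
    intro A hA hTA
    obtain ⟨s, hs, hsA⟩ := not_subset.1 hTA
    refine ⟨s, hs, hsA, eq_of_subset_of_card_le (fun y hy => ?_) (by rw [hTi s hs]; exact hA)⟩
    rw [mem_inter] at hy
    exact mem_sdiff.2 ⟨hy.1, by rw [mem_singleton]; rintro rfl; exact hsA hy.2⟩
  obtain ⟨i₀, hi₀⟩ : T.Nonempty := by rw [← card_pos]; omega
  obtain ⟨A₀, hA₀, hA₀T⟩ := h.1.exists_not_subset (sdiff_subset.trans hT) (hTi i₀ hi₀)
  obtain ⟨s₀, hs₀, hs₀A, hA₀s⟩ := hmiss A₀ (hcov₁ A₀ hA₀) fun hc => hA₀T (sdiff_subset.trans hc)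
  have hA₀l := mem_layer.1 (h.1.subset₁ hA₀)
  set X := A₀ \ T with hX
  have hXs : X ⊆ seg n := sdiff_subset.trans hA₀l.1
  have hd : Disjoint X T := sdiff_disjoint
  have hXc : X.card = α + 1 := by
    have h1 := card_sdiff_add_card_inter A₀ T
    rw [inter_comm, hA₀s, hTi s₀ hs₀, hA₀l.2, ← hX] at h1
    omega
  have hEj : ∀ j ∈ T, j ≠ s₀ → extensions n t 𝓕 (T \ {j}) = insert j X := by
    intro j hj hjs
    have hns : ¬ T \ {j} ⊆ A₀ := fun hc => hs₀A (hc (mem_sdiff.2 ⟨hs₀, by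
      rw [mem_singleton]; exact hjs.symm⟩))
    refine eq_of_subset_of_card_le ((extensions_subset_of_not_subset (hTi j hj) hA₀ hns).trans
      fun y hy => ?_) ?_
    · simp only [mem_sdiff, mem_singleton, not_and, not_not] at hy
      rw [mem_insert, hX, mem_sdiff]
      by_cases hyT : y ∈ T
      · exact Or.inl (hy.2 hyT)
      · exact Or.inr ⟨hy.1, hyT⟩
    · rw [hE j hj, card_insert_of_notMem fun hc => disjoint_left.1 hd hc hj, hXc]
  have m1 : ∀ A ∈ 𝓕, ¬ T ⊆ A → ∃ s ∈ T, (X ∪ T) \ {s} = A := by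
    intro A hA hTA
    obtain ⟨s, hs, hsA, hAs⟩ := hmiss A (hcov₁ A hA) hTA
    -- Here `t ≥ 2` is needed: `T` has at least three elements. Since `j ≠ s`, the set `T \ {j}` is
    -- not inside `A`, so its extensions are.
    obtain ⟨j, hj, hjs⟩ : ∃ j ∈ T, j ∉ ({s, s₀} : Finset ℕ) :=
      exists_mem_notMem_of_card_lt_card (lt_of_le_of_lt card_le_two (by omega))
    rw [mem_insert, mem_singleton, not_or] at hjs
    have hns : ¬ T \ {j} ⊆ A := fun hc => hsA (hc (mem_sdiff.2 ⟨hs, by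
      rw [mem_singleton]; exact fun h => hjs.1 h.symm⟩))
    have h1 := extensions_subset_of_not_subset (n := n) (hTi j hj) hA hns
    rw [hEj j hj hjs.2] at h1
    have hXA : X ⊆ A := ((subset_insert _ _).trans h1).trans sdiff_subset
    refine ⟨s, hs, eq_of_subset_of_card_le (fun y hy => ?_) ?_⟩
    · rw [mem_sdiff, mem_union, mem_singleton] at hy
      rcases hy.1 with hy' | hy'
      · exact hXA hy'
      · have : y ∈ T ∩ A := by rw [hAs]; exact mem_sdiff.2 ⟨hy', by simpa using hy.2⟩
        exact (mem_inter.1 this).2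
    · have := card_union_sdiff_singleton hd hs
      rw [(mem_layer.1 (h.1.subset₁ hA)).2]
      omega
  refine ⟨X, hXs, hd, hXc, h.eq_of_subset (admissible_genC hT hXs hd hTc (by omega) (by omega)
    (by omega) (by omega) (by omega) (by omega)) (fun A hA => ?_) (fun A hA => ?_)⟩
  · rw [mem_genC₁, mem_star]
    by_cases hTA : T ⊆ A
    · exact Or.inr ⟨mem_layer.1 (h.1.subset₁ hA), hTA⟩
    · exact Or.inl (m1 A hA hTA)
  · rw [mem_genC₂, mem_star]
    by_cases hTA : T ⊆ A
    · exact Or.inr ⟨mem_layer.1 (h.1.subset₂ hA), hTA⟩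
    · obtain ⟨i, hi, hiA, hAi⟩ := hmiss A (hcov₂ A hA) hTA
      refine Or.inl ⟨h.1.subset₂ hA, by rw [inter_comm, hAi, hTi i hi], ?_⟩
      -- `B` misses some `s ≠ i`, so `A` and `B` share only `t - 1` elements of `T`; the remaining
      -- one lies in `X`.
      obtain ⟨B, hB, hBT⟩ := h.1.exists_not_subset (sdiff_subset.trans hT) (hTi i hi)
      obtain ⟨s, hs, rfl⟩ := m1 B hB fun hc => hBT (sdiff_subset.trans hc)
      have hsi : s ≠ i := by
        rintro rfl
        exact hBT (sdiff_subset_sdiff subset_union_right le_rfl)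
      have h1 := h.1.cross _ hB A hA
      have hsub : ((X ∪ T) \ {s}) ∩ A ⊆ (A ∩ X) ∪ ((T ∩ A) \ {s}) := by
        intro y hy
        simp only [mem_union, mem_inter, mem_sdiff, mem_singleton] at hy ⊢
        tauto
      have h2 := (card_le_card hsub).trans (card_union_le _ _)
      have hsTA : s ∈ T ∩ A := by
        rw [hAi, mem_sdiff, mem_singleton]
        exact ⟨hs, hsi⟩
      rw [card_sdiff_of_subset (singleton_subset_iff.2 hsTA), hAi, hTi i hi, card_singleton] at h2
      omega

end CrossInt

/-! ### Cross `t`-intersecting families of `(t+1)`-sets. -/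

namespace CrossInt

open Finset

variable {n k l t α β : ℕ} {𝓕 𝓖 : Finset (Finset ℕ)}

lemma card_inter_insert_le {D S : Finset ℕ} {x : ℕ} :
    (D ∩ insert x S).card ≤ (D ∩ S).card + 1 := by
  refine (card_le_card (t := insert x (D ∩ S)) fun y hy => ?_).trans (card_insert_le _ _)
  simp only [mem_inter, mem_insert] at hy ⊢
  tauto

/-- A `(t+1)`-set that meets all `S ∪ {x}`, `x ∈ X`, in at least `t` elements and does not
contain `S`. -/
lemma subset_of_not_subset_of_le_card {D S X : Finset ℕ} (hSc : S.card = t) (hX : X.Nonempty)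
    (hD : ∀ x ∈ X, t ≤ (D ∩ insert x S).card) (hSD : ¬ S ⊆ D) :
    X ⊆ D ∧ (D ∩ S).card + 1 = t := by
  have hlt : (D ∩ S).card < S.card :=
    card_lt_card (ssubset_of_subset_of_ne inter_subset_right fun h => hSD (inter_eq_right.1 h))
  constructor
  · intro x hx
    by_contra hxD
    have := hD x hx
    rw [inter_insert_of_notMem hxD] at this
    omega
  · obtain ⟨x, hx⟩ := hX
    have := (hD x hx).trans card_inter_insert_le
    omega

lemma card_add_card_inter_le {D S X : Finset ℕ} (hXS : Disjoint X S) (hXD : X ⊆ D) :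
    X.card + (D ∩ S).card ≤ D.card := by
  rw [← card_union_of_disjoint (disjoint_of_subset_right inter_subset_right hXS)]
  exact card_le_card (union_subset hXD inter_subset_left)

/-- Otherwise `D` contains `X` and `t - 1` elements of `S`, at least `t + 2` elements in all. -/
lemma subset_of_three_le {D S X : Finset ℕ} (hSc : S.card = t) (hXS : Disjoint X S)
    (hX : 3 ≤ X.card) (hDc : D.card = t + 1) (hD : ∀ x ∈ X, t ≤ (D ∩ insert x S).card) :
    S ⊆ D := by
  by_contra hSD
  have hne : X.Nonempty := by rw [← card_pos]; omega
  have h1 := subset_of_not_subset_of_le_card hSc hne hD hSD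
  have h2 := card_add_card_inter_le hXS h1.1
  omega

lemma exists_eq_sdiff_of_card_eq_two {D S X : Finset ℕ} (hSc : S.card = t) (hXS : Disjoint X S)
    (hX : X.card = 2) (hDc : D.card = t + 1) (hD : ∀ x ∈ X, t ≤ (D ∩ insert x S).card)
    (hSD : ¬ S ⊆ D) : ∃ s ∈ S, D = (X ∪ S) \ {s} := by
  have hne : X.Nonempty := by rw [← card_pos]; omega
  have h1 := subset_of_not_subset_of_le_card hSc hne hD hSD
  obtain ⟨s, hs, hsD⟩ := not_subset.1 hSD
  have hsub : X ∪ (D ∩ S) ⊆ D := union_subset h1.1 inter_subset_left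
  have hc : (X ∪ (D ∩ S)).card = t + 1 := by
    rw [card_union_of_disjoint (disjoint_of_subset_right inter_subset_right hXS)]
    omega
  have hDeq := eq_of_subset_of_card_le hsub (by omega)
  refine ⟨s, hs, eq_of_subset_of_card_le (fun y hy => ?_) ?_⟩
  · rw [← hDeq] at hy
    rw [mem_sdiff, mem_singleton, mem_union]
    refine ⟨(mem_union.1 hy).imp_right fun h => (mem_inter.1 h).2, ?_⟩
    rintro rfl
    exact hsD (hDeq ▸ hy)
  · have := card_union_sdiff_singleton hXS hs
    omega

/-- If `D ⊄ U`, then `D ∩ U` has at most `t` elements, so it lies in each of `A`, `B`, `C`. These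
omit three different points of `U`, which leaves room for only `t - 1`. -/
lemma subset_of_three_subsets {U D A B C : Finset ℕ} (hU : U.card = t + 2) (hA : A ⊆ U)
    (hB : B ⊆ U) (hC : C ⊆ U) (hAc : A.card = t + 1) (hBc : B.card = t + 1) (hCc : C.card = t + 1)
    (hAB : A ≠ B) (hAC : A ≠ C) (hBC : B ≠ C) (hD : D.card = t + 1) (hDA : t ≤ (D ∩ A).card)
    (hDB : t ≤ (D ∩ B).card) (hDC : t ≤ (D ∩ C).card) : D ⊆ U := by
  by_contra hDU
  have hlt : (D ∩ U).card < D.card :=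
    card_lt_card (ssubset_of_subset_of_ne inter_subset_left fun h => hDU (inter_eq_left.1 h))
  have key : ∀ W ⊆ U, t ≤ (D ∩ W).card → D ∩ U ⊆ W := by
    intro W hW hDW
    have := eq_of_subset_of_card_le (inter_subset_inter_left hW (s := D)) (by omega)
    rw [← this]
    exact inter_subset_right
  have hcomp : ∀ W ⊆ U, W.card = t + 1 → ∃ w ∈ U, W = U \ {w} := by
    intro W hW hWc
    obtain ⟨w, hw⟩ := card_eq_one.1 (show (U \ W).card = 1 by
      rw [card_sdiff_of_subset hW]; omega)
    exact ⟨w, (mem_sdiff.1 (hw ▸ mem_singleton_self w : w ∈ U \ W)).1, by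
      rw [← hw, Finset.sdiff_sdiff_eq_self hW]⟩
  have kA := key A hA hDA
  have kB := key B hB hDB
  have kC := key C hC hDC
  obtain ⟨a, ha, rfl⟩ := hcomp A hA hAc
  obtain ⟨b, hb, rfl⟩ := hcomp B hB hBc
  obtain ⟨c, hc, rfl⟩ := hcomp C hC hCc
  have hsub : D ∩ U ⊆ U \ {a, b, c} := by
    intro y hy
    have h1 := kA hy
    have h2 := kB hy
    have h3 := kC hy
    simp only [mem_sdiff, mem_insert, mem_singleton] at *
    tauto
  have h1 := card_le_card hsub
  have habc : ({a, b, c} : Finset ℕ).card = 3 := by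
    rw [card_eq_three]
    exact ⟨a, b, c, fun h => hAB (by rw [h]), fun h => hAC (by rw [h]), fun h => hBC (by rw [h]),
      rfl⟩
  have hsubU : ({a, b, c} : Finset ℕ) ⊆ U :=
    insert_subset ha (insert_subset hb (singleton_subset_iff.2 hc))
  rw [card_sdiff_of_subset hsubU, habc] at h1
  have := hDA.trans (card_le_card (inter_subset_inter_left hA (s := D)))
  have := card_le_card hsubU
  omega

/-- A set meeting two `(t+1)`-sets at distance two in at least `t` elements. -/
lemma exists_eq_insert_insert {A B C : Finset ℕ}
    (hC : C.card = t + 1) (hAB : (A ∩ B).card < t) (hCA : t ≤ (C ∩ A).card)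
    (hCB : t ≤ (C ∩ B).card) :
    (A ∩ B).card + 1 = t ∧ ∃ x ∈ A \ B, ∃ y ∈ B \ A, C = insert x (insert y (A ∩ B)) := by
  -- The sizes of `C ∩ A` and `C ∩ B` sum to at least `2t`, their union has at most `t + 1` elements
  -- and their intersection at most `t - 1`, so equality holds throughout.
  have h1 := card_union_add_card_inter (C ∩ A) (C ∩ B)
  have h2 : (C ∩ A) ∪ (C ∩ B) ⊆ C := union_subset inter_subset_left inter_subset_left
  have h3 : (C ∩ A) ∩ (C ∩ B) ⊆ A ∩ B := inter_subset_inter inter_subset_right inter_subset_right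
  have h2' := card_le_card h2
  have h3' := card_le_card h3
  have e2 := eq_of_subset_of_card_le h2 (by omega)
  have e3 := eq_of_subset_of_card_le h3 (by omega)
  have hP : A ∩ B ⊆ C := by rw [← e3]; exact inter_subset_left.trans inter_subset_left
  have hx : ((C ∩ A) \ B).card = 1 := by
    have h4 := card_sdiff_add_card_inter (C ∩ A) B
    have h5 : C ∩ A ∩ B = A ∩ B := by
      rw [inter_assoc]; exact inter_eq_right.2 hP
    rw [h5] at h4
    omega
  have hy : ((C ∩ B) \ A).card = 1 := by
    have h4 := card_sdiff_add_card_inter (C ∩ B) A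
    have h5 : C ∩ B ∩ A = A ∩ B := by
      rw [inter_assoc, inter_comm B]; exact inter_eq_right.2 hP
    rw [h5] at h4
    omega
  obtain ⟨x, hx⟩ := card_eq_one.1 hx
  obtain ⟨y, hy⟩ := card_eq_one.1 hy
  have hx' : ∀ z, z ∈ (C ∩ A) \ B ↔ z = x := fun z => by rw [hx, mem_singleton]
  have hy' : ∀ z, z ∈ (C ∩ B) \ A ↔ z = y := fun z => by rw [hy, mem_singleton]
  have e2' : ∀ z, z ∈ C → z ∈ A ∨ z ∈ B := fun z hz => by
    rw [← e2, mem_union, mem_inter, mem_inter] at hz; tauto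
  have hx1 := (hx' x).2 rfl
  have hy1 := (hy' y).2 rfl
  simp only [mem_sdiff, mem_inter] at hx' hy' hx1 hy1
  refine ⟨by omega, x, mem_sdiff.2 ⟨hx1.1.2, hx1.2⟩, y, mem_sdiff.2 ⟨hy1.1.2, hy1.2⟩, ?_⟩
  ext z
  simp only [mem_insert, mem_inter]
  constructor
  · intro hz
    have := hx' z
    have := hy' z
    have := e2' z hz
    tauto
  · rintro (rfl | rfl | hz)
    · exact hx1.1.1
    · exact hy1.1.1
    · exact hP (mem_inter.2 hz)

section Path

variable {P : Finset ℕ} {p q r s : ℕ} {𝓢 𝓣 : Finset (Finset ℕ)}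

/-- In a `2 × 2` grid with diagonals `a, d` and `b, c`, a set containing neither diagonal has at
most two cells. -/
lemma diagonal_of_three_le {a b c d : Finset ℕ} (h : 𝓢 ⊆ {a, b, c, d}) (h3 : 3 ≤ 𝓢.card) :
    a ∈ 𝓢 ∧ d ∈ 𝓢 ∨ b ∈ 𝓢 ∧ c ∈ 𝓢 := by
  by_contra hcon
  have key : ∀ x y : Finset ℕ, ¬ 𝓢 ⊆ {x, y} := fun x y hs => by
    have := (card_le_card hs).trans card_le_two
    omega
  have hm : ∀ z ∈ 𝓢, z = a ∨ z = b ∨ z = c ∨ z = d := fun z hz => by simpa using h hz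
  by_cases ha : a ∈ 𝓢 <;> by_cases hb : b ∈ 𝓢
  · refine key a b fun z hz => ?_
    rcases hm z hz with rfl | rfl | rfl | rfl <;> simp_all
  · refine key a c fun z hz => ?_
    rcases hm z hz with rfl | rfl | rfl | rfl <;> simp_all
  · refine key b d fun z hz => ?_
    rcases hm z hz with rfl | rfl | rfl | rfl <;> simp_all
  · refine key c d fun z hz => ?_
    rcases hm z hz with rfl | rfl | rfl | rfl <;> simp_all

lemma card_le_three_of_notMem {a b c d : Finset ℕ} (h : 𝓢 ⊆ {a, b, c, d}) (hd : d ∉ 𝓢)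
    (h3 : 3 ≤ 𝓢.card) : 𝓢.card = 3 ∧ a ∈ 𝓢 ∧ b ∈ 𝓢 ∧ c ∈ 𝓢 := by
  have hs : 𝓢 ⊆ {a, b, c} := by
    intro z hz
    have := h hz
    simp only [mem_insert, mem_singleton] at this ⊢
    rcases this with h | h | h | rfl
    · exact Or.inl h
    · exact Or.inr (Or.inl h)
    · exact Or.inr (Or.inr h)
    · exact absurd hz hd
  have h4 : ({a, b, c} : Finset (Finset ℕ)).card ≤ 3 := card_le_three
  have heq := eq_of_subset_of_card_le hs (by omega)
  have := card_le_card hs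
  refine ⟨by omega, ?_, ?_, ?_⟩ <;> simp [heq]

lemma card_inter_insert_insert_le {a b c d : ℕ} (hac : a ≠ c) (had : a ≠ d) (hbc : b ≠ c)
    (hbd : b ≠ d) :
    (insert a (insert b P) ∩ insert c (insert d P)).card ≤ P.card := by
  refine card_le_card fun y hy => ?_
  simp only [mem_inter, mem_insert] at hy
  grind

/-- The diagonal of `𝓢` consists of two sets at distance two, which confines `𝓣` to a second grid,
`{p, r} × {q, s}` over `P`. Cells with disjoint pairs exclude each other across the families, so
with three members required on each side exactly one cell is missing from each grid. -/
lemma exists_path_of_diagonal (hP : P.card + 1 = t) (hpq : p ≠ q) (hpr : p ≠ r) (hps : p ≠ s)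
    (hqr : q ≠ r) (hqs : q ≠ s) (hrs : r ≠ s)
    (h𝓢 : 𝓢 ⊆ {insert p (insert r P), insert p (insert s P), insert q (insert r P),
      insert q (insert s P)})
    (h𝓣 : ∀ D ∈ 𝓣, D.card = t + 1) (hc : ∀ C ∈ 𝓢, ∀ D ∈ 𝓣, t ≤ (C ∩ D).card)
    (h𝓢3 : 3 ≤ 𝓢.card) (h𝓣3 : 3 ≤ 𝓣.card) (h₁ : insert p (insert r P) ∈ 𝓢)
    (h₂ : insert q (insert s P) ∈ 𝓢) :
    𝓢.card = 3 ∧ 𝓣.card = 3 ∧ ∃ p q r s : ℕ, p ≠ q ∧ p ≠ r ∧ p ≠ s ∧ q ≠ r ∧ q ≠ s ∧ r ≠ s ∧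
      insert p (insert r P) ∈ 𝓢 ∧ insert p (insert s P) ∈ 𝓢 ∧ insert q (insert s P) ∈ 𝓢 ∧
      insert p (insert q P) ∈ 𝓣 ∧ insert p (insert s P) ∈ 𝓣 ∧ insert r (insert s P) ∈ 𝓣 := by
  have hcap : insert p (insert r P) ∩ insert q (insert s P) = P := by
    refine Subset.antisymm (fun y hy => ?_) (fun y hy => ?_)
    · simp only [mem_inter, mem_insert] at hy
      grind
    · simp [hy]
  have hT : 𝓣 ⊆ {insert p (insert q P), insert p (insert s P), insert r (insert q P),
      insert r (insert s P)} := by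
    intro D hD
    have hD1 := hc _ h₁ D hD
    have hD2 := hc _ h₂ D hD
    rw [inter_comm] at hD1 hD2
    obtain ⟨-, x, hx, y, hy, rfl⟩ := exists_eq_insert_insert (h𝓣 D hD)
      (by rw [hcap]; omega) hD1 hD2
    have hx' : x = p ∨ x = r := by
      simp only [mem_sdiff, mem_insert, not_or] at hx
      tauto
    have hy' : y = q ∨ y = s := by
      simp only [mem_sdiff, mem_insert, not_or] at hy
      tauto
    rw [hcap]
    rcases hx' with rfl | rfl <;> rcases hy' with rfl | rfl <;> simp
  have hbad₁ : insert q (insert r P) ∈ 𝓢 → insert p (insert s P) ∈ 𝓣 → False := fun hC hD => by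
    have := (hc _ hC _ hD).trans
      (card_inter_insert_insert_le hpq.symm hqs hpr.symm hrs)
    omega
  have hbad₂ : insert p (insert s P) ∈ 𝓢 → insert r (insert q P) ∈ 𝓣 → False := fun hC hD => by
    have := (hc _ hC _ hD).trans
      (card_inter_insert_insert_le hpr hpq hrs.symm hqs.symm)
    omega
  by_cases hm : insert p (insert s P) ∈ 𝓣
  · obtain ⟨c1, s1, s2, s3⟩ := card_le_three_of_notMem
      (a := insert p (insert r P)) (b := insert p (insert s P)) (c := insert q (insert s P))
      (d := insert q (insert r P)) (h𝓢.trans fun z => by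
        simp only [mem_insert, mem_singleton]; tauto) (fun hC => hbad₁ hC hm) h𝓢3
    obtain ⟨c2, t1, t2, t3⟩ := card_le_three_of_notMem
      (a := insert p (insert q P)) (b := insert p (insert s P)) (c := insert r (insert s P))
      (d := insert r (insert q P)) (hT.trans fun z => by
        simp only [mem_insert, mem_singleton]; tauto) (fun hC => hbad₂ s2 hC) h𝓣3
    exact ⟨c1, c2, p, q, r, s, hpq, hpr, hps, hqr, hqs, hrs, s1, s2, s3, t1, t2, t3⟩
  · obtain ⟨c2, t1, t2, t3⟩ := card_le_three_of_notMem
      (a := insert p (insert q P)) (b := insert r (insert q P)) (c := insert r (insert s P))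
      (d := insert p (insert s P)) (hT.trans fun z => by
        simp only [mem_insert, mem_singleton]; tauto) hm h𝓣3
    obtain ⟨c1, s1, s2, s3⟩ := card_le_three_of_notMem
      (a := insert p (insert r P)) (b := insert q (insert r P)) (c := insert q (insert s P))
      (d := insert p (insert s P)) (h𝓢.trans fun z => by
        simp only [mem_insert, mem_singleton]; tauto) (fun hC => hbad₂ hC t2) h𝓢3
    -- Relabelling `p ↔ q`, `r ↔ s` brings this case into the form of the first.
    refine ⟨c1, c2, q, p, s, r, hpq.symm, hqs, hqr, hps, hpr, hrs.symm, s3, s2, s1, ?_, ?_, ?_⟩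
    · rwa [Finset.insert_comm]
    · rwa [Finset.insert_comm]
    · rwa [Finset.insert_comm]

lemma subset_four_of_card_inter_lt {A B : Finset ℕ} (hAc : A.card = t + 1) (hBc : B.card = t + 1)
    (hAB : (A ∩ B).card < t) (h𝓢 : ∀ C ∈ 𝓢, C.card = t + 1)
    (hcA : ∀ C ∈ 𝓢, t ≤ (C ∩ A).card) (hcB : ∀ C ∈ 𝓢, t ≤ (C ∩ B).card) (hne : 𝓢.Nonempty) :
    (A ∩ B).card + 1 = t ∧ ∃ p q r s : ℕ, p ≠ q ∧ p ≠ r ∧ p ≠ s ∧ q ≠ r ∧ q ≠ s ∧ r ≠ s ∧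
      𝓢 ⊆ {insert p (insert r (A ∩ B)), insert p (insert s (A ∩ B)),
        insert q (insert r (A ∩ B)), insert q (insert s (A ∩ B))} := by
  have key := fun C (hC : C ∈ 𝓢) =>
    exists_eq_insert_insert (h𝓢 C hC) hAB (hcA C hC) (hcB C hC)
  obtain ⟨C₀, hC₀⟩ := hne
  have hP := (key C₀ hC₀).1
  have h1 := card_sdiff_add_card_inter A B
  have h2 := card_sdiff_add_card_inter B A
  rw [inter_comm] at h2
  obtain ⟨p, q, hpq, hA⟩ := card_eq_two.1 (show (A \ B).card = 2 by omega)
  obtain ⟨r, s, hrs, hB⟩ := card_eq_two.1 (show (B \ A).card = 2 by omega)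
  have hne : ∀ x ∈ A \ B, ∀ y ∈ B \ A, x ≠ y := by
    intro x hx y hy hxy
    rw [mem_sdiff] at hx hy
    exact hx.2 (hxy ▸ hy.1)
  rw [hA, hB] at hne
  refine ⟨hP, p, q, r, s, hpq, hne p (by simp) r (by simp), hne p (by simp) s (by simp),
    hne q (by simp) r (by simp), hne q (by simp) s (by simp), hrs, fun C hC => ?_⟩
  obtain ⟨-, x, hx, y, hy, hxy⟩ := key C hC
  rw [hA, mem_insert, mem_singleton] at hx
  rw [hB, mem_insert, mem_singleton] at hy
  rw [hxy]
  rcases hx with rfl | rfl <;> rcases hy with rfl | rfl <;> simp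

/-- Two cross `t`-intersecting families of `(t+1)`-sets with at least three members, one of which
contains two sets at distance two. -/
lemma exists_path {A B : Finset ℕ} (hA : A ∈ 𝓣) (hB : B ∈ 𝓣) (hAB : (A ∩ B).card < t)
    (h𝓢 : ∀ C ∈ 𝓢, C.card = t + 1) (h𝓣 : ∀ D ∈ 𝓣, D.card = t + 1)
    (hc : ∀ C ∈ 𝓢, ∀ D ∈ 𝓣, t ≤ (C ∩ D).card) (h𝓢3 : 3 ≤ 𝓢.card) (h𝓣3 : 3 ≤ 𝓣.card) :
    𝓢.card = 3 ∧ 𝓣.card = 3 ∧ ∃ P : Finset ℕ, P.card + 1 = t ∧ ∃ p q r s : ℕ,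
      p ≠ q ∧ p ≠ r ∧ p ≠ s ∧ q ≠ r ∧ q ≠ s ∧ r ≠ s ∧
      insert p (insert r P) ∈ 𝓢 ∧ insert p (insert s P) ∈ 𝓢 ∧ insert q (insert s P) ∈ 𝓢 ∧
      insert p (insert q P) ∈ 𝓣 ∧ insert p (insert s P) ∈ 𝓣 ∧ insert r (insert s P) ∈ 𝓣 := by
  obtain ⟨hP, p, q, r, s, hpq, hpr, hps, hqr, hqs, hrs, hsub⟩ := subset_four_of_card_inter_lt
    (h𝓣 A hA) (h𝓣 B hB) hAB h𝓢 (fun C hC => hc C hC A hA) (fun C hC => hc C hC B hB)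
    (by rw [← card_pos]; omega)
  rcases diagonal_of_three_le hsub h𝓢3 with ⟨h1, h2⟩ | ⟨h1, h2⟩
  · obtain ⟨c1, c2, hex⟩ :=
      exists_path_of_diagonal hP hpq hpr hps hqr hqs hrs hsub h𝓣 hc h𝓢3 h𝓣3 h1 h2
    exact ⟨c1, c2, _, hP, hex⟩
  · obtain ⟨c1, c2, hex⟩ :=
      exists_path_of_diagonal hP hpq hps hpr hqs hqr hrs.symm (hsub.trans fun z => by
        simp only [mem_insert, mem_singleton]; tauto) h𝓣 hc
        h𝓢3 h𝓣3 h1 h2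
    exact ⟨c1, c2, _, hP, hex⟩

end Path

section Singleton

variable {T : Finset ℕ}

/-- A cover `D ≠ T` meets `T` in some `T \ {i}`, so it arises from an extension of `T \ {i}` other
than `i`; the final `+ 1` is `T` itself. -/
lemma card_minCovers_le_of_mem (hT : T ∈ minCovers n t 𝓕)
    (hc : ∀ D ∈ minCovers n t 𝓕, t ≤ (D ∩ T).card) :
    (minCovers n t 𝓕).card ≤ ∑ i ∈ T, ((extensions n t 𝓕 (T \ {i})).card - 1) + 1 := by
  obtain ⟨⟨hTs, hTc⟩, -⟩ := mem_minCovers.1 hT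
  have hsub : minCovers n t 𝓕 ⊆ insert T (T.biUnion fun i =>
      (extensions n t 𝓕 (T \ {i}) \ {i}).image fun x => insert x (T \ {i})) := by
    intro D hD
    rw [mem_insert]
    by_cases hDT : D = T
    · exact Or.inl hDT
    right
    have hDc := (mem_minCovers.1 hD).1.2
    obtain ⟨i, hi, hiD⟩ : ∃ i ∈ T, i ∉ D := by
      by_contra! hcon
      exact hDT (eq_of_subset_of_card_le hcon (by omega)).symm
    have hTi : (T \ {i}).card = t := by
      rw [card_sdiff_of_subset (singleton_subset_iff.2 hi), card_singleton]
      omega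
    have hDTi : D ∩ T = T \ {i} := by
      refine eq_of_subset_of_card_le (fun y hy => ?_) (by rw [hTi]; exact hc D hD)
      rw [mem_inter] at hy
      exact mem_sdiff.2 ⟨hy.2, by rw [mem_singleton]; rintro rfl; exact hiD hy.1⟩
    obtain ⟨x, hx, hxD⟩ := (exists_eq_insert_iff (s := T \ {i}) (t := D)).2
      ⟨hDTi ▸ inter_subset_left, by omega⟩
    rw [mem_biUnion]
    refine ⟨i, hi, mem_image.2 ⟨x, mem_sdiff.2 ⟨mem_extensions.2 ⟨hx, hxD ▸ hD⟩, ?_⟩, hxD⟩⟩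
    rw [mem_singleton]
    rintro rfl
    exact hiD (hxD ▸ mem_insert_self _ _)
  refine (card_le_card hsub).trans ((card_insert_le _ _).trans (Nat.add_le_add_right ?_ 1))
  refine card_biUnion_le.trans (sum_le_sum fun i hi => card_image_le.trans ?_)
  have hiE : i ∈ extensions n t 𝓕 (T \ {i}) :=
    mem_extensions.2 ⟨by simp, by rwa [insert_sdiff_self_of_mem hi]⟩
  rw [card_sdiff_of_subset (singleton_subset_iff.2 hiE), card_singleton]

lemma Admissible.card_minCovers_le_of_mem (h : Admissible n (t + (α + 1)) l t 𝓕 𝓖)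
    (hT : T ∈ minCovers n t 𝓕) (hc : ∀ D ∈ minCovers n t 𝓕, t ≤ (D ∩ T).card) :
    (minCovers n t 𝓕).card ≤ (t + 1) * (α + 1) + 1 ∧
      ((t + 1) * (α + 1) + 1 ≤ (minCovers n t 𝓕).card →
        ∀ i ∈ T, (extensions n t 𝓕 (T \ {i})).card = α + 2) := by
  obtain ⟨⟨hTs, hTc⟩, -⟩ := mem_minCovers.1 hT
  have h1 := CrossInt.card_minCovers_le_of_mem hT hc
  have h2 : ∀ i ∈ T, (extensions n t 𝓕 (T \ {i})).card ≤ α + 2 := fun i hi =>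
    h.card_extensions_le (sdiff_subset.trans hTs) (by
      rw [card_sdiff_of_subset (singleton_subset_iff.2 hi), card_singleton]
      omega)
  have h3 : ∑ i ∈ T, (α + 1) = (t + 1) * (α + 1) := by rw [sum_const, hTc, smul_eq_mul]
  constructor
  · have : ∑ i ∈ T, ((extensions n t 𝓕 (T \ {i})).card - 1) ≤ ∑ i ∈ T, (α + 1) :=
      sum_le_sum fun i hi => by have := h2 i hi; omega
    omega
  · intro hge i hi
    by_contra hne
    have : ∑ i ∈ T, ((extensions n t 𝓕 (T \ {i})).card - 1) < ∑ i ∈ T, (α + 1) :=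
      sum_lt_sum (fun i hi => by have := h2 i hi; omega) ⟨i, hi, by have := h2 i hi; omega⟩
    omega

/-- Some `F ∈ 𝓕` meets `T` in fewer than `t` elements. A minimal cover shares `t` elements with `T`
and has one more, so `|T ∩ F| = t - 1` and the element of `T` it may omit is one of the two in `T \
F`. Each choice leaves at most `α + 2` extensions. -/
lemma Admissible.card_minCovers_le_of_notMem (h : Admissible n (t + (α + 1)) l t 𝓕 𝓖)
    (hTs : T ⊆ seg n) (hTc : T.card = t + 1) (hT : T ∉ minCovers n t 𝓕)
    (hc : ∀ D ∈ minCovers n t 𝓕, t ≤ (D ∩ T).card) :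
    (minCovers n t 𝓕).card ≤ 2 * (α + 2) := by
  rcases (minCovers n t 𝓕).eq_empty_or_nonempty with he | ⟨D₀, hD₀⟩
  · simp [he]
  have hncov : ¬ IsTCover t 𝓕 T := fun hcov => hT (mem_minCovers.2 ⟨⟨hTs, hTc⟩, hcov⟩)
  unfold IsTCover at hncov
  push Not at hncov
  obtain ⟨F, hF, hTF⟩ := hncov
  have key : ∀ D ∈ minCovers n t 𝓕, (T ∩ F).card + 1 = t ∧ ∃ i ∈ T \ F, T \ {i} ⊆ D := by
    intro D hD
    have hDT := hc D hD
    have hDc := (mem_minCovers.1 hD).1.2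
    have hDF := (mem_minCovers.1 hD).2 F hF
    obtain ⟨S, hS, hSc⟩ := exists_subset_card_eq hDT
    have hST : S ⊆ T := hS.trans inter_subset_right
    have hSD : S ⊆ D := hS.trans inter_subset_left
    obtain ⟨i, hi, hiS⟩ := (exists_eq_insert_iff (s := S) (t := T)).2 ⟨hST, by omega⟩
    obtain ⟨x, hx, hxS⟩ := (exists_eq_insert_iff (s := S) (t := D)).2 ⟨hSD, by omega⟩
    have h1 : t ≤ (F ∩ S).card + 1 := by
      rw [← hxS, inter_comm] at hDF
      exact hDF.trans card_inter_insert_le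
    have h2 : F ∩ S ⊆ T ∩ F := by
      rw [inter_comm]
      exact inter_subset_inter_right hST
    have h3 := card_le_card h2
    have h4 := eq_of_subset_of_card_le h2 (by omega)
    refine ⟨by omega, i, mem_sdiff.2 ⟨hiS ▸ mem_insert_self _ _, fun hiF => ?_⟩, ?_⟩
    · have : i ∈ T ∩ F := mem_inter.2 ⟨hiS ▸ mem_insert_self _ _, hiF⟩
      rw [← h4] at this
      exact hi (mem_inter.1 this).2
    · rw [← hiS, insert_sdiff_of_mem _ (mem_singleton_self i)]
      exact sdiff_subset.trans hSD
  have hcard : (T \ F).card = 2 := by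
    have := card_sdiff_add_card_inter T F
    have := (key D₀ hD₀).1
    omega
  have hsub : minCovers n t 𝓕 ⊆ (T \ F).biUnion fun i =>
      (minCovers n t 𝓕).filter fun D => T \ {i} ⊆ D := by
    intro D hD
    obtain ⟨-, i, hi, hiD⟩ := key D hD
    exact mem_biUnion.2 ⟨i, hi, mem_filter.2 ⟨hD, hiD⟩⟩
  refine ((card_le_card hsub).trans (card_biUnion_le_card_mul _ _ (α + 2) fun i hi => ?_)).trans
    (by rw [hcard])
  have hTi : (T \ {i}).card = t := by
    rw [card_sdiff_of_subset (singleton_subset_iff.2 (mem_sdiff.1 hi).1), card_singleton]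
    omega
  rw [← card_extensions hTi]
  exact h.card_extensions_le (sdiff_subset.trans hTs) hTi

end Singleton

lemma exists_eq_union_sdiff {A B D : Finset ℕ} (hAc : A.card = t + 1) (hBc : B.card = t + 1)
    (hAB : (A ∩ B).card = t) (hDc : D.card = t + 1) (hDA : t ≤ (D ∩ A).card)
    (hDB : t ≤ (D ∩ B).card) (hD : ¬ A ∩ B ⊆ D) : ∃ s ∈ A ∩ B, D = (A ∪ B) \ {s} := by
  obtain ⟨a, ha, haA⟩ := (exists_eq_insert_iff (s := A ∩ B) (t := A)).2
    ⟨inter_subset_left, by omega⟩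
  obtain ⟨b, hb, hbB⟩ := (exists_eq_insert_iff (s := A ∩ B) (t := B)).2
    ⟨inter_subset_right, by omega⟩
  have hab : a ≠ b := by
    rintro rfl
    rw [haA] at hbB
    rw [hbB, inter_self] at hAB
    omega
  have hd : Disjoint {a, b} (A ∩ B) := by
    rw [disjoint_insert_left, disjoint_singleton_left]
    exact ⟨ha, hb⟩
  obtain ⟨s, hs, hDs⟩ := exists_eq_sdiff_of_card_eq_two hAB hd (card_pair hab) hDc (by
    intro x hx
    rw [mem_insert, mem_singleton] at hx
    rcases hx with rfl | rfl
    · rw [haA]; exact hDA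
    · rw [hbB]; exact hDB) hD
  refine ⟨s, hs, ?_⟩
  have hunion : {a, b} ∪ (A ∩ B) = A ∪ B := by
    have hmA : ∀ y, y ∈ insert a (A ∩ B) ↔ y ∈ A := fun y => by rw [haA]
    have hmB : ∀ y, y ∈ insert b (A ∩ B) ↔ y ∈ B := fun y => by rw [hbB]
    ext y
    have h1 := hmA y
    have h2 := hmB y
    simp only [mem_insert, mem_inter] at h1 h2
    simp only [mem_union, mem_insert, mem_singleton, mem_inter]
    tauto
  rw [hDs, hunion]

/-- Covers not containing `A ∩ B` have the form `(A ∪ B) \ {s}` with `s ∈ A ∩ B`, which leaves at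
most `t` of them. -/
lemma card_minCovers_le_of_inter {A B : Finset ℕ} (hAc : A.card = t + 1) (hBc : B.card = t + 1)
    (hAB : (A ∩ B).card = t) (hcA : ∀ D ∈ minCovers n t 𝓕, t ≤ (D ∩ A).card)
    (hcB : ∀ D ∈ minCovers n t 𝓕, t ≤ (D ∩ B).card) :
    (minCovers n t 𝓕).card ≤ (extensions n t 𝓕 (A ∩ B)).card + t := by
  rw [card_extensions hAB]
  have hsub : minCovers n t 𝓕 ⊆ ((minCovers n t 𝓕).filter fun D => A ∩ B ⊆ D) ∪
      (A ∩ B).image fun s => (A ∪ B) \ {s} := by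
    intro D hD
    rw [mem_union]
    by_cases hSD : A ∩ B ⊆ D
    · exact Or.inl (mem_filter.2 ⟨hD, hSD⟩)
    · obtain ⟨s, hs, hDs⟩ := exists_eq_union_sdiff hAc hBc hAB (mem_minCovers.1 hD).1.2
        (hcA D hD) (hcB D hD) hSD
      exact Or.inr (mem_image.2 ⟨s, hs, hDs.symm⟩)
  have h1 := (card_le_card hsub).trans (card_union_le _ _)
  have h2 := card_image_le (s := A ∩ B) (f := fun s => (A ∪ B) \ {s})
  omega

end CrossInt

/-! ### Classification of the minimal covers of an extremal pair. -/

namespace CrossInt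

open Finset

variable {n t α β : ℕ} {𝓕 𝓖 : Finset (Finset ℕ)}

lemma card_inter_le_of_ne {A B : Finset ℕ} (hA : A.card = t + 1) (hB : B.card = t + 1)
    (hne : A ≠ B) : (A ∩ B).card ≤ t := by
  have : (A ∩ B).card < A.card := card_lt_card (ssubset_of_subset_of_ne inter_subset_left
    fun h => hne (eq_of_subset_of_card_le (inter_eq_left.1 h) (by omega)))
  omega

/-- The possible configurations of minimal covers of an extremal pair. -/
theorem IsExtremal.minCovers_classification
    (h : IsExtremal n (t + (α + 1)) (t + (β + 1)) t 𝓕 𝓖)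
    (hn : LargeGround n t α β) (ht : 1 ≤ t) (hβα : β ≤ α) :
    (∃ U ⊆ seg n, U.card = t + 2 ∧ U.powersetCard (t + 1) ⊆ minCovers n t 𝓕 ∧
      U.powersetCard (t + 1) ⊆ minCovers n t 𝓖) ∨
    (t = 1 ∧ ∃ p q r s : ℕ, p ≠ q ∧ p ≠ r ∧ p ≠ s ∧ q ≠ r ∧ q ≠ s ∧ r ≠ s ∧
      {p, r} ∈ minCovers n t 𝓕 ∧ {p, s} ∈ minCovers n t 𝓕 ∧ {q, s} ∈ minCovers n t 𝓕 ∧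
      {p, q} ∈ minCovers n t 𝓖 ∧ {p, s} ∈ minCovers n t 𝓖 ∧ {r, s} ∈ minCovers n t 𝓖) ∨
    (∃ S ⊆ seg n, S.card = t ∧ (extensions n t 𝓕 S).card = α + 2 ∧
      (extensions n t 𝓖 S).card = β + 2) ∨
    (2 ≤ t ∧ ∃ T ∈ minCovers n t 𝓕, T ∈ minCovers n t 𝓖 ∧
      ∀ i ∈ T, (extensions n t 𝓕 (T \ {i})).card = α + 2) := by
  have hA := h.genA_le hn ht
  have hH := h.genH_le hn ht hβα
  have hC := h.genC_le hn ht
  have hcr := h.inter_minCovers hn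
  have hcr' : ∀ V ∈ minCovers n t 𝓖, ∀ T ∈ minCovers n t 𝓕, t ≤ (V ∩ T).card :=
    fun V hV T hT => by rw [inter_comm]; exact hcr T hT V hV
  have hH' : β = 0 → 2 * (α + 2 + t) ≤ (minCovers n t 𝓕).card * (minCovers n t 𝓖).card := by
    rintro rfl
    exact h.genH_le_of_eq_succ hn ht
  have hmc₁ : ∀ D ∈ minCovers n t 𝓕, D ⊆ seg n ∧ D.card = t + 1 := fun D hD =>
    (mem_minCovers.1 hD).1
  have hmc₂ : ∀ D ∈ minCovers n t 𝓖, D ⊆ seg n ∧ D.card = t + 1 := fun D hD =>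
    (mem_minCovers.1 hD).1
  have hpos₁ := (h.minCovers_nonempty hn ht).card_pos
  have hpos₂ := (h.symm.minCovers_nonempty hn.symm ht).card_pos
  obtain h2 | h2 | h2 : (minCovers n t 𝓖).card = 1 ∨ (minCovers n t 𝓖).card = 2 ∨
    3 ≤ (minCovers n t 𝓖).card := by omega
  · obtain ⟨T, hT⟩ := card_eq_one.1 h2
    have hTG : T ∈ minCovers n t 𝓖 := by rw [hT]; exact mem_singleton_self T
    rw [h2, mul_one] at hA hH hC hH'
    by_cases hTF : T ∈ minCovers n t 𝓕
    · have hle := h.1.card_minCovers_le_of_mem hTF fun D hD => hcr D hD T hTG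
      rcases Nat.lt_or_ge t 2 with ht2 | ht2
      -- For `t = 1` the upper bound is `2α + 3`, less than the `2(α + 2)` that `genH` guarantees.
      · exfalso
        have hle1 := hle.1
        rw [show t + 1 = 2 by omega] at hle1
        nlinarith
      · exact Or.inr (Or.inr (Or.inr ⟨ht2, T, hTF, hTG, hle.2 hC⟩))
    · exfalso
      -- At most `2(α + 2)` covers: too few against `3(α + 2)` if `β ≥ 1`, and against `2(α + 2 +
      -- t)` if `β = 0`.
      have hle := h.1.card_minCovers_le_of_notMem (hmc₂ T hTG).1 (hmc₂ T hTG).2 hTF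
        fun D hD => hcr D hD T hTG
      have hβ : β = 0 := by
        by_contra hβ
        have : 3 * (α + 2) ≤ (β + 2) * (α + 2) := Nat.mul_le_mul_right _ (by omega)
        omega
      have := hH' hβ
      omega
  · obtain ⟨A, B, hAB, hABeq⟩ := card_eq_two.1 h2
    have hAG : A ∈ minCovers n t 𝓖 := by rw [hABeq]; simp
    have hBG : B ∈ minCovers n t 𝓖 := by rw [hABeq]; simp
    rw [h2] at hA hH hC hH'
    rcases Nat.lt_or_ge (A ∩ B).card t with hlt | hge
    · exfalso
      obtain ⟨-, p, q, r, s, -, -, -, -, -, -, hsub⟩ := subset_four_of_card_inter_lt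
        (hmc₂ A hAG).2 (hmc₂ B hBG).2 hlt (fun C hC => (hmc₁ C hC).2)
        (fun C hC => hcr C hC A hAG) (fun C hC => hcr C hC B hBG) (h.minCovers_nonempty hn ht)
      -- The product is at most `8`, below `(t + 2)² ≥ 9`.
      have := (card_le_card hsub).trans card_le_four
      nlinarith
    · have hABt : (A ∩ B).card = t :=
        le_antisymm (card_inter_le_of_ne (hmc₂ A hAG).2 (hmc₂ B hBG).2 hAB) hge
      have hSs : A ∩ B ⊆ seg n := inter_subset_left.trans (hmc₂ A hAG).1
      have hle := card_minCovers_le_of_inter (hmc₂ A hAG).2 (hmc₂ B hBG).2 hABt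
        (fun D hD => hcr D hD A hAG) (fun D hD => hcr D hD B hBG)
      have hext := h.1.card_extensions_le hSs hABt
      -- If `β ≥ 1`, then `3(α + 2) ≤ 2(α + 2 + t)` gives `α + 2 ≤ 2t`, and so `(t + 2)² ≤ 6t`,
      -- which is impossible. For `β = 0` the bound `2(α + 2 + t)` then forces equality in `hle` and
      -- `hext`.
      have hβ : β = 0 := by
        by_contra hβ
        have h3 : 3 * (α + 2) ≤ (β + 2) * (α + 2) := Nat.mul_le_mul_right _ (by omega)
        have h4 : α + 2 ≤ 2 * t := by omega
        have h5 : (t + 2) * (t + 2) ≤ 6 * t := by omega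
        zify at h5
        nlinarith [sq_nonneg ((t : ℤ) - 1)]
      have h6 := hH' hβ
      have hextG := h.1.symm.card_extensions_le hSs hABt
      have hextG' : 2 ≤ (extensions n t 𝓖 (A ∩ B)).card := by
        rw [card_extensions hABt, ← card_pair hAB]
        refine card_le_card (insert_subset ?_ (singleton_subset_iff.2 ?_))
        · exact mem_filter.2 ⟨hAG, inter_subset_left⟩
        · exact mem_filter.2 ⟨hBG, inter_subset_right⟩
      exact Or.inr (Or.inr (Or.inl ⟨A ∩ B, hSs, hABt, by omega, by omega⟩))
  obtain h1 | h1 | h1 : (minCovers n t 𝓕).card = 1 ∨ (minCovers n t 𝓕).card = 2 ∨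
    3 ≤ (minCovers n t 𝓕).card := by omega
  · exfalso
    obtain ⟨T, hT⟩ := card_eq_one.1 h1
    have hTF : T ∈ minCovers n t 𝓕 := by rw [hT]; exact mem_singleton_self T
    rw [h1, one_mul] at hA hH hC hH'
    have hsq : (β + 2) * (β + 2) ≤ (β + 2) * (α + 2) := Nat.mul_le_mul_left _ (by omega)
    by_cases hTG : T ∈ minCovers n t 𝓖
    · have hle := (h.1.symm.card_minCovers_le_of_mem hTG fun D hD => hcr' D hD T hTF).1
      -- From `(β + 2)² ≤ (t + 1)(β + 1) + 1`. The right-hand side is then at most `t²`,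
      -- contradicting `(t + 2)²`.
      have hβt : β + 2 ≤ t := by nlinarith
      nlinarith
    · have hle := h.1.symm.card_minCovers_le_of_notMem (hmc₁ T hTF).1 (hmc₁ T hTF).2 hTG
        fun D hD => hcr' D hD T hTF
      have hβ : β = 0 := by nlinarith
      subst hβ
      nlinarith
  · exfalso
    obtain ⟨A, B, hAB, hABeq⟩ := card_eq_two.1 h1
    have hAF : A ∈ minCovers n t 𝓕 := by rw [hABeq]; simp
    have hBF : B ∈ minCovers n t 𝓕 := by rw [hABeq]; simp
    rw [h1] at hA hH hC hH'
    rcases Nat.lt_or_ge (A ∩ B).card t with hlt | hge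
    · obtain ⟨-, p, q, r, s, -, -, -, -, -, -, hsub⟩ := subset_four_of_card_inter_lt
        (hmc₁ A hAF).2 (hmc₁ B hBF).2 hlt (fun C hC => (hmc₂ C hC).2)
        (fun C hC => hcr' C hC A hAF) (fun C hC => hcr' C hC B hBF)
        (h.symm.minCovers_nonempty hn.symm ht)
      have := (card_le_card hsub).trans card_le_four
      nlinarith
    · have hABt : (A ∩ B).card = t :=
        le_antisymm (card_inter_le_of_ne (hmc₁ A hAF).2 (hmc₁ B hBF).2 hAB) hge
      have hSs : A ∩ B ⊆ seg n := inter_subset_left.trans (hmc₁ A hAF).1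
      have hle := card_minCovers_le_of_inter (hmc₁ A hAF).2 (hmc₁ B hBF).2 hABt
        (fun D hD => hcr' D hD A hAF) (fun D hD => hcr' D hD B hBF)
      have hext := h.1.symm.card_extensions_le hSs hABt
      have hsq : (β + 2) * (β + 2) ≤ (β + 2) * (α + 2) := Nat.mul_le_mul_left _ (by omega)
      have h5 : (t + 2) * (t + 2) ≤ 2 * (β + 2 + t) := by omega
      have h6 : (β + 2) * (β + 2) ≤ 2 * (β + 2 + t) := by omega
      rcases Nat.eq_zero_or_pos β with hβ | hβ
      · subst hβ
        nlinarith
      · have h7 : β + 2 ≤ 2 * t := by nlinarith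
        zify at h5 h7
        nlinarith [sq_nonneg ((t : ℤ) - 1)]
  -- Both sides now have at least three covers. Two covers of `𝓖` at distance two give paths with
  -- `c₁c₂ = 9`, hence `t = 1`. Otherwise three covers of `𝓖` form either a sunflower with kernel `A
  -- ∩ B` or three subsets of the `(t+2)`-set `A ∪ B`; either shape passes to all covers of `𝓕` and
  -- back to all covers of `𝓖`, and the lower bound on `c₁c₂` makes it complete.
  by_cases hdist : ∃ A ∈ minCovers n t 𝓖, ∃ B ∈ minCovers n t 𝓖, (A ∩ B).card < t
  · obtain ⟨A, hAG, B, hBG, hlt⟩ := hdist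
    obtain ⟨c1, c2, P, hP, p, q, r, s, hpq, hpr, hps, hqr, hqs, hrs, m1, m2, m3, m4, m5, m6⟩ :=
      exists_path hAG hBG hlt (fun C hC => (hmc₁ C hC).2) (fun C hC => (hmc₂ C hC).2) hcr h1 h2
    rw [c1, c2] at hA
    have ht1 : t = 1 := by nlinarith
    have hP0 : P = ∅ := card_eq_zero.1 (by omega)
    rw [hP0] at m1 m2 m3 m4 m5 m6
    exact Or.inr (Or.inl ⟨ht1, p, q, r, s, hpq, hpr, hps, hqr, hqs, hrs, m1, m2, m3, m4, m5, m6⟩)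
  push Not at hdist
  obtain ⟨A, hAG, B, hBG, C, hCG, hAB, hAC, hBC⟩ :=
    two_lt_card.1 (show 2 < (minCovers n t 𝓖).card by omega)
  have hABt : (A ∩ B).card = t :=
    le_antisymm (card_inter_le_of_ne (hmc₂ A hAG).2 (hmc₂ B hBG).2 hAB) (hdist A hAG B hBG)
  have hSs : A ∩ B ⊆ seg n := inter_subset_left.trans (hmc₂ A hAG).1
  by_cases hSC : A ∩ B ⊆ C
  · have hextG : 3 ≤ (extensions n t 𝓖 (A ∩ B)).card := by
      have h3 : ({A, B, C} : Finset (Finset ℕ)).card = 3 :=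
        card_eq_three.2 ⟨A, B, C, hAB, hAC, hBC, rfl⟩
      rw [card_extensions hABt, ← h3]
      refine card_le_card (insert_subset ?_ (insert_subset ?_ (singleton_subset_iff.2 ?_)))
      · exact mem_filter.2 ⟨hAG, inter_subset_left⟩
      · exact mem_filter.2 ⟨hBG, inter_subset_right⟩
      · exact mem_filter.2 ⟨hCG, hSC⟩
    have hall₁ : ∀ D ∈ minCovers n t 𝓕, A ∩ B ⊆ D := fun D hD =>
      subset_of_three_le hABt disjoint_extensions hextG (hmc₁ D hD).2
        fun x hx => hcr D hD _ (mem_extensions.1 hx).2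
    have hcF : (extensions n t 𝓕 (A ∩ B)).card = (minCovers n t 𝓕).card := by
      rw [card_extensions hABt, filter_true_of_mem hall₁]
    have hall₂ : ∀ D ∈ minCovers n t 𝓖, A ∩ B ⊆ D := fun D hD =>
      subset_of_three_le hABt disjoint_extensions (hcF ▸ h1) (hmc₂ D hD).2
        fun x hx => hcr' D hD _ (mem_extensions.1 hx).2
    have hcG : (extensions n t 𝓖 (A ∩ B)).card = (minCovers n t 𝓖).card := by
      rw [card_extensions hABt, filter_true_of_mem hall₂]
    have hle₁ := h.1.card_extensions_le hSs hABt
    have hle₂ := h.1.symm.card_extensions_le hSs hABt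
    rw [hcF] at hle₁
    rw [hcG] at hle₂
    refine Or.inr (Or.inr (Or.inl ⟨A ∩ B, hSs, hABt, ?_, ?_⟩))
    · rw [hcF]
      by_contra hne
      have : (minCovers n t 𝓕).card * (minCovers n t 𝓖).card ≤ (α + 1) * (β + 2) :=
        Nat.mul_le_mul (by omega) hle₂
      nlinarith
    · rw [hcG]
      by_contra hne
      have : (minCovers n t 𝓕).card * (minCovers n t 𝓖).card ≤ (α + 2) * (β + 1) :=
        Nat.mul_le_mul hle₁ (by omega)
      nlinarith
  · obtain ⟨s, hs, hCs⟩ := exists_eq_union_sdiff (hmc₂ A hAG).2 (hmc₂ B hBG).2 hABt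
      (hmc₂ C hCG).2 (hdist C hCG A hAG) (hdist C hCG B hBG) hSC
    have hU : (A ∪ B).card = t + 2 := by
      have := card_union_add_card_inter A B
      rw [(hmc₂ A hAG).2, (hmc₂ B hBG).2] at this
      omega
    have hCU : C ⊆ A ∪ B := by rw [hCs]; exact sdiff_subset
    have hin₁ : ∀ D ∈ minCovers n t 𝓕, D ⊆ A ∪ B := fun D hD =>
      subset_of_three_subsets hU subset_union_left subset_union_right hCU (hmc₂ A hAG).2
        (hmc₂ B hBG).2 (hmc₂ C hCG).2 hAB hAC hBC (hmc₁ D hD).2 (hcr D hD A hAG)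
        (hcr D hD B hBG) (hcr D hD C hCG)
    obtain ⟨A', hA', B', hB', C', hC', hAB', hAC', hBC'⟩ :=
      two_lt_card.1 (show 2 < (minCovers n t 𝓕).card by omega)
    have hin₂ : ∀ D ∈ minCovers n t 𝓖, D ⊆ A ∪ B := fun D hD =>
      subset_of_three_subsets hU (hin₁ A' hA') (hin₁ B' hB') (hin₁ C' hC') (hmc₁ A' hA').2
        (hmc₁ B' hB').2 (hmc₁ C' hC').2 hAB' hAC' hBC' (hmc₂ D hD).2 (hcr' D hD A' hA')
        (hcr' D hD B' hB') (hcr' D hD C' hC')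
    have hs₁ : minCovers n t 𝓕 ⊆ (A ∪ B).powersetCard (t + 1) := fun D hD =>
      mem_powersetCard.2 ⟨hin₁ D hD, (hmc₁ D hD).2⟩
    have hs₂ : minCovers n t 𝓖 ⊆ (A ∪ B).powersetCard (t + 1) := fun D hD =>
      mem_powersetCard.2 ⟨hin₂ D hD, (hmc₂ D hD).2⟩
    have hc : ((A ∪ B).powersetCard (t + 1)).card = t + 2 := by
      rw [card_powersetCard, hU, Nat.choose_succ_self_right]
    have hc₁ := card_le_card hs₁
    have hc₂ := card_le_card hs₂
    rw [hc] at hc₁ hc₂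
    refine Or.inl ⟨A ∪ B, union_subset (hmc₂ A hAG).1 (hmc₂ B hBG).1, hU, ?_, ?_⟩
    · refine (eq_of_subset_of_card_le hs₁ ?_).ge
      rw [hc]
      by_contra hne
      nlinarith
    · refine (eq_of_subset_of_card_le hs₂ ?_).ge
      rw [hc]
      by_contra hne
      nlinarith

end CrossInt

/-! ### Transport to the standard models by a permutation. -/

namespace CrossInt

open Finset

variable {n k t : ℕ}

lemma exists_perm_seg {W : Finset ℕ} (hW : W ⊆ seg n) {f : ℕ → ℕ} (hf : ∀ x ∈ W, f x ∈ seg n)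
    (hinj : Set.InjOn f W) :
    ∃ σ : Equiv.Perm ℕ, (seg n).image σ = seg n ∧ ∀ x ∈ W, σ x = f x := by
  obtain ⟨g, hg⟩ := exists_equiv_extend_of_card_eq (α := {x // x ∈ seg n}) (t := seg n)
    (s := univ.filter fun x : {x // x ∈ seg n} => (x : ℕ) ∈ W) (f := fun x => f x)
    (Fintype.card_coe _) (by
      intro y hy
      obtain ⟨x, hx, rfl⟩ := mem_image.1 hy
      exact hf x (mem_filter.1 hx).2) (by
      intro x hx y hy hxy
      simp only [coe_filter, mem_univ, true_and, Set.mem_ofPred_eq] at hx hy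
      exact Subtype.ext (hinj hx hy hxy))
  refine ⟨Equiv.Perm.ofSubtype g, ?_, fun x hx => ?_⟩
  · refine eq_of_subset_of_card_le (fun y hy => ?_)
      (card_image_of_injective _ (Equiv.injective _)).ge
    obtain ⟨x, hx, rfl⟩ := mem_image.1 hy
    rw [Equiv.Perm.ofSubtype_apply_of_mem g hx]
    exact (g ⟨x, hx⟩).2
  · rw [Equiv.Perm.ofSubtype_apply_of_mem g (hW hx)]
    exact hg ⟨x, hW hx⟩ (mem_filter.2 ⟨mem_univ _, hx⟩)

lemma exists_perm_image_eq {A₁ A₂ B₁ B₂ : Finset ℕ} (hA₁ : A₁ ⊆ seg n) (hA₂ : A₂ ⊆ seg n)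
    (hB₁ : B₁ ⊆ seg n) (hB₂ : B₂ ⊆ seg n) (hA : Disjoint A₁ A₂) (hB : Disjoint B₁ B₂)
    (h₁ : A₁.card = B₁.card) (h₂ : A₂.card = B₂.card) :
    ∃ σ : Equiv.Perm ℕ, (seg n).image σ = seg n ∧ A₁.image σ = B₁ ∧ A₂.image σ = B₂ := by
  let e₁ := equivOfCardEq h₁
  let e₂ := equivOfCardEq h₂
  let f : ℕ → ℕ := fun x => if h : x ∈ A₁ then e₁ ⟨x, h⟩ else if h : x ∈ A₂ then e₂ ⟨x, h⟩ else 0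
  have f₁ : ∀ x (h : x ∈ A₁), f x = e₁ ⟨x, h⟩ := fun x h => dif_pos h
  have f₂ : ∀ x (h : x ∈ A₂), f x = e₂ ⟨x, h⟩ := fun x h => by
    simp only [f]
    rw [dif_neg fun h' => disjoint_left.1 hA h' h, dif_pos h]
  have m₁ : ∀ x ∈ A₁, f x ∈ B₁ := fun x h => by rw [f₁ x h]; exact (e₁ ⟨x, h⟩).2
  have m₂ : ∀ x ∈ A₂, f x ∈ B₂ := fun x h => by rw [f₂ x h]; exact (e₂ ⟨x, h⟩).2
  obtain ⟨σ, hσ, hσf⟩ := exists_perm_seg (f := f) (union_subset hA₁ hA₂) (by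
    intro x hx
    rcases mem_union.1 hx with h | h
    · exact hB₁ (m₁ x h)
    · exact hB₂ (m₂ x h)) (by
    intro x hx y hy hxy
    rw [mem_coe, mem_union] at hx hy
    rcases hx with hx | hx <;> rcases hy with hy | hy
    · rw [f₁ x hx, f₁ y hy] at hxy
      simpa using e₁.injective (Subtype.ext hxy)
    · exact absurd (hxy ▸ m₂ y hy) (disjoint_left.1 hB (m₁ x hx))
    · exact absurd (hxy ▸ m₂ x hx) (disjoint_left.1 hB (m₁ y hy))
    · rw [f₂ x hx, f₂ y hy] at hxy
      simpa using e₂.injective (Subtype.ext hxy))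
  refine ⟨σ, hσ, ?_, ?_⟩
  · refine eq_of_subset_of_card_le (fun y hy => ?_) ?_
    · obtain ⟨x, hx, rfl⟩ := mem_image.1 hy
      rw [hσf x (mem_union_left _ hx)]
      exact m₁ x hx
    · rw [card_image_of_injective _ σ.injective, h₁]
  · refine eq_of_subset_of_card_le (fun y hy => ?_) ?_
    · obtain ⟨x, hx, rfl⟩ := mem_image.1 hy
      rw [hσf x (mem_union_right _ hx)]
      exact m₂ x hx
    · rw [card_image_of_injective _ σ.injective, h₂]

section PermFamily

variable {σ : Equiv.Perm ℕ}

lemma image_perm_mem_layer (hσ : (seg n).image σ = seg n) {F : Finset ℕ} :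
    F.image σ ∈ layer n k ↔ F ∈ layer n k := by
  rw [mem_layer, mem_layer, card_image_of_injective _ σ.injective]
  nth_rewrite 1 [← hσ]
  rw [image_subset_image_iff σ.injective]

lemma permFamily_union (𝓕 𝓖 : Finset (Finset ℕ)) :
    permFamily σ (𝓕 ∪ 𝓖) = permFamily σ 𝓕 ∪ permFamily σ 𝓖 := image_union _ _

lemma permFamily_filter (hσ : (seg n).image σ = seg n) {p q : Finset ℕ → Prop}
    [DecidablePred p] [DecidablePred q] (hpq : ∀ F, q (F.image σ) ↔ p F) :
    permFamily σ ((layer n k).filter p) = (layer n k).filter q := by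
  ext G
  have hG : (G.image σ.symm).image σ = G := by
    rw [image_image, σ.self_comp_symm, image_id]
  constructor
  · intro h
    obtain ⟨F, hF, rfl⟩ := mem_image.1 h
    rw [mem_filter] at hF ⊢
    exact ⟨(image_perm_mem_layer hσ).2 hF.1, (hpq F).2 hF.2⟩
  · intro h
    rw [mem_filter, ← hG, image_perm_mem_layer hσ, hpq] at h
    exact mem_image.2 ⟨_, mem_filter.2 h, hG⟩

lemma card_image_inter_image (F U : Finset ℕ) : (F.image σ ∩ U.image σ).card = (F ∩ U).card := by
  rw [← image_inter _ _ σ.injective, card_image_of_injective _ σ.injective]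

lemma permFamily_star (hσ : (seg n).image σ = seg n) (S : Finset ℕ) :
    permFamily σ (star n k S) = star n k (S.image σ) :=
  permFamily_filter hσ fun _ => image_subset_image_iff σ.injective

lemma permFamily_genA (hσ : (seg n).image σ = seg n) (U : Finset ℕ) :
    permFamily σ (genA n k t U) = genA n k t (U.image σ) :=
  permFamily_filter hσ fun F => by rw [card_image_inter_image]

lemma permFamily_image_sdiff (S X : Finset ℕ) :
    permFamily σ (S.image fun i => (X ∪ S) \ {i}) =
      (S.image σ).image fun i => (X.image σ ∪ S.image σ) \ {i} := by
  unfold permFamily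
  rw [image_image, image_image]
  refine image_congr fun i _ => ?_
  simp [image_sdiff _ _ σ.injective, image_union]

lemma permFamily_genH (hσ : (seg n).image σ = seg n) (S X Y : Finset ℕ) :
    permFamily σ (genH n k S X Y) = genH n k (S.image σ) (X.image σ) (Y.image σ) := by
  unfold genH
  rw [permFamily_union, permFamily_image_sdiff]
  congr 1
  exact permFamily_filter hσ fun F => by
    rw [card_image_inter_image, image_subset_image_iff σ.injective]

lemma permFamily_genC₁ (hσ : (seg n).image σ = seg n) (T X : Finset ℕ) :
    permFamily σ (genC₁ n k T X) = genC₁ n k (T.image σ) (X.image σ) := by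
  unfold genC₁
  rw [permFamily_union, permFamily_image_sdiff, permFamily_star hσ]

lemma permFamily_genC₂ (hσ : (seg n).image σ = seg n) (T X : Finset ℕ) :
    permFamily σ (genC₂ n k t T X) = genC₂ n k t (T.image σ) (X.image σ) := by
  unfold genC₂
  rw [permFamily_union, permFamily_star hσ]
  congr 1
  exact permFamily_filter hσ fun F => by rw [card_image_inter_image, card_image_inter_image]

end PermFamily

lemma genC₁_seg (n l t : ℕ) (h : t ≤ l) :
    genC₁ n l (seg (t + 1)) (Icc (t + 2) (l + 1)) = famC₁ n l t := by
  have : Icc (t + 2) (l + 1) ∪ seg (t + 1) = seg (l + 1) := by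
    ext x
    simp only [mem_union, mem_Icc]
    omega
  rw [genC₁, famC₁, this]

variable {l : ℕ} {𝓕 𝓖 : Finset (Finset ℕ)}

lemma seg_subset_seg {m : ℕ} (h : m ≤ n) : seg m ⊆ seg n := Icc_subset_Icc_right h

lemma pairIso_famA {U : Finset ℕ} (hU : U ⊆ seg n) (hUc : U.card = t + 2) :
    PairIso n (genA n k t U) (genA n l t U) (famA n k t) (famA n l t) := by
  have hle : t + 2 ≤ n := by rw [← hUc, ← card_seg n]; exact card_le_card hU
  obtain ⟨σ, hσ, h, -⟩ := exists_perm_image_eq (A₂ := ∅) (B₂ := ∅) (B₁ := seg (t + 2)) hU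
    (empty_subset _) (seg_subset_seg hle) (empty_subset _) (disjoint_empty_right _)
    (disjoint_empty_right _) (by rw [hUc, card_seg]) rfl
  refine ⟨σ, hσ, ?_, ?_⟩
  · rw [permFamily_genA hσ, h]; rfl
  · rw [permFamily_genA hσ, h]; rfl

lemma pairIso_famC {T X : Finset ℕ} (hT : T ⊆ seg n) (hX : X ⊆ seg n) (hd : Disjoint X T)
    (hTc : T.card = t + 1) (hXc : X.card + t = k) (hn : k + 1 ≤ n) :
    PairIso n (genC₁ n k T X) (genC₂ n l t T X) (famC₁ n k t) (famC₂ n l t k) := by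
  obtain ⟨σ, hσ, h₁, h₂⟩ := exists_perm_image_eq (B₁ := seg (t + 1)) (B₂ := Icc (t + 2) (k + 1))
    hT hX (seg_subset_seg (by omega)) (Icc_subset_Icc (by omega) hn) hd.symm
    (disjoint_left.2 fun x h h' => by simp only [mem_Icc] at h h'; omega)
    (by rw [hTc, card_seg]) (by rw [Nat.card_Icc]; omega)
  refine ⟨σ, hσ, ?_, ?_⟩
  · rw [permFamily_genC₁ hσ, h₁, h₂, genC₁_seg _ _ _ (by omega)]
  · rw [permFamily_genC₂ hσ, h₁, h₂]; rfl

/-- Only `S` has to be moved to `[t]`; the sets `X` and `Y` are arbitrary in the model and are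
carried along. -/
lemma pairIso_famH {S X Y : Finset ℕ} (hS : S ⊆ seg n) (hSc : S.card = t) (hX : X ⊆ seg n)
    (hY : Y ⊆ seg n) (hdX : Disjoint X S) (hdY : Disjoint Y S) :
    ∃ X' ∈ (Icc (t + 1) n).powersetCard X.card, ∃ Y' ∈ (Icc (t + 1) n).powersetCard Y.card,
      (X' ∩ Y').card = (X ∩ Y).card ∧
        PairIso n (genH n k S X Y) (genH n l S Y X) (famH n k t X' Y') (famH n l t Y' X') := by
  have hle : t ≤ n := by rw [← hSc, ← card_seg n]; exact card_le_card hS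
  obtain ⟨σ, hσ, h, -⟩ := exists_perm_image_eq (A₂ := ∅) (B₂ := ∅) (B₁ := seg t) hS
    (empty_subset _) (seg_subset_seg hle) (empty_subset _) (disjoint_empty_right _)
    (disjoint_empty_right _) (by rw [hSc, card_seg]) rfl
  have key : ∀ Z : Finset ℕ, Z ⊆ seg n → Disjoint Z S →
      Z.image σ ∈ (Icc (t + 1) n).powersetCard Z.card := by
    intro Z hZ hd
    refine mem_powersetCard.2 ⟨fun y hy => ?_, card_image_of_injective _ σ.injective⟩
    have h1 : y ∈ seg n := by rw [← hσ]; exact image_subset_image hZ hy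
    have h2 : y ∉ seg t := by
      rw [← h]
      exact disjoint_left.1 ((disjoint_image σ.injective).2 hd) hy
    simp only [mem_Icc] at h1 h2 ⊢
    omega
  refine ⟨X.image σ, key X hX hdX, Y.image σ, key Y hY hdY, card_image_inter_image X Y, σ, hσ,
    ?_, ?_⟩
  · rw [permFamily_genH hσ, h]; rfl
  · rw [permFamily_genH hσ, h]; rfl

lemma pairIso_famB (hn : 4 ≤ n) {p q r s : ℕ} (hpq : p ≠ q) (hpr : p ≠ r) (hps : p ≠ s)
    (hqr : q ≠ r) (hqs : q ≠ s) (hrs : r ≠ s) (hp : p ∈ seg n) (hq : q ∈ seg n) (hr : r ∈ seg n)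
    (hs : s ∈ seg n) :
    PairIso n (star n k {p, q} ∪ star n k {p, s} ∪ star n k {r, s})
      (star n l {p, r} ∪ star n l {p, s} ∪ star n l {q, s})
      (famB n k 1 3 2 4) (famB n l 1 2 3 4) := by
  -- The path `q–p–s–r` of the first family goes to `1–3–2–4`, and the path `q–s–p–r` of the second
  -- to `1–2–3–4`.
  let f : ℕ → ℕ := fun x => if x = q then 1 else if x = p then 3 else if x = s then 2 else 4
  have fq : f q = 1 := by simp [f]
  have fp : f p = 3 := by simp [f, hpq]
  have fs : f s = 2 := by simp [f, hqs.symm, hps.symm]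
  have fr : f r = 4 := by simp [f, hqr.symm, hpr.symm, hrs]
  obtain ⟨σ, hσ, h⟩ := exists_perm_seg (W := {p, q, r, s}) (f := f)
    (insert_subset hp (insert_subset hq (insert_subset hr (singleton_subset_iff.2 hs))))
    (by
      intro x hx
      simp only [mem_insert, mem_singleton] at hx
      rw [mem_Icc]
      rcases hx with rfl | rfl | rfl | rfl
      · omega
      · omega
      · omega
      · omega)
    (by
      intro x hx y hy hxy
      simp only [coe_insert, coe_singleton, Set.mem_insert_iff, Set.mem_singleton_iff] at hx hy
      rcases hx with rfl | rfl | rfl | rfl <;> rcases hy with rfl | rfl | rfl | rfl <;>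
        first | rfl | omega)
  have hσp : σ p = 3 := by rw [h p (by simp), fp]
  have hσq : σ q = 1 := by rw [h q (by simp), fq]
  have hσr : σ r = 4 := by rw [h r (by simp), fr]
  have hσs : σ s = 2 := by rw [h s (by simp), fs]
  refine ⟨σ, hσ, ?_, ?_⟩
  · simp only [permFamily_union, permFamily_star hσ, image_insert, image_singleton, hσp, hσq, hσr,
      hσs, famB]
    rw [pair_comm 3 1, pair_comm 4 2]
  · simp only [permFamily_union, permFamily_star hσ, image_insert, image_singleton, hσp, hσq, hσr,
      hσs, famB]
    rw [pair_comm 3 2, union_comm, union_comm (star n l {3, 4}), union_assoc]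

end CrossInt

/-! ### The main theorem. -/

open CrossInt
theorem theorem1p1 (n k₁ k₂ t : ℕ) (ht : 1 ≤ t) (hk₂ : t + 1 ≤ k₂) (hk₁ : k₂ ≤ k₁)
    (hn : (t + 1) ^ 2 * (k₁ + k₂) ^ 2 * (k₁ - t + 1) * (k₂ - t + 1) + (k₁ + k₂ - t) ≤ n)
    (𝓕₁ 𝓕₂ : Finset (Finset ℕ)) (hmax : IsExtremal n k₁ k₂ t 𝓕₁ 𝓕₂) :
    (2 ≤ t →
      PairIso n 𝓕₁ 𝓕₂ (famA n k₁ t) (famA n k₂ t) ∨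
      PairIso n 𝓕₁ 𝓕₂ (famC₁ n k₁ t) (famC₂ n k₂ t k₁) ∨
      ∃ X ∈ (Finset.Icc (t + 1) n).powersetCard (k₁ - t + 1),
        ∃ Y ∈ (Finset.Icc (t + 1) n).powersetCard (k₂ - t + 1),
          2 ≤ (X ∩ Y).card ∧ PairIso n 𝓕₁ 𝓕₂ (famH n k₁ t X Y) (famH n k₂ t Y X)) ∧
    (t = 1 →
      PairIso n 𝓕₁ 𝓕₂ (famA n k₁ 1) (famA n k₂ 1) ∨
      PairIso n 𝓕₁ 𝓕₂ (famB n k₁ 1 3 2 4) (famB n k₂ 1 2 3 4) ∨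
      ∃ X ∈ (Finset.Icc 2 n).powersetCard k₁,
        ∃ Y ∈ (Finset.Icc 2 n).powersetCard k₂,
          1 ≤ (X ∩ Y).card ∧ PairIso n 𝓕₁ 𝓕₂ (famH n k₁ 1 X Y) (famH n k₂ 1 Y X)) := by
  obtain ⟨α, rfl⟩ : ∃ α, k₁ = t + (α + 1) := ⟨k₁ - t - 1, by omega⟩
  obtain ⟨β, rfl⟩ : ∃ β, k₂ = t + (β + 1) := ⟨k₂ - t - 1, by omega⟩
  have hL : LargeGround n t α β := by
    unfold LargeGround
    rwa [show t + (α + 1) + (t + (β + 1)) = 2 * t + α + β + 2 by ring,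
      show t + (α + 1) - t + 1 = α + 2 by omega, show t + (β + 1) - t + 1 = β + 2 by omega,
      show 2 * t + α + β + 2 - t = t + α + β + 2 by omega] at hn
  have h0 := hL.add_le
  rcases hmax.minCovers_classification hL ht (by omega) with ⟨U, hU, hUc, hU₁, hU₂⟩ |
    ⟨rfl, p, q, r, s, hpq, hpr, hps, hqr, hqs, hrs, m1, m2, m3, m4, m5, m6⟩ |
    ⟨S, hS, hSc, hX, hY⟩ | ⟨ht2, T, hT₁, hT₂, hE⟩
  · obtain ⟨rfl, rfl⟩ := hmax.eq_genA hL ht hU hUc hU₁ hU₂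
    refine ⟨fun _ => Or.inl (pairIso_famA hU hUc), ?_⟩
    rintro rfl
    exact Or.inl (pairIso_famA hU hUc)
  · refine ⟨fun h => absurd h (by omega), fun _ => Or.inr (Or.inl ?_)⟩
    -- The covers of one family give the stars of the other, so for `𝓕₁` the letters `q` and `r` are
    -- interchanged.
    rw [hmax.eq_star_union (by omega) m1 m2 m3 m4 m5 m6,
      hmax.symm.eq_star_union (by omega) m4 m5 m6 m1 m2 m3]
    have hm₁ := (mem_minCovers.1 m1).1.1
    have hm₂ := (mem_minCovers.1 m3).1.1
    rw [Finset.insert_subset_iff, Finset.singleton_subset_iff] at hm₁ hm₂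
    exact pairIso_famB (by omega) hpq hpr hps hqr hqs hrs hm₁.1 hm₂.1 hm₁.2 hm₂.2
  · obtain ⟨X, Y, hXs, hYs, hdX, hdY, hXc, hYc, hXY, rfl, rfl⟩ :=
      hmax.eq_genH hL ht hS hSc hX hY
    obtain ⟨X', hX', Y', hY', hcap, hiso⟩ :=
      pairIso_famH (k := t + (α + 1)) (l := t + (β + 1)) hS hSc hXs hYs hdX hdY
    rw [hXc] at hX'
    rw [hYc] at hY'
    rw [← hcap] at hXY
    refine ⟨fun ht2 => Or.inr (Or.inr ⟨X', ?_, Y', ?_, by omega, hiso⟩), ?_⟩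
    · rwa [show t + (α + 1) - t + 1 = α + 2 by omega]
    · rwa [show t + (β + 1) - t + 1 = β + 2 by omega]
    · rintro rfl
      refine Or.inr (Or.inr ⟨X', ?_, Y', ?_, by omega, hiso⟩)
      · rwa [show 1 + (α + 1) = α + 2 by ring]
      · rwa [show 1 + (β + 1) = β + 2 by ring]
  · obtain ⟨X, hXs, hd, hXc, rfl, rfl⟩ := hmax.eq_genC hL ht2 hT₁ hT₂ hE
    obtain ⟨hTs, hTc⟩ := (mem_minCovers.1 hT₁).1
    exact ⟨fun _ => Or.inr (Or.inl (pairIso_famC hTs hXs hd hTc (by omega) (by omega))),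
      fun h => absurd h (by omega)⟩
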